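/- Let $(A_k)_{k\ge 1}$ and $(B_k)_{k\ge 1}$ be real random variables on a probability space $\Omega$ such that the whole family $A_1,B_1,A_2,B_2,\dots$ is independent and identically distributed, with mean $0$, variance $1$ and $\mathbb{E}\,e^{\lambda A_1}<\infty$ for all $\lambda\in\mathbf{R}$. For $x\in I=[0,1]$ put $$X_k(x)=\frac{1}{\sqrt{k}}\big(A_k\cos(2\pi kx)+B_k\sin(2\pi kx)\big),\qquad k\ge 1,$$ and for $f\in C(I,\mathbf{C})$, $\beta\in\mathbf{C}$ and $n\ge 0$ put $$\mu_n(f;\beta)=\int_0^1 f(x)\,\frac{e^{\beta\sum_{k=1}^n X_k(x)}}{\mathbb{E}\,e^{\beta\sum_{k=1}^n X_k(x)}}\,dx .$$ Then there exists an open set $U\subset\mathbf{C}$ containing the interval $(0,\sqrt{2})$ such that: 1. For all $\beta\in U$, $n\ge 0$ and $x\in I$ we have $\mathbb{E}\,e^{\beta\sum_{k=1}^n X_k(x)}\neq 0$, and for all $\beta\in U$ and $f\in C(I,\mathbf{C})$ the sequence $(\mu_n(f;\beta))_{n\ge 0}$ is a martingale with respect to the filtration $\sigma(A_1,B_1,\dots,A_n,B_n)$.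 2. There are random variables $\mu(f;\beta)$, for $f\in C(I,\mathbf{C})$ and $\beta\in U$, such that for every compact $K\subset U$ there exists $p>1$ for which $\mu_n(f;\beta)\to\mu(f;\beta)$ in $L^p(\Omega)$ as $n\to\infty$, for all $\beta\in K$ and all $f\in C(I,\mathbf{C})$. 3. For each fixed $f\in C(I,\mathbf{C})$, almost surely the maps $\beta\mapsto\mu_n(f;\beta)$ converge uniformly on compact subsets of $U$ to the map $\beta\mapsto\mu(f;\beta)$, which is analytic on $U$. -/

import Mathlib

open MeasureTheory ProbabilityTheory Filter Topology

namespace FourierChaos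

variable {Ω : Type*}

/-- The terms of the random Fourier series. Lean's index `k : ℕ` is the mathematical index `k + 1`:
`A k`, `B k` stand for `A_{k+1}`, `B_{k+1}`, and `field A B k x` is
`X_{k+1}(x) = (k+1)^{-1/2} (A_{k+1} cos (2π(k+1)x) + B_{k+1} sin (2π(k+1)x))`. -/
noncomputable def field (A B : ℕ → Ω → ℝ) (k : ℕ) (x : unitInterval) (ω : Ω) : ℝ :=
  1 / √((k : ℝ) + 1) *
    (A k ω * Real.cos (2 * Real.pi * ((k : ℝ) + 1) * (x : ℝ)) +
      B k ω * Real.sin (2 * Real.pi * ((k : ℝ) + 1) * (x : ℝ)))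

/-- The partial sum `X_1(x) + ⋯ + X_n(x)`. -/
noncomputable def partialField (A B : ℕ → Ω → ℝ) (n : ℕ) (x : unitInterval) (ω : Ω) : ℝ :=
  ∑ k ∈ Finset.range n, field A B k x ω

variable [MeasurableSpace Ω]

/-- The normalizing factor `𝔼 exp (β (X_1(x) + ⋯ + X_n(x)))`. -/
noncomputable def normalizer (P : Measure Ω) (A B : ℕ → Ω → ℝ) (β : ℂ) (n : ℕ)
    (x : unitInterval) : ℂ :=
  ∫ ω, Complex.exp (β * (partialField A B n x ω : ℂ)) ∂P

/-- `μ_n(f; β) = ∫_{[0,1]} f(x) exp (β ∑_{k ≤ n} X_k(x)) / 𝔼 exp (β ∑_{k ≤ n} X_k(x)) dx`,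
the integral being with respect to Lebesgue measure. -/
noncomputable def chaos (P : Measure Ω) (A B : ℕ → Ω → ℝ) (f : C(unitInterval, ℂ)) (β : ℂ)
    (n : ℕ) (ω : Ω) : ℂ :=
  ∫ x : unitInterval,
    f x * (Complex.exp (β * (partialField A B n x ω : ℂ)) / normalizer P A B β n x)

/-- The filtration `ℱ_n = σ(A_1, B_1, …, A_n, B_n)`, which is also `σ(X_1, …, X_n)`. -/
def coeffFiltration (A B : ℕ → Ω → ℝ) (hA : ∀ k, Measurable (A k)) (hB : ∀ k, Measurable (B k)) :
    Filtration ℕ (inferInstance : MeasurableSpace Ω) where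
  seq n := ⨆ k, ⨆ _ : k < n,
    MeasurableSpace.comap (A k) inferInstance ⊔ MeasurableSpace.comap (B k) inferInstance
  mono' _ _ hmn := iSup_mono fun _ => iSup_mono' fun hk => ⟨lt_of_lt_of_le hk hmn, le_rfl⟩
  le' _ := iSup_le fun k => iSup_le fun _ => sup_le (hA k).comap_le (hB k).comap_le

end FourierChaos

/-! The threshold `√2` comes from a moment computation. Let `M` be the normalized exponential of the
first `m` terms and `R` that of the terms `m ≤ k < n`. They are independent, `R` has mean one, and
`M * R` is the normalized exponential of the first `n` terms; this gives the martingale property.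
The logarithm of the moment generating function is `z² / 2 + O(|z|³)` near `0`, and the cubes of the
coefficients are summable. So the law of the coefficients matters only up to bounded factors, and `𝔼
|M(x)|^q` is at most a constant times `m ^ momentExponent q β`, as in the Gaussian case. At a real
parameter `b` the exponent is `q (q - 1) b² / 2`; it is smaller than `q - 1` for some `q > 1`
exactly when `b² < 2`. By continuity the strict inequality survives on a disc around `b`, and `U` is
the union of such discs.

On a dyadic block `m ≤ n ≤ 2m` the increment is `∫ f M (R - 1)`. The kernel `𝔼 R(x) conj R(y) - 1`
is bounded, because the block has bounded variance. It is small when `x` and `y` are far apart on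
the circle, because the covariance `∑ cos (2πk(x - y)) / k` then oscillates. Second moments alone
would not reach `√2`, so `M` is truncated at height `m`. The truncated part is estimated in `L²`,
with a weight depending on the past because only the first moment of `∫ |f M|` is used. The excess
is estimated in `L¹` through the `p`-th moment. Together they give an `L¹` bound `m ^ (-c)`
(`exists_lintegral_chaos_sub_le`). Interpolation with the at most linear growth of the `p`-th
moments makes the increments decay in `Lʳ` for some `r > 1`, and summing over dyadic blocks gives a
Cauchy sequence, uniformly on the disc (`exists_uniform_cauchy`).

For almost sure convergence, each `μ_n` is holomorphic in `β`. Cauchy's formula bounds the supremum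
of an increment over a disc by its mean modulus on a larger circle. That mean is a nonnegative
submartingale, so Doob's inequality turns the `L¹` bounds into uniform convergence
(`ae_uniformCauchySeqOn_chaos`), and the limit inherits holomorphy. -/

namespace FourierChaos

/-! ### The complex moment generating function near the real axis -/

section MomentGeneratingFunction

variable {Ω : Type*} [MeasurableSpace Ω] {P : Measure Ω} {X : Ω → ℝ}

lemma differentiable_complexMGF (hX : ∀ t : ℝ, Integrable (fun ω => Real.exp (t * X ω)) P) :
    Differentiable ℂ (complexMGF X P) := fun z => by
  have huniv : integrableExpSet X P = Set.univ := Set.eq_univ_of_forall hX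
  exact (hasDerivAt_complexMGF (z := z) (by simp [huniv])).differentiableAt

lemma integrable_exp_mul_ofReal (hm : Measurable X)
    (hX : ∀ t : ℝ, Integrable (fun ω => Real.exp (t * X ω)) P) (z : ℂ) :
    Integrable (fun ω => Complex.exp (z * X ω)) P := by
  refine Integrable.mono' (hX z.re) (by fun_prop) (ae_of_all _ fun ω => ?_)
  rw [Complex.norm_exp]
  simp

/-- This is the Taylor bound `|exp w - 1 - w - w² / 2| ≤ |w|³ exp |w|` at `w = zX`, integrated; mean
`0` and variance `1` fix the coefficients. -/
lemma complexMGF_taylor [IsProbabilityMeasure P] (hm : Measurable X)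
    (hX : ∀ t : ℝ, Integrable (fun ω => Real.exp (t * X ω)) P)
    (hmean : ∫ ω, X ω ∂P = 0) (hvar : variance X P = 1) :
    ∃ C : ℝ, 0 ≤ C ∧ ∀ z : ℂ, ‖z‖ ≤ 1 → ‖complexMGF X P z - 1 - z ^ 2 / 2‖ ≤ C * ‖z‖ ^ 3 := by
  have habs : Integrable (fun ω => Real.exp (2 * |X ω|)) P :=
    integrable_exp_mul_abs (hX 2) (by simpa using hX (-2))
  have hset : (0 : ℝ) ∈ interior (integrableExpSet X P) := by
    have : integrableExpSet X P = Set.univ := Set.eq_univ_of_forall hX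
    simp [this]
  have hL2 : MemLp X 2 P := memLp_of_mem_interior_integrableExpSet hset 2
  have hint1 : Integrable X P := hL2.integrable (by norm_num)
  have hsq : Integrable (fun ω => X ω ^ 2) P := hL2.integrable_sq
  have hsq1 : ∫ ω, X ω ^ 2 ∂P = 1 := by
    rw [variance_of_integral_eq_zero hm.aemeasurable hmean] at hvar
    simpa using hvar
  -- One factor `exp |X|`, with `6 = 3!`, pays for `|X|³`; the other pays for `exp (‖z‖ |X|)`.
  refine ⟨∫ ω, 6 * Real.exp (2 * |X ω|) ∂P, integral_nonneg fun ω => by positivity,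
    fun z hz => ?_⟩
  have e1 : complexMGF X P z - 1 - z ^ 2 / 2 =
      ∫ ω, (Complex.exp (z * X ω) - (1 + z * X ω + z ^ 2 / 2 * ((X ω ^ 2 : ℝ) : ℂ))) ∂P := by
    have i0 : Integrable (fun _ : Ω => (1 : ℂ)) P := integrable_const _
    have i1 : Integrable (fun ω => z * (X ω : ℂ)) P := hint1.ofReal.const_mul z
    have i2 : Integrable (fun ω => z ^ 2 / 2 * ((X ω ^ 2 : ℝ) : ℂ)) P :=
      hsq.ofReal.const_mul _
    have i01 : Integrable (fun ω => 1 + z * (X ω : ℂ)) P := i0.add i1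
    have i012 : Integrable (fun ω => 1 + z * (X ω : ℂ) + z ^ 2 / 2 * ((X ω ^ 2 : ℝ) : ℂ)) P :=
      i01.add i2
    rw [integral_sub (integrable_exp_mul_ofReal hm hX z) i012, integral_add i01 i2,
      integral_add i0 i1, integral_const_mul, integral_const_mul, integral_complex_ofReal, hmean,
      integral_complex_ofReal, hsq1]
    simp only [complexMGF, integral_const, probReal_univ]
    simp
    ring
  rw [e1, mul_comm, ← integral_const_mul]
  refine norm_integral_le_of_norm_le ((habs.const_mul 6).const_mul _) (ae_of_all _ fun ω => ?_)
  have h3 := Complex.norm_exp_sub_sum_le_norm_mul_exp (z * X ω) 3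
  have hsum : ∑ m ∈ Finset.range 3, (z * X ω : ℂ) ^ m / (m.factorial : ℂ) =
      1 + z * X ω + z ^ 2 / 2 * ((X ω ^ 2 : ℝ) : ℂ) := by
    simp [Finset.sum_range_succ, Nat.factorial]
    ring
  rw [hsum] at h3
  refine h3.trans ?_
  have hn : ‖z * (X ω : ℂ)‖ = ‖z‖ * |X ω| := by simp
  rw [hn, mul_pow, mul_assoc]
  refine mul_le_mul_of_nonneg_left ?_ (by positivity)
  have h4 : |X ω| ^ 3 ≤ 6 * Real.exp |X ω| := by
    have := Real.pow_div_factorial_le_exp |X ω| (abs_nonneg _) 3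
    rw [div_le_iff₀ (by positivity)] at this
    norm_num [Nat.factorial] at this
    linarith
  calc |X ω| ^ 3 * Real.exp (‖z‖ * |X ω|) ≤ (6 * Real.exp |X ω|) * Real.exp (1 * |X ω|) := by
        gcongr
    _ = 6 * Real.exp (2 * |X ω|) := by
        rw [mul_assoc, ← Real.exp_add]; ring_nf

/-- With the error in the exponent, products over the index become sums of cubic errors. -/
lemma complexMGF_eq_exp [IsProbabilityMeasure P] (hm : Measurable X)
    (hX : ∀ t : ℝ, Integrable (fun ω => Real.exp (t * X ω)) P)
    (hmean : ∫ ω, X ω ∂P = 0) (hvar : variance X P = 1) :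
    ∃ ρ : ℝ, 0 < ρ ∧ ∃ C : ℝ, 0 ≤ C ∧ ∀ z : ℂ, ‖z‖ ≤ ρ →
      ∃ h : ℂ, complexMGF X P z = Complex.exp (z ^ 2 / 2 + h) ∧ ‖h‖ ≤ C * ‖z‖ ^ 3 := by
  obtain ⟨C, hC, hT⟩ := complexMGF_taylor hm hX hmean hvar
  -- This radius forces `‖w‖ ≤ 1/2`, well inside the disc where the principal logarithm of `1 + w`
  -- is under control.
  set ρ : ℝ := 1 / (2 * (C + 1)) with hρ
  have hρ0 : 0 < ρ := by positivity
  have hρ1 : ρ ≤ 1 / 2 := by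
    rw [hρ]; apply one_div_le_one_div_of_le <;> linarith
  have hCρ : (C + 1) * ρ = 1 / 2 := by rw [hρ]; field_simp
  refine ⟨ρ, hρ0, (C + 1) ^ 2 + C, by positivity, fun z hz => ?_⟩
  have hz1 : ‖z‖ ≤ 1 := by linarith
  set w := complexMGF X P z - 1 with hw
  have hTz := hT z hz1
  rw [← hw] at hTz
  have hz3 : ‖z‖ ^ 3 ≤ ‖z‖ ^ 2 := pow_le_pow_of_le_one (norm_nonneg _) hz1 (by norm_num)
  have hwn : ‖w‖ ≤ (C + 1) * ‖z‖ ^ 2 := by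
    have : ‖w‖ ≤ ‖w - z ^ 2 / 2‖ + ‖z ^ 2 / 2‖ := by
      have := norm_add_le (w - z ^ 2 / 2) (z ^ 2 / 2)
      rwa [sub_add_cancel] at this
    have h2 : ‖z ^ 2 / 2‖ = ‖z‖ ^ 2 / 2 := by simp
    nlinarith [sq_nonneg ‖z‖]
  have hwhalf : ‖w‖ ≤ 1 / 2 := by
    have : (C + 1) * ‖z‖ ^ 2 ≤ (C + 1) * ρ := by
      gcongr
      calc ‖z‖ ^ 2 = ‖z‖ * ‖z‖ := sq _
        _ ≤ ρ * 1 := by gcongr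
        _ = ρ := mul_one _
    linarith
  have hlog := Complex.norm_log_one_add_sub_self_le (z := w) (by linarith)
  have hlog2 : ‖Complex.log (1 + w) - w‖ ≤ ‖w‖ ^ 2 := by
    have : (1 - ‖w‖)⁻¹ ≤ 2 := by
      rw [inv_le_comm₀ (by linarith) (by norm_num)]; linarith
    nlinarith [sq_nonneg ‖w‖]
  have hne : (1 + w) ≠ 0 := by
    intro h0
    have : w = -1 := by linear_combination h0
    rw [this] at hwhalf; norm_num at hwhalf
  refine ⟨Complex.log (1 + w) - z ^ 2 / 2, ?_, ?_⟩
  · rw [add_sub_cancel, Complex.exp_log hne, hw]; ring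
  · have e : Complex.log (1 + w) - z ^ 2 / 2 =
        (Complex.log (1 + w) - w) + (w - z ^ 2 / 2) := by ring
    rw [e]
    have h4 : ‖w‖ ^ 2 ≤ (C + 1) ^ 2 * ‖z‖ ^ 3 := by
      calc ‖w‖ ^ 2 ≤ ((C + 1) * ‖z‖ ^ 2) ^ 2 := by gcongr
        _ = (C + 1) ^ 2 * ‖z‖ ^ 4 := by ring
        _ ≤ (C + 1) ^ 2 * ‖z‖ ^ 3 :=
          mul_le_mul_of_nonneg_left
            (pow_le_pow_of_le_one (norm_nonneg _) hz1 (by norm_num)) (by positivity)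
    have := norm_add_le (Complex.log (1 + w) - w) (w - z ^ 2 / 2)
    nlinarith

/-- The function is positive on the real axis, so by compactness it has no zero in a thin strip
around `[-R, R]`. For `‖z‖ ≤ ρ` the local expansion gives the cubic bound; beyond, compactness
bounds the left side and `‖z‖³ ≥ ρ³` absorbs the bound. Only the logarithm of the modulus occurs, so
no branch has to be chosen. -/
lemma exists_strip_log_norm_complexMGF [IsProbabilityMeasure P] (hm : Measurable X)
    (hX : ∀ t : ℝ, Integrable (fun ω => Real.exp (t * X ω)) P)
    (hmean : ∫ ω, X ω ∂P = 0) (hvar : variance X P = 1) (R : ℝ) :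
    ∃ ε : ℝ, 0 < ε ∧ ∃ C : ℝ, 0 ≤ C ∧ ∀ z : ℂ, |z.re| ≤ R → |z.im| ≤ ε →
      complexMGF X P z ≠ 0 ∧
        |Real.log ‖complexMGF X P z‖ - (z ^ 2).re / 2| ≤ C * ‖z‖ ^ 3 := by
  obtain ⟨ρ, hρ, C, hC, hexp⟩ := complexMGF_eq_exp hm hX hmean hvar
  have hcont : Continuous (complexMGF X P) := (differentiable_complexMGF hX).continuous
  -- nonvanishing near the real segment
  have hopen : IsOpen {z | complexMGF X P z ≠ 0} := isOpen_ne_fun hcont continuous_const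
  have hseg : IsCompact ((fun t : ℝ => (t : ℂ)) '' Set.Icc (-R) R) :=
    isCompact_Icc.image Complex.continuous_ofReal
  have hsub : ((fun t : ℝ => (t : ℂ)) '' Set.Icc (-R) R) ⊆ {z | complexMGF X P z ≠ 0} := by
    rintro _ ⟨t, -, rfl⟩
    simp only [Set.mem_ofPred_eq, complexMGF_ofReal]
    exact_mod_cast (mgf_pos (hX t)).ne'
  obtain ⟨ε, hε, hthick⟩ := hseg.exists_cthickening_subset_open hopen hsub
  have hmem : ∀ z : ℂ, |z.re| ≤ R → |z.im| ≤ ε → complexMGF X P z ≠ 0 := fun z h1 h2 => by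
    apply hthick
    refine Metric.mem_cthickening_of_dist_le z (z.re : ℂ) ε _ ⟨z.re, abs_le.1 h1, rfl⟩ ?_
    rw [Complex.dist_eq]
    have : z - (z.re : ℂ) = z.im * Complex.I := by
      apply Complex.ext <;> simp
    rw [this]
    simpa using h2
  set K : Set ℂ := Set.Icc (-R) R ×ℂ Set.Icc (-ε) ε with hK
  have hKc : IsCompact K := isCompact_Icc.reProdIm isCompact_Icc
  have hKmem : ∀ z : ℂ, |z.re| ≤ R → |z.im| ≤ ε → z ∈ K := fun z h1 h2 => by
    rw [hK, Complex.mem_reProdIm]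
    exact ⟨abs_le.1 h1, abs_le.1 h2⟩
  have hKne : ∀ z ∈ K, complexMGF X P z ≠ 0 := fun z hz => by
    rw [hK, Complex.mem_reProdIm] at hz
    exact hmem z (abs_le.2 hz.1) (abs_le.2 hz.2)
  obtain ⟨C', hC'⟩ := hKc.exists_bound_of_continuousOn
    (f := fun z => Real.log ‖complexMGF X P z‖ - (z ^ 2).re / 2) (by
      refine ContinuousOn.sub (ContinuousOn.log hcont.norm.continuousOn fun z hz => ?_)
        (by fun_prop)
      exact norm_ne_zero_iff.2 (hKne z hz))
  refine ⟨ε, hε, C + |C'| / ρ ^ 3, by positivity, fun z h1 h2 => ⟨hmem z h1 h2, ?_⟩⟩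
  rcases le_total ‖z‖ ρ with hz | hz
  · obtain ⟨h, hh, hhn⟩ := hexp z hz
    rw [hh, Complex.norm_exp, Real.log_exp]
    have : (z ^ 2 / 2 + h).re - (z ^ 2).re / 2 = h.re := by simp
    rw [this]
    calc |h.re| ≤ ‖h‖ := Complex.abs_re_le_norm h
      _ ≤ C * ‖z‖ ^ 3 := hhn
      _ ≤ (C + |C'| / ρ ^ 3) * ‖z‖ ^ 3 := by
        gcongr
        have : 0 ≤ |C'| / ρ ^ 3 := by positivity
        linarith
  · have := hC' z (hKmem z h1 h2)
    rw [Real.norm_eq_abs] at this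
    refine this.trans ((le_abs_self _).trans ?_)
    have h5 : |C'| ≤ |C'| / ρ ^ 3 * ‖z‖ ^ 3 := by
      rw [div_mul_eq_mul_div, le_div_iff₀ (by positivity)]
      gcongr
    have : 0 ≤ C * ‖z‖ ^ 3 := by positivity
    linarith

end MomentGeneratingFunction

/-! ### Normalized exponentials and independence of past and future -/

/-- The standing assumptions on the coefficients: i.i.d., standardized, with exponential moments. -/
structure IsStandardIID {Ω : Type*} [MeasurableSpace Ω] (P : Measure Ω) (A B : ℕ → Ω → ℝ) :
    Prop where
  prob : IsProbabilityMeasure P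
  measurable_left : ∀ k, Measurable (A k)
  measurable_right : ∀ k, Measurable (B k)
  indep : iIndepFun (Sum.elim A B) P
  ident_left : ∀ k, IdentDistrib (A k) (A 0) P P
  ident_right : ∀ k, IdentDistrib (B k) (A 0) P P
  mean : ∫ ω, A 0 ω ∂P = 0
  var : variance (A 0) P = 1
  exp_moment : ∀ t : ℝ, Integrable (fun ω => Real.exp (t * A 0 ω)) P

/-- The coefficient of `A k` in `field A B k x`. -/
noncomputable def cosCoeff (k : ℕ) (x : unitInterval) : ℝ :=
  1 / √((k : ℝ) + 1) * Real.cos (2 * Real.pi * ((k : ℝ) + 1) * (x : ℝ))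

/-- The coefficient of `B k` in `field A B k x`. -/
noncomputable def sinCoeff (k : ℕ) (x : unitInterval) : ℝ :=
  1 / √((k : ℝ) + 1) * Real.sin (2 * Real.pi * ((k : ℝ) + 1) * (x : ℝ))

lemma cosCoeff_sq_add_sinCoeff_sq (k : ℕ) (x : unitInterval) :
    cosCoeff k x ^ 2 + sinCoeff k x ^ 2 = 1 / ((k : ℝ) + 1) := by
  have h : (√((k : ℝ) + 1)) ^ 2 = (k : ℝ) + 1 := Real.sq_sqrt (by positivity)
  rw [cosCoeff, sinCoeff, mul_pow, mul_pow, ← mul_add, Real.cos_sq_add_sin_sq, mul_one, div_pow, h,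
    one_pow]

lemma one_div_sqrt_le_one (k : ℕ) : 1 / √((k : ℝ) + 1) ≤ 1 := by
  rw [div_le_one (by positivity)]
  exact Real.one_le_sqrt.2 (by linarith [Nat.cast_nonneg (α := ℝ) k])

lemma abs_cosCoeff_le (k : ℕ) (x : unitInterval) : |cosCoeff k x| ≤ 1 / √((k : ℝ) + 1) := by
  rw [cosCoeff, abs_mul, abs_of_nonneg (by positivity : 0 ≤ 1 / √((k : ℝ) + 1))]
  exact mul_le_of_le_one_right (by positivity) (Real.abs_cos_le_one _)

lemma abs_sinCoeff_le (k : ℕ) (x : unitInterval) : |sinCoeff k x| ≤ 1 / √((k : ℝ) + 1) := by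
  rw [sinCoeff, abs_mul, abs_of_nonneg (by positivity : 0 ≤ 1 / √((k : ℝ) + 1))]
  exact mul_le_of_le_one_right (by positivity) (Real.abs_sin_le_one _)

@[fun_prop]
lemma continuous_cosCoeff (k : ℕ) : Continuous (cosCoeff k) := by
  unfold cosCoeff; fun_prop

@[fun_prop]
lemma continuous_sinCoeff (k : ℕ) : Continuous (sinCoeff k) := by
  unfold sinCoeff; fun_prop

section Deterministic

variable {Ω : Type*}

lemma field_eq (A B : ℕ → Ω → ℝ) (k : ℕ) (x : unitInterval) (ω : Ω) :
    field A B k x ω = cosCoeff k x * A k ω + sinCoeff k x * B k ω := by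
  rw [field, cosCoeff, sinCoeff]; ring

/-- The partial sum of the field over the indices `m ≤ k < n`. -/
noncomputable def blockField (A B : ℕ → Ω → ℝ) (m n : ℕ) (x : unitInterval) (ω : Ω) : ℝ :=
  ∑ k ∈ Finset.Ico m n, field A B k x ω

lemma blockField_zero (A B : ℕ → Ω → ℝ) (n : ℕ) (x : unitInterval) (ω : Ω) :
    blockField A B 0 n x ω = partialField A B n x ω := by
  rw [blockField, partialField, Nat.Ico_zero_eq_range]

/-- A bound for the partial sums, uniform in the point. -/
noncomputable def majorant (A B : ℕ → Ω → ℝ) (n : ℕ) (ω : Ω) : ℝ :=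
  ∑ k ∈ Finset.range n, (|A k ω| + |B k ω|)

lemma majorant_nonneg (A B : ℕ → Ω → ℝ) (n : ℕ) (ω : Ω) : 0 ≤ majorant A B n ω :=
  Finset.sum_nonneg fun _ _ => by positivity

lemma abs_field_le (A B : ℕ → Ω → ℝ) (k : ℕ) (x : unitInterval) (ω : Ω) :
    |field A B k x ω| ≤ |A k ω| + |B k ω| := by
  rw [field_eq]
  refine (abs_add_le _ _).trans (add_le_add ?_ ?_) <;> rw [abs_mul]
  · exact mul_le_of_le_one_left (abs_nonneg _) ((abs_cosCoeff_le k x).trans (one_div_sqrt_le_one k))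
  · exact mul_le_of_le_one_left (abs_nonneg _) ((abs_sinCoeff_le k x).trans (one_div_sqrt_le_one k))

lemma abs_blockField_le (A B : ℕ → Ω → ℝ) (m n : ℕ) (x : unitInterval) (ω : Ω) :
    |blockField A B m n x ω| ≤ majorant A B n ω := by
  refine (Finset.abs_sum_le_sum_abs _ _).trans
    ((Finset.sum_le_sum fun k _ => abs_field_le A B k x ω).trans ?_)
  refine Finset.sum_le_sum_of_subset_of_nonneg ?_ fun _ _ _ => by positivity
  intro k hk
  simp only [Finset.mem_Ico] at hk
  simpa using hk.2

lemma measurable_blockField [MeasurableSpace Ω] {A B : ℕ → Ω → ℝ} {m n : ℕ}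
    (hA : ∀ k ∈ Finset.Ico m n, Measurable (A k)) (hB : ∀ k ∈ Finset.Ico m n, Measurable (B k)) :
    Measurable fun p : Ω × unitInterval => blockField A B m n p.2 p.1 := by
  unfold blockField
  refine Finset.measurable_sum _ fun k hk => ?_
  simp only [field_eq]
  have h0 : Measurable (Prod.fst : Ω × unitInterval → Ω) := measurable_fst
  have h1 := (hA k hk).comp h0
  have h2 := (hB k hk).comp h0
  exact (((continuous_cosCoeff k).measurable.comp measurable_snd).mul h1).add
    (((continuous_sinCoeff k).measurable.comp measurable_snd).mul h2)

end Deterministic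

variable {Ω : Type*} [MeasurableSpace Ω]

/-- `𝔼 exp (β X_{k+1}(x))`, expressed through the moment generating function. -/
noncomputable def factor (P : Measure Ω) (A : ℕ → Ω → ℝ) (β : ℂ) (k : ℕ) (x : unitInterval) : ℂ :=
  complexMGF (A 0) P (β * cosCoeff k x) * complexMGF (A 0) P (β * sinCoeff k x)

/-- The normalized exponential of the block of the field over `m ≤ k < n`. -/
noncomputable def expWeight (P : Measure Ω) (A B : ℕ → Ω → ℝ) (β : ℂ) (m n : ℕ)
    (x : unitInterval) (ω : Ω) : ℂ :=
  Complex.exp (β * (blockField A B m n x ω : ℂ)) / ∏ k ∈ Finset.Ico m n, factor P A β k x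

/-- The σ-algebra generated by the coefficients of index at least `n`. -/
@[reducible] def tailAlgebra (A B : ℕ → Ω → ℝ) (n : ℕ) : MeasurableSpace Ω :=
  ⨆ k, ⨆ _ : n ≤ k,
    MeasurableSpace.comap (A k) inferInstance ⊔ MeasurableSpace.comap (B k) inferInstance

lemma expWeight_mul (P : Measure Ω) (A B : ℕ → Ω → ℝ) (β : ℂ) {l m n : ℕ} (hlm : l ≤ m)
    (hmn : m ≤ n) (x : unitInterval) (ω : Ω) :
    expWeight P A B β l m x ω * expWeight P A B β m n x ω = expWeight P A B β l n x ω := by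
  simp only [expWeight, blockField]
  rw [← Finset.prod_Ico_consecutive _ hlm hmn, ← Finset.sum_Ico_consecutive _ hlm hmn,
    div_mul_div_comm,
    ← Complex.exp_add]
  push_cast
  ring_nf

/-- The σ-algebra on `Ω` is left free: the same statement serves the ambient one and
`coeffFiltration`, and its section at fixed `x` also serves `tailAlgebra`. -/
lemma measurable_expWeight_of_continuous {Ω : Type*} [MeasurableSpace Ω] {A B : ℕ → Ω → ℝ}
    {m n : ℕ}
    (hA : ∀ k ∈ Finset.Ico m n, Measurable (A k)) (hB : ∀ k ∈ Finset.Ico m n, Measurable (B k))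
    (β : ℂ) {c : unitInterval → ℂ} (hc : Continuous c) :
    Measurable fun p : Ω × unitInterval =>
        Complex.exp (β * (blockField A B m n p.2 p.1 : ℂ)) / c p.2 :=
  (((measurable_blockField hA hB).complex_ofReal.const_mul β).cexp).div
    (hc.measurable.comp measurable_snd)

lemma measurable_expWeight_of_continuous_left {Ω : Type*} [MeasurableSpace Ω] {A B : ℕ → Ω → ℝ}
    {m n : ℕ}
    (hA : ∀ k ∈ Finset.Ico m n, Measurable (A k)) (hB : ∀ k ∈ Finset.Ico m n, Measurable (B k))
    (β : ℂ) {c : unitInterval → ℂ} (hc : Continuous c) (x : unitInterval) :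
    Measurable fun ω : Ω => Complex.exp (β * (blockField A B m n x ω : ℂ)) / c x := by
  simpa only [Function.comp_def] using (measurable_expWeight_of_continuous hA hB β hc).comp
    (measurable_prodMk_right (y := x) : Measurable (fun ω : Ω => (ω, x)))

namespace IsStandardIID

variable {P : Measure Ω} {A B : ℕ → Ω → ℝ} (h : IsStandardIID P A B)
include h

lemma complexMGF_left (k : ℕ) : complexMGF (A k) P = complexMGF (A 0) P :=
  complexMGF_congr_identDistrib (h.ident_left k)

lemma complexMGF_right (k : ℕ) : complexMGF (B k) P = complexMGF (A 0) P :=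
  complexMGF_congr_identDistrib (h.ident_right k)

lemma continuous_mgf : Continuous (complexMGF (A 0) P) :=
  (differentiable_complexMGF h.exp_moment).continuous

lemma measurable_coeff (i : ℕ ⊕ ℕ) : Measurable (Sum.elim A B i) := by
  rcases i with k | k
  · exact h.measurable_left k
  · exact h.measurable_right k

lemma integrable_exp_coeff (i : ℕ ⊕ ℕ) (t : ℝ) :
    Integrable (fun ω => Real.exp (t * Sum.elim A B i ω)) P := by
  have hm : Measurable fun y : ℝ => Real.exp (t * y) := by fun_prop
  have hid : IdentDistrib (Sum.elim A B i) (A 0) P P := by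
    rcases i with k | k
    · exact h.ident_left k
    · exact h.ident_right k
  exact ((hid.comp hm).integrable_iff).2 (h.exp_moment t)

/-- The coefficients are arbitrary complex numbers because the formula is needed twice: for the
normalizer, and for the mixed moments `𝔼 R(x) conj R(y)`. -/
lemma integral_exp_sum (a b : ℕ → ℂ) (s : Finset ℕ) :
    ∫ ω, Complex.exp (∑ k ∈ s, (a k * A k ω + b k * B k ω)) ∂P =
      ∏ k ∈ s, (complexMGF (A 0) P (a k) * complexMGF (A 0) P (b k)) := by
  let g : s ⊕ s → ℕ ⊕ ℕ := Sum.map Subtype.val Subtype.val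
  have hg : Function.Injective g := Subtype.val_injective.sumMap Subtype.val_injective
  have hi := (h.indep.precomp hg).integral_fun_prod_comp
    (f := fun i (y : ℝ) => Complex.exp (Sum.elim (fun k : s => a k) (fun k : s => b k) i * y))
    (fun i => (h.measurable_coeff (g i)).aemeasurable) (fun i => by fun_prop)
  rw [Fintype.prod_sum_type] at hi
  simp only [Fintype.prod_sum_type, Sum.elim_inl, Sum.elim_inr, g, Sum.map_inl, Sum.map_inr] at hi
  have e1 : ∀ ω, Complex.exp (∑ k ∈ s, (a k * A k ω + b k * B k ω)) =
      (∏ k : s, Complex.exp (a k * A k ω)) * ∏ k : s, Complex.exp (b k * B k ω) := by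
    intro ω
    rw [Finset.prod_coe_sort s fun k => Complex.exp (a k * A k ω),
      Finset.prod_coe_sort s fun k => Complex.exp (b k * B k ω), ← Complex.exp_sum,
      ← Complex.exp_sum, ← Complex.exp_add, Finset.sum_add_distrib]
  simp_rw [e1]
  rw [hi, Finset.prod_mul_distrib, ← Finset.prod_coe_sort s, ← Finset.prod_coe_sort s]
  congr 1
  · exact Finset.prod_congr rfl fun k _ => by rw [← h.complexMGF_left k]; rfl
  · exact Finset.prod_congr rfl fun k _ => by rw [← h.complexMGF_right k]; rfl

lemma integral_exp_blockField (β : ℂ) (m n : ℕ) (x : unitInterval) :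
    ∫ ω, Complex.exp (β * (blockField A B m n x ω : ℂ)) ∂P =
      ∏ k ∈ Finset.Ico m n, factor P A β k x := by
  have := h.integral_exp_sum (fun k => β * cosCoeff k x) (fun k => β * sinCoeff k x)
    (Finset.Ico m n)
  simp only [factor]
  rw [← this]
  congr 1 with ω
  congr 1
  simp only [blockField, field_eq]
  push_cast
  rw [Finset.mul_sum]
  exact Finset.sum_congr rfl fun k _ => by ring

lemma normalizer_eq (β : ℂ) (n : ℕ) (x : unitInterval) :
    normalizer P A B β n x = ∏ k ∈ Finset.Ico 0 n, factor P A β k x := by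
  rw [normalizer, ← h.integral_exp_blockField]
  simp only [blockField_zero]

lemma chaos_eq (f : C(unitInterval, ℂ)) (β : ℂ) (n : ℕ) (ω : Ω) :
    chaos P A B f β n ω = ∫ x : unitInterval, f x * expWeight P A B β 0 n x ω := by
  simp only [chaos, expWeight, h.normalizer_eq, blockField_zero]

lemma continuous_factor (k : ℕ) :
    Continuous fun p : ℂ × unitInterval => factor P A p.1 k p.2 := by
  have := h.continuous_mgf
  unfold factor
  fun_prop

lemma continuous_prod_factor (m n : ℕ) :
    Continuous fun p : ℂ × unitInterval => ∏ k ∈ Finset.Ico m n, factor P A p.1 k p.2 :=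
  continuous_finsetProd _ fun k _ => h.continuous_factor k

lemma continuous_prod_factor_right (β : ℂ) (m n : ℕ) :
    Continuous fun x : unitInterval => ∏ k ∈ Finset.Ico m n, factor P A β k x :=
  continuous_finsetProd _ fun k _ =>
    (h.continuous_factor k).comp (continuous_const.prodMk continuous_id)

lemma measurable_expWeight (β : ℂ) (m n : ℕ) :
    Measurable fun p : Ω × unitInterval => expWeight P A B β m n p.2 p.1 := by
  have := measurable_expWeight_of_continuous (fun k (_ : k ∈ Finset.Ico m n) => h.measurable_left k)
    (fun k _ => h.measurable_right k) β (h.continuous_prod_factor_right β m n)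
  unfold expWeight
  exact this

lemma measurable_expWeight_filtration (β : ℂ) (n : ℕ) :
    Measurable[(coeffFiltration A B h.measurable_left h.measurable_right n).prod inferInstance]
      fun p : Ω × unitInterval => expWeight P A B β 0 n p.2 p.1 := by
  have hle : ∀ k ∈ Finset.Ico 0 n, MeasurableSpace.comap (A k) inferInstance ⊔
      MeasurableSpace.comap (B k) inferInstance ≤
        coeffFiltration A B h.measurable_left h.measurable_right n := fun k hk =>
    le_iSup₂_of_le k (Finset.mem_Ico.1 hk).2 le_rfl
  have := @measurable_expWeight_of_continuous Ω
    (coeffFiltration A B h.measurable_left h.measurable_right n) A B 0 n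
    (fun k hk => Measurable.of_comap_le (le_sup_left.trans (hle k hk)))
    (fun k hk => Measurable.of_comap_le (le_sup_right.trans (hle k hk))) β _
    (h.continuous_prod_factor_right β 0 n)
  unfold expWeight
  exact this

lemma measurable_expWeight_filtration_left (β : ℂ) (n : ℕ) (x : unitInterval) :
    Measurable[coeffFiltration A B h.measurable_left h.measurable_right n]
      fun ω => expWeight P A B β 0 n x ω := by
  have hle : ∀ k ∈ Finset.Ico 0 n, MeasurableSpace.comap (A k) inferInstance ⊔
      MeasurableSpace.comap (B k) inferInstance ≤
        coeffFiltration A B h.measurable_left h.measurable_right n := fun k hk =>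
    le_iSup₂_of_le k (Finset.mem_Ico.1 hk).2 le_rfl
  have := @measurable_expWeight_of_continuous_left Ω
    (coeffFiltration A B h.measurable_left h.measurable_right n) A B 0 n
    (fun k hk => Measurable.of_comap_le (le_sup_left.trans (hle k hk)))
    (fun k hk => Measurable.of_comap_le (le_sup_right.trans (hle k hk))) β _
    (h.continuous_prod_factor_right β 0 n) x
  unfold expWeight
  exact this

lemma measurable_expWeight_tail (β : ℂ) (m n : ℕ) (x : unitInterval) :
    Measurable[tailAlgebra A B m] fun ω => expWeight P A B β m n x ω := by
  have hle : ∀ k ∈ Finset.Ico m n, MeasurableSpace.comap (A k) inferInstance ⊔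
      MeasurableSpace.comap (B k) inferInstance ≤ tailAlgebra A B m := fun k hk =>
    le_iSup₂_of_le k (Finset.mem_Ico.1 hk).1 le_rfl
  have := @measurable_expWeight_of_continuous_left Ω (tailAlgebra A B m) A B m n
    (fun k hk => Measurable.of_comap_le (le_sup_left.trans (hle k hk)))
    (fun k hk => Measurable.of_comap_le (le_sup_right.trans (hle k hk))) β _
    (h.continuous_prod_factor_right β m n) x
  unfold expWeight
  exact this

lemma tailAlgebra_le (n : ℕ) : tailAlgebra A B n ≤ (inferInstance : MeasurableSpace Ω) :=
  iSup₂_le fun k _ => sup_le (h.measurable_left k).comap_le (h.measurable_right k).comap_le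

lemma indep_filtration_tail (n : ℕ) :
    Indep (coeffFiltration A B h.measurable_left h.measurable_right n) (tailAlgebra A B n) P := by
  have hd : Disjoint {i : ℕ ⊕ ℕ | Sum.elim id id i < n} {i : ℕ ⊕ ℕ | n ≤ Sum.elim id id i} :=
    Set.disjoint_left.2 fun i h1 h2 => absurd (show Sum.elim id id i < n from h1) (not_lt.2 h2)
  have := indep_iSup_of_disjoint (fun i => (h.measurable_coeff i).comap_le) h.indep.iIndep hd
  refine indep_of_indep_of_le_left (indep_of_indep_of_le_right this ?_) ?_
  · refine iSup₂_le fun k hk => sup_le ?_ ?_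
    · exact le_iSup₂_of_le (Sum.inl k) hk le_rfl
    · exact le_iSup₂_of_le (Sum.inr k) hk le_rfl
  · refine iSup₂_le fun k hk => sup_le ?_ ?_
    · exact le_iSup₂_of_le (Sum.inl k) hk le_rfl
    · exact le_iSup₂_of_le (Sum.inr k) hk le_rfl

lemma indepFun_of_measurable {β γ : Type*} [MeasurableSpace β] [MeasurableSpace γ] {n : ℕ}
    {X : Ω → β} {Y : Ω → γ}
    (hX : Measurable[coeffFiltration A B h.measurable_left h.measurable_right n] X)
    (hY : Measurable[tailAlgebra A B n] Y) : IndepFun X Y P := by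
  rw [IndepFun_iff_Indep]
  exact indep_of_indep_of_le_left
    (indep_of_indep_of_le_right (h.indep_filtration_tail n) hY.comap_le) hX.comap_le

/-- For fixed `n` this is the dominating function behind the integrability and Fubini arguments;
nothing about it is uniform in `n`. -/
lemma integrable_exp_majorant (t : ℝ) (n : ℕ) :
    Integrable (fun ω => Real.exp (t * majorant A B n ω)) P := by
  have := h.prob
  have habs := h.indep.comp (fun _ y => |y|) (fun _ => measurable_norm)
  have := habs.integrable_exp_mul_sum (t := t)
    (s := (Finset.range n).disjSum (Finset.range n))
    (fun i => (h.measurable_coeff i).abs)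
    (fun i _ => integrable_exp_mul_abs (h.integrable_exp_coeff i t) (h.integrable_exp_coeff i (-t)))
  refine this.congr (ae_of_all _ fun ω => ?_)
  simp only [Finset.sum_apply, Finset.sum_disjSum, majorant, Finset.sum_add_distrib,
    Function.comp_apply, Sum.elim_inl, Sum.elim_inr]

lemma measurable_majorant (n : ℕ) : Measurable (majorant A B n) :=
  Finset.measurable_sum _ fun k _ => (h.measurable_left k).abs.add (h.measurable_right k).abs

lemma integral_expWeight {β : ℂ} {m n : ℕ} {x : unitInterval}
    (hne : ∀ k, factor P A β k x ≠ 0) : ∫ ω, expWeight P A B β m n x ω ∂P = 1 := by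
  simp only [expWeight]
  rw [integral_div, h.integral_exp_blockField, div_self]
  exact Finset.prod_ne_zero_iff.2 fun k _ => hne k

lemma exists_norm_expWeight_le {β : ℂ} (hne : ∀ k x, factor P A β k x ≠ 0) (m n : ℕ) :
    ∃ C : ℝ, 0 ≤ C ∧ ∀ x ω,
      ‖expWeight P A B β m n x ω‖ ≤ C * Real.exp (‖β‖ * majorant A B n ω) := by
  have hc : Continuous fun x : unitInterval => (∏ k ∈ Finset.Ico m n, factor P A β k x)⁻¹ :=
    (h.continuous_prod_factor_right β m n).inv₀
      fun x => Finset.prod_ne_zero_iff.2 fun k _ => hne k x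
  obtain ⟨C, hC⟩ := isCompact_univ.exists_bound_of_continuousOn hc.continuousOn
  refine ⟨C, (norm_nonneg _).trans (hC 0 trivial), fun x ω => ?_⟩
  rw [expWeight, div_eq_mul_inv, norm_mul, mul_comm]
  refine mul_le_mul (hC x trivial) ?_ (norm_nonneg _) ((norm_nonneg _).trans (hC 0 trivial))
  rw [Complex.norm_exp]
  refine Real.exp_le_exp.2 ((Complex.re_le_norm _).trans ?_)
  rw [norm_mul]
  refine mul_le_mul_of_nonneg_left ?_ (norm_nonneg _)
  simpa using abs_blockField_le A B m n x ω

end IsStandardIID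

/-! ### The martingale property -/

namespace IsStandardIID

variable {Ω : Type*} [MeasurableSpace Ω] {P : Measure Ω} {A B : ℕ → Ω → ℝ}
  (h : IsStandardIID P A B)
include h

lemma integrable_prod_of_norm_le {E α : Type*} [NormedAddCommGroup E] [MeasurableSpace α]
    {ν : Measure α} [IsFiniteMeasure ν] {G : Ω × α → E} (hG : AEStronglyMeasurable G (P.prod ν))
    {C t : ℝ} {n : ℕ} (hle : ∀ p, ‖G p‖ ≤ C * Real.exp (t * majorant A B n p.1)) :
    Integrable G (P.prod ν) := by
  have := h.prob
  exact Integrable.mono' (((h.integrable_exp_majorant t n).comp_fst ν).const_mul C) hG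
    (ae_of_all _ hle)

lemma memLp_of_norm_le {E : Type*} [NormedAddCommGroup E] {G : Ω → E}
    (hG : AEStronglyMeasurable G P) {C t : ℝ} {n : ℕ}
    (hle : ∀ ω, ‖G ω‖ ≤ C * Real.exp (t * majorant A B n ω)) {q : ℝ} (hq : 0 < q) :
    MemLp G (ENNReal.ofReal q) P := by
  have hexp : MemLp (fun ω => Real.exp (t * majorant A B n ω)) (ENNReal.ofReal q) P := by
    have hm := h.measurable_majorant n
    rw [← integrable_norm_rpow_iff (by fun_prop) (by simpa using hq) ENNReal.ofReal_ne_top,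
      ENNReal.toReal_ofReal hq.le]
    refine (h.integrable_exp_majorant (q * t) n).congr (ae_of_all _ fun ω => ?_)
    simp only [Real.norm_eq_abs, Real.abs_exp, ← Real.exp_mul]
    ring_nf
  exact MemLp.of_le (hexp.const_mul C) hG (ae_of_all _ fun ω => (hle ω).trans (le_abs_self _))

lemma integrable_of_norm_le {E : Type*} [NormedAddCommGroup E] {G : Ω → E}
    (hG : AEStronglyMeasurable G P) {C t : ℝ} {n : ℕ}
    (hle : ∀ ω, ‖G ω‖ ≤ C * Real.exp (t * majorant A B n ω)) : Integrable G P :=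
  Integrable.mono' ((h.integrable_exp_majorant t n).const_mul C) hG (ae_of_all _ hle)

lemma measurable_expWeight_left (β : ℂ) (m n : ℕ) (x : unitInterval) :
    Measurable fun ω => expWeight P A B β m n x ω := by
  simpa only [Function.comp_def] using (h.measurable_expWeight β m n).comp
    (measurable_prodMk_right (y := x) : Measurable (fun ω : Ω => (ω, x)))

lemma stronglyMeasurable_chaos (f : C(unitInterval, ℂ)) (β : ℂ) (n : ℕ) :
    StronglyMeasurable[coeffFiltration A B h.measurable_left h.measurable_right n]
      (chaos P A B f β n) := by
  have hm : StronglyMeasurable[(coeffFiltration A B h.measurable_left h.measurable_right n).prod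
      inferInstance] (Function.uncurry fun (ω : Ω) (x : unitInterval) =>
        f x * expWeight P A B β 0 n x ω) :=
    (Measurable.mul (f.continuous.measurable.comp measurable_snd)
      (h.measurable_expWeight_filtration β n)).stronglyMeasurable
  have := @StronglyMeasurable.integral_prod_right Ω unitInterval ℂ
    (coeffFiltration A B h.measurable_left h.measurable_right n) _ volume _ _ _ _ hm
  rwa [show chaos P A B f β n = _ from funext fun ω => h.chaos_eq f β n ω]

lemma measurable_chaos (f : C(unitInterval, ℂ)) (β : ℂ) (n : ℕ) :
    Measurable (chaos P A B f β n) :=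
  ((h.stronglyMeasurable_chaos f β n).mono (Filtration.le _ n)).measurable

lemma exists_norm_mul_expWeight_le (f : C(unitInterval, ℂ)) {β : ℂ}
    (hne : ∀ k x, factor P A β k x ≠ 0) (m n : ℕ) :
    ∃ C : ℝ, 0 ≤ C ∧ ∀ x ω,
      ‖f x * expWeight P A B β m n x ω‖ ≤ C * Real.exp (‖β‖ * majorant A B n ω) := by
  obtain ⟨C, hC, hle⟩ := h.exists_norm_expWeight_le hne m n
  refine ⟨‖f‖ * C, by positivity, fun x ω => ?_⟩
  rw [norm_mul, mul_assoc]
  exact mul_le_mul (f.norm_coe_le_norm x) (hle x ω) (norm_nonneg _) (norm_nonneg _)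

lemma exists_norm_chaos_le (f : C(unitInterval, ℂ)) {β : ℂ}
    (hne : ∀ k x, factor P A β k x ≠ 0) (n : ℕ) :
    ∃ C : ℝ, 0 ≤ C ∧ ∀ ω, ‖chaos P A B f β n ω‖ ≤ C * Real.exp (‖β‖ * majorant A B n ω) := by
  obtain ⟨C, hC, hle⟩ := h.exists_norm_mul_expWeight_le f hne 0 n
  refine ⟨C, hC, fun ω => ?_⟩
  rw [h.chaos_eq]
  simpa using norm_integral_le_of_norm_le_const (μ := (volume : Measure unitInterval))
    (ae_of_all _ fun x => hle x ω)

lemma memLp_chaos (f : C(unitInterval, ℂ)) {β : ℂ} (hne : ∀ k x, factor P A β k x ≠ 0) (n : ℕ)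
    {q : ℝ} (hq : 0 < q) : MemLp (chaos P A B f β n) (ENNReal.ofReal q) P := by
  obtain ⟨C, hC, hle⟩ := h.exists_norm_chaos_le f hne n
  exact h.memLp_of_norm_le (h.measurable_chaos f β n).aestronglyMeasurable hle hq

lemma integrable_chaos (f : C(unitInterval, ℂ)) {β : ℂ} (hne : ∀ k x, factor P A β k x ≠ 0)
    (n : ℕ) : Integrable (chaos P A B f β n) P := by
  obtain ⟨C, hC, hle⟩ := h.exists_norm_chaos_le f hne n
  exact h.integrable_of_norm_le (h.measurable_chaos f β n).aestronglyMeasurable hle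

lemma setIntegral_chaos (f : C(unitInterval, ℂ)) {β : ℂ} (hne : ∀ k x, factor P A β k x ≠ 0)
    (n : ℕ) (s : Set Ω) :
    ∫ ω in s, chaos P A B f β n ω ∂P =
      ∫ x : unitInterval, f x * ∫ ω in s, expWeight P A B β 0 n x ω ∂P := by
  have := h.prob
  obtain ⟨C, hC, hle⟩ := h.exists_norm_mul_expWeight_le f hne 0 n
  have hint : Integrable (Function.uncurry fun (ω : Ω) (x : unitInterval) =>
      f x * expWeight P A B β 0 n x ω) (P.prod volume) :=
    h.integrable_prod_of_norm_le
      (Measurable.mul (f.continuous.measurable.comp measurable_snd)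
        (h.measurable_expWeight β 0 n)).aestronglyMeasurable
      (fun p => hle p.2 p.1)
  simp_rw [h.chaos_eq]
  rw [integral_integral_swap]
  · simp_rw [integral_const_mul]
  · refine hint.mono_measure ?_
    exact Measure.prod_mono Measure.restrict_le_self le_rfl

/-- The martingale property at a fixed point: the new factor is independent of the past and has mean
one. Fubini then carries it to `chaos`. -/
lemma setIntegral_expWeight_succ {β : ℂ} (hne : ∀ k x, factor P A β k x ≠ 0) (n : ℕ) {s : Set Ω}
    (hs : MeasurableSet[coeffFiltration A B h.measurable_left h.measurable_right n] s)
    (x : unitInterval) :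
    ∫ ω in s, expWeight P A B β 0 (n + 1) x ω ∂P = ∫ ω in s, expWeight P A B β 0 n x ω ∂P := by
  have hs' := Filtration.le _ n _ hs
  rw [← integral_indicator hs', ← integral_indicator hs']
  have hX : Measurable[coeffFiltration A B h.measurable_left h.measurable_right n]
      (s.indicator fun ω => expWeight P A B β 0 n x ω) :=
    Measurable.indicator (h.measurable_expWeight_filtration_left β n x) hs
  have hind := h.indepFun_of_measurable hX (h.measurable_expWeight_tail β n (n + 1) x)
  have := hind.integral_fun_mul_eq_mul_integral
    (hX.mono (Filtration.le _ n) le_rfl).aestronglyMeasurable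
    (h.measurable_expWeight_left β n (n + 1) x).aestronglyMeasurable
  rw [h.integral_expWeight (fun k => hne k x), mul_one] at this
  rw [← this]
  congr 1 with ω
  by_cases hω : ω ∈ s
  · simp only [Set.indicator_of_mem hω]
    exact (expWeight_mul P A B β (Nat.zero_le n) n.le_succ x ω).symm
  · simp [Set.indicator_of_notMem hω]

lemma martingale_chaos (f : C(unitInterval, ℂ)) {β : ℂ} (hne : ∀ k x, factor P A β k x ≠ 0) :
    Martingale (chaos P A B f β) (coeffFiltration A B h.measurable_left h.measurable_right) P := by
  have := h.prob
  refine martingale_of_setIntegral_eq_succ (h.stronglyMeasurable_chaos f β)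
    (h.integrable_chaos f hne) fun n s hs => ?_
  rw [h.setIntegral_chaos f hne, h.setIntegral_chaos f hne]
  simp_rw [h.setIntegral_expWeight_succ hne n hs]

end IsStandardIID

/-! ### Growth of the moments -/

lemma sum_one_div_sqrt_pow_three_le :
    ∃ S : ℝ, 0 ≤ S ∧ ∀ n : ℕ, ∑ k ∈ Finset.range n, (1 / √((k : ℝ) + 1)) ^ 3 ≤ S := by
  have hs : Summable fun k : ℕ => (1 / √((k : ℝ) + 1)) ^ 3 := by
    have h1 := (summable_nat_add_iff 1).2
      (Real.summable_one_div_nat_rpow.2 (by norm_num : (1 : ℝ) < 3 / 2))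
    refine h1.congr fun k => ?_
    push_cast
    rw [div_pow, one_pow, Real.sqrt_eq_rpow, ← Real.rpow_natCast, ← Real.rpow_mul (by positivity)]
    norm_num
  exact ⟨∑' k : ℕ, (1 / √((k : ℝ) + 1)) ^ 3, tsum_nonneg fun k => by positivity,
    fun n => hs.sum_le_tsum _ fun k _ => by positivity⟩

/-- The exponent of growth of the `q`-th moment of the normalized exponential. -/
noncomputable def momentExponent (q : ℝ) (β : ℂ) : ℝ :=
  (q ^ 2 * β.re ^ 2 - q * (β.re ^ 2 - β.im ^ 2)) / 2

lemma momentExponent_nonneg {q : ℝ} (hq : 1 ≤ q) (β : ℂ) : 0 ≤ momentExponent q β := by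
  rw [momentExponent]
  have h1 : 0 ≤ q * (q - 1) * β.re ^ 2 :=
    mul_nonneg (mul_nonneg (by linarith) (by linarith)) (sq_nonneg _)
  have h2 : 0 ≤ q * β.im ^ 2 := mul_nonneg (by linarith) (sq_nonneg _)
  nlinarith

lemma sum_one_div_le_one_add_log (n : ℕ) :
    ∑ k ∈ Finset.range n, 1 / ((k : ℝ) + 1) ≤ 1 + Real.log n := by
  have := harmonic_le_one_add_log n
  rw [harmonic] at this
  push_cast at this
  simpa using this

namespace IsStandardIID

variable {Ω : Type*} [MeasurableSpace Ω] {P : Measure Ω} {A B : ℕ → Ω → ℝ}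
  (h : IsStandardIID P A B)
include h

/-- The squares of the two coefficients of index `k` add up to `1 / (k + 1)`, so the Gaussian main
term does not depend on `x`; the cubic errors are summable. Coefficients of size at most `1` keep
every argument in the strip. -/
lemma exists_log_norm_prod_factor (R : ℝ) :
    ∃ ε : ℝ, 0 < ε ∧ ∃ C : ℝ, 0 ≤ C ∧ ∀ β : ℂ, |β.re| ≤ R → |β.im| ≤ ε →
      (∀ k x, factor P A β k x ≠ 0) ∧
      ∀ n x, |Real.log ‖∏ k ∈ Finset.Ico 0 n, factor P A β k x‖ -
        (β ^ 2).re / 2 * ∑ k ∈ Finset.range n, 1 / ((k : ℝ) + 1)| ≤ C * ‖β‖ ^ 3 := by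
  have := h.prob
  obtain ⟨ε, hε, C, hC, hstrip⟩ := exists_strip_log_norm_complexMGF (h.measurable_left 0)
    h.exp_moment h.mean h.var R
  obtain ⟨S, hS, hsum⟩ := sum_one_div_sqrt_pow_three_le
  -- The `2` counts the cosine and the sine factor of each index.
  refine ⟨ε, hε, 2 * C * S, by positivity, fun β h1 h2 => ?_⟩
  have key : ∀ (u : ℝ) (k : ℕ), |u| ≤ 1 / √((k : ℝ) + 1) → complexMGF (A 0) P (β * u) ≠ 0 ∧
      |Real.log ‖complexMGF (A 0) P (β * u)‖ - (β ^ 2).re / 2 * u ^ 2| ≤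
        C * ‖β‖ ^ 3 * (1 / √((k : ℝ) + 1)) ^ 3 := by
    intro u k hu
    have hu1 : |u| ≤ 1 := hu.trans (one_div_sqrt_le_one k)
    have hs := hstrip (β * u)
      (by
        rw [Complex.re_mul_ofReal, abs_mul]
        exact (mul_le_of_le_one_right (abs_nonneg _) hu1).trans h1)
      (by
        rw [Complex.im_mul_ofReal, abs_mul]
        exact (mul_le_of_le_one_right (abs_nonneg _) hu1).trans h2)
    refine ⟨hs.1, ?_⟩
    have e : ((β * u) ^ 2).re / 2 = (β ^ 2).re / 2 * u ^ 2 := by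
      rw [mul_pow, ← Complex.ofReal_pow, Complex.re_mul_ofReal]; ring
    rw [← e]
    refine hs.2.trans ?_
    rw [norm_mul, mul_pow, mul_assoc, Complex.norm_real, Real.norm_eq_abs]
    gcongr
  have hne : ∀ k x, factor P A β k x ≠ 0 := fun k x =>
    mul_ne_zero (key _ k (abs_cosCoeff_le k x)).1 (key _ k (abs_sinCoeff_le k x)).1
  refine ⟨hne, fun n x => ?_⟩
  rw [norm_prod, Real.log_prod fun k _ => norm_ne_zero_iff.2 (hne k x), Nat.Ico_zero_eq_range,
    Finset.mul_sum, ← Finset.sum_sub_distrib]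
  refine (Finset.abs_sum_le_sum_abs _ _).trans ?_
  calc _ ≤ ∑ k ∈ Finset.range n, 2 * C * ‖β‖ ^ 3 * (1 / √((k : ℝ) + 1)) ^ 3 := by
        refine Finset.sum_le_sum fun k _ => ?_
        have hc := key _ k (abs_cosCoeff_le k x)
        have hs := key _ k (abs_sinCoeff_le k x)
        rw [factor, norm_mul, Real.log_mul (norm_ne_zero_iff.2 hc.1) (norm_ne_zero_iff.2 hs.1),
          ← cosCoeff_sq_add_sinCoeff_sq k x]
        have := abs_add_le (Real.log ‖complexMGF (A 0) P (β * cosCoeff k x)‖ -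
          (β ^ 2).re / 2 * cosCoeff k x ^ 2) (Real.log ‖complexMGF (A 0) P (β * sinCoeff k x)‖ -
          (β ^ 2).re / 2 * sinCoeff k x ^ 2)
        refine (le_of_eq ?_).trans (this.trans ((add_le_add hc.2 hs.2).trans (le_of_eq (by ring))))
        congr 1; ring
    _ ≤ 2 * C * S * ‖β‖ ^ 3 := by
        rw [← Finset.mul_sum]
        calc _ ≤ 2 * C * ‖β‖ ^ 3 * S := by gcongr; exact hsum n
          _ = _ := by ring

/-- Since `‖exp (βX)‖ ^ q = exp (q Re β X)`, a moment is a ratio of normalizers, at the real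
parameter `q Re β` and at `β`. The difference of their logarithms produces `momentExponent q β`. -/
lemma integral_norm_expWeight_rpow (β : ℂ) (q : ℝ) (n : ℕ)
    (x : unitInterval) :
    ∫ ω, ‖expWeight P A B β 0 n x ω‖ ^ q ∂P =
      ‖∏ k ∈ Finset.Ico 0 n, factor P A ((q * β.re : ℝ) : ℂ) k x‖ /
        ‖∏ k ∈ Finset.Ico 0 n, factor P A β k x‖ ^ q := by
  have e : ∀ ω, ‖expWeight P A B β 0 n x ω‖ ^ q = Real.exp (q * β.re * blockField A B 0 n x ω) /
      ‖∏ k ∈ Finset.Ico 0 n, factor P A β k x‖ ^ q := by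
    intro ω
    rw [expWeight, norm_div, Real.div_rpow (norm_nonneg _) (norm_nonneg _), Complex.norm_exp,
      ← Real.exp_mul, Complex.re_mul_ofReal]
    ring_nf
  simp_rw [e]
  rw [integral_div, ← h.integral_exp_blockField ((q * β.re : ℝ) : ℂ)]
  congr 1
  have : ∀ ω, Complex.exp (((q * β.re : ℝ) : ℂ) * (blockField A B 0 n x ω : ℂ)) =
      ((Real.exp (q * β.re * blockField A B 0 n x ω) : ℝ) : ℂ) := by
    intro ω; push_cast; rfl
  simp_rw [this]
  rw [integral_complex_ofReal, Complex.norm_real, Real.norm_eq_abs, abs_of_nonneg]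
  exact integral_nonneg fun ω => (Real.exp_pos _).le

/-- Growth of the moments of the normalized exponential, near the real segment `[-2, 2]`. -/
lemma exists_lintegral_norm_expWeight_rpow_le :
    ∃ ε : ℝ, 0 < ε ∧ ∃ C : ℝ, 0 ≤ C ∧ ∀ β : ℂ, |β.re| ≤ 2 → |β.im| ≤ ε →
      (∀ k x, factor P A β k x ≠ 0) ∧
      ∀ q : ℝ, 1 ≤ q → q ≤ 2 → ∀ n : ℕ, 1 ≤ n → ∀ x : unitInterval,
        ∫⁻ ω, ‖expWeight P A B β 0 n x ω‖ₑ ^ q ∂P ≤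
          ENNReal.ofReal (C * (n : ℝ) ^ momentExponent q β) := by
  -- Both `β` and `q Re β` must lie in the strip; `q ≤ 2` and `|Re β| ≤ 2` give half-length `4`.
  obtain ⟨ε, hε, C, hC, hlog⟩ := h.exists_log_norm_prod_factor 4
  -- `8 + ε²` bounds `momentExponent`, to pay for the `1` in `H ≤ 1 + log n`; `64 = 4³` is the cubic
  -- error at `q Re β`, and the last term is `q ≤ 2` times the one at `β`.
  refine ⟨ε, hε, Real.exp (8 + ε ^ 2 + C * 64 + 2 * (C * (2 + ε) ^ 3)), by positivity,
    fun β h1 h2 => ⟨(hlog β (by linarith) h2).1, fun q hq1 hq2 n hn x => ?_⟩⟩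
  have hne := (hlog β (by linarith) h2).1
  have hqb : |q * β.re| ≤ 4 := by
    rw [abs_mul, abs_of_nonneg (by linarith : 0 ≤ q)]
    nlinarith [abs_nonneg β.re]
  have hq := hlog ((q * β.re : ℝ) : ℂ) (by simpa only [Complex.ofReal_re] using hqb)
    (by simp only [Complex.ofReal_im, abs_zero]; exact hε.le)
  have hβ := (hlog β (by linarith) h2).2 n x
  have hq' := hq.2 n x
  set F := ∏ k ∈ Finset.Ico 0 n, factor P A β k x with hF
  set G := ∏ k ∈ Finset.Ico 0 n, factor P A ((q * β.re : ℝ) : ℂ) k x with hG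
  set H := ∑ k ∈ Finset.range n, 1 / ((k : ℝ) + 1) with hH
  have hF0 : 0 < ‖F‖ := norm_pos_iff.2 (Finset.prod_ne_zero_iff.2 fun k _ => hne k x)
  have hG0 : 0 < ‖G‖ := norm_pos_iff.2 (Finset.prod_ne_zero_iff.2 fun k _ => hq.1 k x)
  have hint : Integrable (fun ω => ‖expWeight P A B β 0 n x ω‖ ^ q) P := by
    obtain ⟨c, hc, hle⟩ := h.exists_norm_expWeight_le hne 0 n
    have := (h.memLp_of_norm_le (h.measurable_expWeight_left β 0 n x).aestronglyMeasurable
      (hle x) (by linarith : 0 < q)).integrable_norm_rpow (by simpa using by linarith)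
      ENNReal.ofReal_ne_top
    rwa [ENNReal.toReal_ofReal (by linarith)] at this
  have e1 : ∫⁻ ω, ‖expWeight P A B β 0 n x ω‖ₑ ^ q ∂P =
      ENNReal.ofReal (∫ ω, ‖expWeight P A B β 0 n x ω‖ ^ q ∂P) := by
    rw [ofReal_integral_eq_lintegral_ofReal hint (ae_of_all _ fun ω => by positivity)]
    refine lintegral_congr fun ω => ?_
    rw [← ENNReal.ofReal_rpow_of_nonneg (norm_nonneg _) (by linarith), ofReal_norm]
  rw [e1, h.integral_norm_expWeight_rpow]
  refine ENNReal.ofReal_le_ofReal ?_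
  have e2 : ‖G‖ / ‖F‖ ^ q = Real.exp (Real.log ‖G‖ - q * Real.log ‖F‖) := by
    rw [Real.exp_sub, Real.exp_log hG0, mul_comm, Real.exp_mul, Real.exp_log hF0]
  rw [← hF, ← hG, e2]
  have hn0 : (0 : ℝ) < n := by exact_mod_cast hn
  rw [Real.rpow_def_of_pos hn0, ← Real.exp_add]
  refine Real.exp_le_exp.2 ?_
  have hH1 : H ≤ 1 + Real.log n := sum_one_div_le_one_add_log n
  have hκ0 := momentExponent_nonneg hq1 β
  have hre : (((q * β.re : ℝ) : ℂ) ^ 2).re = q ^ 2 * β.re ^ 2 := by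
    rw [← Complex.ofReal_pow, Complex.ofReal_re]; ring
  have hre2 : (β ^ 2).re = β.re ^ 2 - β.im ^ 2 := by
    rw [sq, Complex.mul_re]; ring
  rw [hre] at hq'
  rw [hre2] at hβ
  have a1 := (abs_le.1 hq').2
  have a2 := (abs_le.1 hβ).1
  have hn3 : ‖((q * β.re : ℝ) : ℂ)‖ ^ 3 ≤ 64 := by
    rw [Complex.norm_real, Real.norm_eq_abs]
    calc |q * β.re| ^ 3 ≤ 4 ^ 3 := by gcongr
      _ = 64 := by norm_num
  have hb3 : ‖β‖ ^ 3 ≤ (2 + ε) ^ 3 := by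
    gcongr
    exact (Complex.norm_le_abs_re_add_abs_im β).trans (add_le_add h1 h2)
  have hκ1 : momentExponent q β ≤ 8 + ε ^ 2 := by
    rw [momentExponent]
    have hr : β.re ^ 2 ≤ 4 := by nlinarith [sq_abs β.re, abs_nonneg β.re]
    have hi : β.im ^ 2 ≤ ε ^ 2 := by nlinarith [sq_abs β.im, abs_nonneg β.im]
    have h3 : q ^ 2 * β.re ^ 2 ≤ 4 * 4 := by
      apply mul_le_mul _ hr (sq_nonneg _) (by norm_num)
      nlinarith
    have h4 : q * β.im ^ 2 ≤ 2 * ε ^ 2 := mul_le_mul hq2 hi (sq_nonneg _) (by norm_num)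
    have h5 : 0 ≤ q * β.re ^ 2 := by positivity
    nlinarith
  have a3 : C * ‖((q * β.re : ℝ) : ℂ)‖ ^ 3 ≤ C * 64 := by gcongr
  have a4 : C * ‖β‖ ^ 3 ≤ C * (2 + ε) ^ 3 := by gcongr
  have a5 : 0 ≤ C * (2 + ε) ^ 3 := by positivity
  have a6 : momentExponent q β * H ≤ momentExponent q β * (1 + Real.log n) := by gcongr
  have a7 : momentExponent q β * H =
      q ^ 2 * β.re ^ 2 / 2 * H - q * ((β.re ^ 2 - β.im ^ 2) / 2 * H) := by
    rw [momentExponent]; ring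
  have a8 : -(q * Real.log ‖F‖) ≤ -(q * ((β.re ^ 2 - β.im ^ 2) / 2 * H)) +
      2 * (C * (2 + ε) ^ 3) := by
    have : q * (-(C * (2 + ε) ^ 3)) ≤
        q * (Real.log ‖F‖ - (β.re ^ 2 - β.im ^ 2) / 2 * H) := by
      apply mul_le_mul_of_nonneg_left _ (by linarith)
      linarith
    nlinarith
  linarith

end IsStandardIID

/-! ### The covariance kernel of a dyadic block -/

/-- Summation by parts for a decreasing sequence against the increments of a bounded one. -/
lemma abs_sum_mul_sub_le {a s : ℕ → ℝ} (ha : ∀ k, a (k + 1) ≤ a k) (ha0 : ∀ k, 0 ≤ a k)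
    (hs : ∀ k, |s k| ≤ 1) {m n : ℕ} (hmn : m ≤ n) :
    |∑ k ∈ Finset.Ico m n, a k * (s (k + 1) - s k)| ≤ 2 * a m := by
  -- Keeping the boundary term `a n * s n` inside closes the induction: each step costs at most `a n
  -- - a (n + 1)`, which telescopes.
  have key : |∑ k ∈ Finset.Ico m n, a k * (s (k + 1) - s k) - a n * s n| ≤ 2 * a m - a n := by
    induction n, hmn using Nat.le_induction with
    | base =>
      have := mul_le_of_le_one_right (ha0 m) (hs m)
      rw [Finset.Ico_self, Finset.sum_empty, zero_sub, abs_neg, abs_mul, abs_of_nonneg (ha0 m)]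
      linarith
    | succ n hmn ih =>
      rw [Finset.sum_Ico_succ_top hmn]
      have e : ∑ k ∈ Finset.Ico m n, a k * (s (k + 1) - s k) + a n * (s (n + 1) - s n) -
          a (n + 1) * s (n + 1) = (∑ k ∈ Finset.Ico m n, a k * (s (k + 1) - s k) - a n * s n) +
          (a n - a (n + 1)) * s (n + 1) := by ring
      rw [e]
      refine (abs_add_le _ _).trans ?_
      have h1 : |(a n - a (n + 1)) * s (n + 1)| ≤ a n - a (n + 1) := by
        rw [abs_mul, abs_of_nonneg (sub_nonneg.2 (ha n))]
        exact mul_le_of_le_one_right (sub_nonneg.2 (ha n)) (hs _)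
      linarith
  have h1 : |a n * s n| ≤ a n := by
    rw [abs_mul, abs_of_nonneg (ha0 n)]
    exact mul_le_of_le_one_right (ha0 n) (hs n)
  have h2 := abs_add_le (∑ k ∈ Finset.Ico m n, a k * (s (k + 1) - s k) - a n * s n) (a n * s n)
  rw [sub_add_cancel] at h2
  linarith

/-- The covariance of a block of the field at two points at distance `t`. -/
noncomputable def blockCov (m n : ℕ) (t : ℝ) : ℝ :=
  ∑ k ∈ Finset.Ico m n, Real.cos (2 * Real.pi * ((k : ℝ) + 1) * t) / ((k : ℝ) + 1)

/-- `2 sin (πt) cos (2π(k+1)t)` is the increment of `sin ((2k+1)πt)`, so summation by parts applies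
with the decreasing weights `1 / (k + 1)`. -/
lemma abs_sin_mul_blockCov_le {m n : ℕ} (hmn : m ≤ n) (t : ℝ) :
    |Real.sin (Real.pi * t)| * |blockCov m n t| ≤ 1 / ((m : ℝ) + 1) := by
  have h1 := abs_sum_mul_sub_le (a := fun k : ℕ => 1 / ((k : ℝ) + 1))
    (s := fun k : ℕ => Real.sin ((2 * (k : ℝ) + 1) * (Real.pi * t)))
    (fun k => by
      push_cast
      exact one_div_le_one_div_of_le (by positivity) (by linarith))
    (fun k => by positivity) (fun k => Real.abs_sin_le_one _) hmn
  have e : ∑ k ∈ Finset.Ico m n, 1 / ((k : ℝ) + 1) *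
      (Real.sin ((2 * ((k + 1 : ℕ) : ℝ) + 1) * (Real.pi * t)) -
        Real.sin ((2 * (k : ℝ) + 1) * (Real.pi * t))) =
      2 * (Real.sin (Real.pi * t) * blockCov m n t) := by
    rw [blockCov, Finset.mul_sum, Finset.mul_sum]
    refine Finset.sum_congr rfl fun k _ => ?_
    rw [Real.sin_sub_sin]
    have e1 : ((2 * ((k + 1 : ℕ) : ℝ) + 1) * (Real.pi * t) - (2 * (k : ℝ) + 1) * (Real.pi * t)) / 2
        = Real.pi * t := by push_cast; ring
    have e2 : ((2 * ((k + 1 : ℕ) : ℝ) + 1) * (Real.pi * t) + (2 * (k : ℝ) + 1) * (Real.pi * t)) / 2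
        = 2 * Real.pi * ((k : ℝ) + 1) * t := by push_cast; ring
    rw [e1, e2]
    ring
  rw [e, abs_mul, abs_mul, abs_of_pos (by norm_num : (0 : ℝ) < 2)] at h1
  linarith

/-- At most `m` terms, each at most `1 / (m + 1)`: this boundedness is why blocks are dyadic. -/
lemma abs_blockCov_le_one {m n : ℕ} (hn : n ≤ 2 * m) (t : ℝ) : |blockCov m n t| ≤ 1 := by
  refine (Finset.abs_sum_le_sum_abs _ _).trans ?_
  have h1 : ∀ k ∈ Finset.Ico m n, |Real.cos (2 * Real.pi * ((k : ℝ) + 1) * t) / ((k : ℝ) + 1)| ≤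
      1 / ((m : ℝ) + 1) := fun k hk => by
    have hk' : (m : ℝ) ≤ k := by exact_mod_cast (Finset.mem_Ico.1 hk).1
    rw [abs_div, abs_of_pos (by positivity : (0 : ℝ) < (k : ℝ) + 1)]
    exact div_le_div₀ zero_le_one (Real.abs_cos_le_one _) (by positivity) (by linarith)
  refine (Finset.sum_le_card_nsmul _ _ _ h1).trans ?_
  rw [Nat.card_Ico, nsmul_eq_mul, mul_one_div, div_le_one (by positivity)]
  have : ((n - m : ℕ) : ℝ) ≤ m := by exact_mod_cast (by omega : n - m ≤ m)
  linarith

lemma cosCoeff_mul_add_sinCoeff_mul (k : ℕ) (x y : unitInterval) :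
    cosCoeff k x * cosCoeff k y + sinCoeff k x * sinCoeff k y =
      Real.cos (2 * Real.pi * ((k : ℝ) + 1) * ((x : ℝ) - y)) / ((k : ℝ) + 1) := by
  have h : 1 / √((k : ℝ) + 1) * (1 / √((k : ℝ) + 1)) = 1 / ((k : ℝ) + 1) := by
    rw [div_mul_div_comm, Real.mul_self_sqrt (by positivity), one_mul]
  rw [mul_sub, Real.cos_sub, cosCoeff, cosCoeff, sinCoeff, sinCoeff]
  calc _ = (1 / √((k : ℝ) + 1) * (1 / √((k : ℝ) + 1))) *
      (Real.cos (2 * Real.pi * ((k : ℝ) + 1) * x) * Real.cos (2 * Real.pi * ((k : ℝ) + 1) * y) +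
        Real.sin (2 * Real.pi * ((k : ℝ) + 1) * x) *
          Real.sin (2 * Real.pi * ((k : ℝ) + 1) * y)) := by
        ring
    _ = _ := by rw [h]; ring

namespace IsStandardIID

variable {Ω : Type*} [MeasurableSpace Ω] {P : Measure Ω} {A B : ℕ → Ω → ℝ}
  (h : IsStandardIID P A B)
include h

omit h in
lemma conj_complexMGF (X : Ω → ℝ) (z : ℂ) :
    (starRingEnd ℂ) (complexMGF X P z) = complexMGF X P ((starRingEnd ℂ) z) := by
  rw [complexMGF, complexMGF, ← integral_conj]
  simp only [← Complex.exp_conj, map_mul, Complex.conj_ofReal]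

lemma integral_expWeight_mul_conj (β : ℂ) (m n : ℕ) (x y : unitInterval) :
    ∫ ω, expWeight P A B β m n x ω * (starRingEnd ℂ) (expWeight P A B β m n y ω) ∂P =
      ∏ k ∈ Finset.Ico m n,
        (complexMGF (A 0) P (β * cosCoeff k x + (starRingEnd ℂ) β * cosCoeff k y) *
          complexMGF (A 0) P (β * sinCoeff k x + (starRingEnd ℂ) β * sinCoeff k y)) /
        (factor P A β k x * (starRingEnd ℂ) (factor P A β k y)) := by
  rw [Finset.prod_div_distrib, ← h.integral_exp_sum, Finset.prod_mul_distrib, ← integral_div]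
  congr 1 with ω
  rw [expWeight, expWeight, map_div₀, ← Complex.exp_conj, div_mul_div_comm, ← Complex.exp_add,
    map_prod]
  congr 2
  simp only [blockField, field_eq, map_mul, Complex.conj_ofReal]
  push_cast
  rw [Finset.mul_sum, Finset.mul_sum, ← Finset.sum_add_distrib]
  exact Finset.sum_congr rfl fun k _ => by ring

/-- In `(βu + conj β v)² / 2` the pure squares cancel against the normalizers, leaving `|β|² u v`;
over cosine, sine and the index these cross terms add up to `blockCov`. At most `m` cubic errors of
order `m ^ (-3/2)` leave `O(m ^ (-1/2))`. -/
lemma exists_integral_expWeight_mul_conj_eq (L : ℝ) :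
    ∃ C : ℝ, 0 ≤ C ∧ ∃ N₀ : ℕ, ∀ β : ℂ, ‖β‖ ≤ L → ∀ m n : ℕ, N₀ ≤ m → n ≤ 2 * m →
      ∀ x y : unitInterval, ∃ e : ℂ, ‖e‖ ≤ C / √((m : ℝ) + 1) ∧
        ∫ ω, expWeight P A B β m n x ω * (starRingEnd ℂ) (expWeight P A B β m n y ω) ∂P =
          Complex.exp (((‖β‖ ^ 2 * blockCov m n ((x : ℝ) - y) : ℝ) : ℂ) + e) := by
  have := h.prob
  obtain ⟨ρ, hρ, C, hC, hexp⟩ := complexMGF_eq_exp (h.measurable_left 0) h.exp_moment h.mean h.var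
  choose! φ hφ hφ3 using hexp
  set L' := |L| with hL'
  -- From this index on, all arguments lie in the disc of radius `ρ` where the expansion holds.
  obtain ⟨N₀, hN₀⟩ := exists_nat_ge ((2 * L' / ρ) ^ 2)
  -- `20 = 2 * 2³ + 4`: two errors at arguments of size `2L'r` and four at size `L'r`.
  refine ⟨20 * C * L' ^ 3, by positivity, N₀, fun β hβ m n hm hn x y => ?_⟩
  have hβ' : ‖β‖ ≤ L' := hβ.trans (le_abs_self L)
  set β' := (starRingEnd ℂ) β with hβ'def
  have hβ'n : ‖β'‖ = ‖β‖ := Complex.norm_conj β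
  let e : ℕ → ℂ := fun k =>
    φ (β * cosCoeff k x + β' * cosCoeff k y) + φ (β * sinCoeff k x + β' * sinCoeff k y) -
      (φ (β * cosCoeff k x) + φ (β * sinCoeff k x) +
        (φ (β' * cosCoeff k y) + φ (β' * sinCoeff k y)))
  have hr : ∀ k, m ≤ k → 1 / √((k : ℝ) + 1) ≤ 1 / √((m : ℝ) + 1) := fun k hk => by
    have : (m : ℝ) ≤ k := by exact_mod_cast hk
    exact one_div_le_one_div_of_le (by positivity) (Real.sqrt_le_sqrt (by linarith))
  set r := 1 / √((m : ℝ) + 1) with hrdef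
  have hr0 : 0 ≤ r := by positivity
  have hLr : 2 * L' * r ≤ ρ := by
    have h1 : 2 * L' / ρ ≤ √((m : ℝ) + 1) := by
      apply Real.le_sqrt_of_sq_le
      have : (N₀ : ℝ) ≤ m := by exact_mod_cast hm
      linarith
    rw [div_le_iff₀ hρ] at h1
    rw [hrdef, mul_one_div, div_le_iff₀ (by positivity)]
    linarith
  have hsingle : ∀ (b : ℂ) (u : ℝ), ‖b‖ ≤ L' → |u| ≤ r → ‖b * u‖ ≤ L' * r := fun b u hb hu => by
    rw [norm_mul, Complex.norm_real, Real.norm_eq_abs]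
    gcongr
  have hLr0 : 0 ≤ L' * r := by positivity
  have hφ1 : ∀ (b : ℂ) (u : ℝ), ‖b‖ ≤ L' → |u| ≤ r →
      complexMGF (A 0) P (b * u) = Complex.exp ((b * u) ^ 2 / 2 + φ (b * u)) ∧
        ‖φ (b * u)‖ ≤ C * (L' * r) ^ 3 := fun b u hb hu => by
    have hle := hsingle b u hb hu
    refine ⟨hφ _ (by linarith), (hφ3 _ (by linarith)).trans ?_⟩
    gcongr
  have hφ2 : ∀ (u v : ℝ), |u| ≤ r → |v| ≤ r →
      complexMGF (A 0) P (β * u + β' * v) =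
        Complex.exp ((β * u + β' * v) ^ 2 / 2 + φ (β * u + β' * v)) ∧
        ‖φ (β * u + β' * v)‖ ≤ C * (2 * L' * r) ^ 3 := fun u v hu hv => by
    have hle : ‖β * u + β' * v‖ ≤ 2 * L' * r := (norm_add_le _ _).trans (by
      have h1 := hsingle β u hβ' hu
      have h2 := hsingle β' v (by rw [hβ'n]; exact hβ') hv
      linarith)
    refine ⟨hφ _ (by linarith), (hφ3 _ (by linarith)).trans ?_⟩
    gcongr
  have hβ'L : ‖β'‖ ≤ L' := by rw [hβ'n]; exact hβ'
  have hmain : ∀ k ∈ Finset.Ico m n,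
      (complexMGF (A 0) P (β * cosCoeff k x + β' * cosCoeff k y) *
          complexMGF (A 0) P (β * sinCoeff k x + β' * sinCoeff k y)) /
        (factor P A β k x * (starRingEnd ℂ) (factor P A β k y)) =
      Complex.exp (((‖β‖ ^ 2 * (Real.cos (2 * Real.pi * ((k : ℝ) + 1) * ((x : ℝ) - y)) /
        ((k : ℝ) + 1)) : ℝ) : ℂ) + e k) ∧ ‖e k‖ ≤ 20 * C * L' ^ 3 * r ^ 3 := by
    intro k hk
    have hk := (Finset.mem_Ico.1 hk).1
    have ux := (abs_cosCoeff_le k x).trans (hr k hk)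
    have uy := (abs_cosCoeff_le k y).trans (hr k hk)
    have vx := (abs_sinCoeff_le k x).trans (hr k hk)
    have vy := (abs_sinCoeff_le k y).trans (hr k hk)
    obtain ⟨e1, n1⟩ := hφ2 _ _ ux uy
    obtain ⟨e2, n2⟩ := hφ2 _ _ vx vy
    obtain ⟨e3, n3⟩ := hφ1 β _ hβ' ux
    obtain ⟨e4, n4⟩ := hφ1 β _ hβ' vx
    obtain ⟨e5, n5⟩ := hφ1 β' _ hβ'L uy
    obtain ⟨e6, n6⟩ := hφ1 β' _ hβ'L vy
    constructor
    · rw [factor, factor, map_mul, conj_complexMGF, conj_complexMGF, map_mul, map_mul,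
        Complex.conj_ofReal, Complex.conj_ofReal, ← hβ'def, e1, e2, e3, e4, e5, e6,
        ← Complex.exp_add, ← Complex.exp_add, ← Complex.exp_add, ← Complex.exp_add,
        ← Complex.exp_sub, ← cosCoeff_mul_add_sinCoeff_mul]
      congr 1
      have hn : ((‖β‖ : ℝ) : ℂ) ^ 2 = β * β' := (Complex.mul_conj' β).symm
      push_cast
      rw [hn]
      simp only [e]
      ring
    · have : ‖e k‖ ≤ (C * (2 * L' * r) ^ 3 + C * (2 * L' * r) ^ 3) +
          ((C * (L' * r) ^ 3 + C * (L' * r) ^ 3) + (C * (L' * r) ^ 3 + C * (L' * r) ^ 3)) := by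
        refine (norm_sub_le _ _).trans (add_le_add (norm_add_le_of_le n1 n2) ?_)
        exact norm_add_le_of_le (norm_add_le_of_le n3 n4) (norm_add_le_of_le n5 n6)
      refine this.trans (le_of_eq (by ring))
  refine ⟨∑ k ∈ Finset.Ico m n, e k, ?_, ?_⟩
  · refine (norm_sum_le_of_le _ fun k hk => (hmain k hk).2).trans ?_
    rw [Finset.sum_const, Nat.card_Ico, nsmul_eq_mul]
    have h1 : ((n - m : ℕ) : ℝ) ≤ (m : ℝ) + 1 := by
      have : ((n - m : ℕ) : ℝ) ≤ m := by exact_mod_cast (by omega : n - m ≤ m)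
      linarith
    have h2 : ((m : ℝ) + 1) * r ^ 2 = 1 := by
      rw [hrdef, div_pow, Real.sq_sqrt (by positivity)]
      field_simp
    calc ((n - m : ℕ) : ℝ) * (20 * C * L' ^ 3 * r ^ 3)
        ≤ ((m : ℝ) + 1) * (20 * C * L' ^ 3 * r ^ 3) := by gcongr
      _ = 20 * C * L' ^ 3 * r * (((m : ℝ) + 1) * r ^ 2) := by ring
      _ = 20 * C * L' ^ 3 / √((m : ℝ) + 1) := by rw [h2, hrdef]; ring
  · rw [h.integral_expWeight_mul_conj, Finset.prod_congr rfl fun k hk => (hmain k hk).1,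
      ← Complex.exp_sum, Finset.sum_add_distrib, blockCov, Finset.mul_sum]
    push_cast
    rfl

/-- The covariance kernel of a block is bounded, and small away from the diagonal. -/
lemma exists_norm_blockKernel_le (L : ℝ) :
    ∃ C : ℝ, 0 ≤ C ∧ ∃ N₀ : ℕ, ∀ β : ℂ, ‖β‖ ≤ L → ∀ m n : ℕ, N₀ ≤ m → m ≤ n → n ≤ 2 * m →
      ∀ δ : ℝ, 0 < δ → ∀ x y : unitInterval,
        ‖∫ ω, expWeight P A B β m n x ω * (starRingEnd ℂ) (expWeight P A B β m n y ω) ∂P - 1‖ ≤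
          C * ((if |Real.sin (Real.pi * ((x : ℝ) - y))| < δ then 1 else 0) +
            (1 / (((m : ℝ) + 1) * δ) + 1 / √((m : ℝ) + 1))) := by
  obtain ⟨C, hC, N₀, hK⟩ := h.exists_integral_expWeight_mul_conj_eq L
  -- From `|exp w - 1| ≤ |w| exp |w|`: the factor `|w|` keeps the off-diagonal decay, while the
  -- exponential only needs `|w| ≤ L² + C`.
  refine ⟨(L ^ 2 + C) * Real.exp (L ^ 2 + C), by positivity, N₀,
    fun β hβ m n hm hmn hn δ hδ x y => ?_⟩
  obtain ⟨e, he, hKe⟩ := hK β hβ m n hm hn x y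
  rw [hKe]
  set s := blockCov m n ((x : ℝ) - y) with hs
  set w : ℂ := ((‖β‖ ^ 2 * s : ℝ) : ℂ) + e with hw
  have hβ2 : ‖β‖ ^ 2 ≤ L ^ 2 := by gcongr
  have hsq : 0 < 1 / √((m : ℝ) + 1) := by positivity
  have he1 : ‖e‖ ≤ C * (1 / √((m : ℝ) + 1)) := by rw [mul_one_div]; exact he
  have hw1 : ‖w‖ ≤ L ^ 2 * |s| + C * (1 / √((m : ℝ) + 1)) := by
    refine (norm_add_le _ _).trans (add_le_add ?_ he1)
    rw [Complex.norm_real, Real.norm_eq_abs, abs_mul, abs_of_nonneg (sq_nonneg ‖β‖)]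
    gcongr
  have hs1 : |s| ≤ 1 := abs_blockCov_le_one hn _
  have hw2 : ‖w‖ ≤ L ^ 2 + C := by
    refine hw1.trans ?_
    have := mul_le_of_le_one_right hC (one_div_sqrt_le_one m)
    have := mul_le_of_le_one_right (sq_nonneg L) hs1
    linarith
  have hsK : |s| ≤ (if |Real.sin (Real.pi * ((x : ℝ) - y))| < δ then 1 else 0) +
      1 / (((m : ℝ) + 1) * δ) := by
    split_ifs with hlt
    · have : 0 < 1 / (((m : ℝ) + 1) * δ) := by positivity
      linarith
    · have h1 := abs_sin_mul_blockCov_le hmn ((x : ℝ) - y)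
      rw [zero_add, ← div_div, le_div_iff₀ hδ]
      refine le_trans ?_ h1
      rw [mul_comm]
      exact mul_le_mul_of_nonneg_right (not_lt.1 hlt) (abs_nonneg _)
  have h1 := Complex.norm_exp_sub_sum_le_norm_mul_exp w 1
  simp only [Finset.sum_range_one, pow_zero, Nat.factorial_zero, Nat.cast_one, div_one,
    pow_one] at h1
  refine h1.trans ?_
  set I : ℝ := if |Real.sin (Real.pi * ((x : ℝ) - y))| < δ then 1 else 0
  have hI : 0 ≤ I := by simp only [I]; split_ifs <;> norm_num
  have hd : 0 < 1 / (((m : ℝ) + 1) * δ) := by positivity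
  calc ‖w‖ * Real.exp ‖w‖
      ≤ ((L ^ 2 + C) * (I + (1 / (((m : ℝ) + 1) * δ) + 1 / √((m : ℝ) + 1)))) *
          Real.exp (L ^ 2 + C) := by
        refine mul_le_mul ?_ (Real.exp_le_exp.2 hw2) (Real.exp_pos _).le (by positivity)
        refine hw1.trans ?_
        have : L ^ 2 * |s| ≤ L ^ 2 * (I + 1 / (((m : ℝ) + 1) * δ)) := by gcongr
        have h3 : 0 ≤ L ^ 2 * (1 / √((m : ℝ) + 1)) := by positivity
        have h4 : 0 ≤ C * (I + 1 / (((m : ℝ) + 1) * δ)) := by positivity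
        linarith
    _ = _ := by ring

end IsStandardIID

/-! ### Neighbourhoods of the diagonal on the circle -/

/-- Jordan's inequality `sin θ ≥ 2θ / π` on `[0, π/2]`. The second alternative is there because the
endpoints `0` and `1` are the same point of the circle. -/
lemma abs_lt_of_abs_sin_pi_mul_lt {t δ : ℝ} (ht : |t| ≤ 1) (h : |Real.sin (Real.pi * t)| < δ) :
    |t| < δ / 2 ∨ 1 - |t| < δ / 2 := by
  have hpi := Real.pi_pos
  have e : |Real.sin (Real.pi * t)| = Real.sin (Real.pi * |t|) := by
    rw [Real.abs_sin_eq_sin_abs_of_abs_le_pi, abs_mul, abs_of_pos hpi]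
    rw [abs_mul, abs_of_pos hpi]
    nlinarith
  rw [e] at h
  rcases le_total |t| (1 / 2) with h2 | h2
  · left
    have := Real.mul_le_sin (x := Real.pi * |t|) (by positivity) (by nlinarith)
    have e2 : 2 / Real.pi * (Real.pi * |t|) = 2 * |t| := by field_simp
    linarith
  · right
    have := Real.mul_le_sin (x := Real.pi * (1 - |t|)) (mul_nonneg hpi.le (by linarith))
      (by nlinarith)
    have e2 : 2 / Real.pi * (Real.pi * (1 - |t|)) = 2 * (1 - |t|) := by field_simp
    have e3 : Real.sin (Real.pi * (1 - |t|)) = Real.sin (Real.pi * |t|) := by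
      rw [mul_sub, mul_one, Real.sin_pi_sub]
    linarith

/-- Such `y` lie within `δ / 2` of `x`, `x - 1` or `x + 1`: three intervals of length `δ`. -/
lemma volume_abs_sin_lt_le (x : unitInterval) (δ : ℝ) :
    volume {y : unitInterval | |Real.sin (Real.pi * ((x : ℝ) - y))| < δ} ≤
      ENNReal.ofReal (3 * δ) := by
  rcases le_or_gt δ 0 with hδ | hδ
  · have : {y : unitInterval | |Real.sin (Real.pi * ((x : ℝ) - y))| < δ} = ∅ :=
      Set.eq_empty_of_forall_notMem fun y hy => absurd (show _ < δ from hy)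
        (not_lt.2 (hδ.trans (abs_nonneg _)))
    simp [this]
  have hsub : (Subtype.val : unitInterval → ℝ) ''
      {y : unitInterval | |Real.sin (Real.pi * ((x : ℝ) - y))| < δ} ⊆
      Metric.ball (x : ℝ) (δ / 2) ∪
        (Metric.ball ((x : ℝ) - 1) (δ / 2) ∪ Metric.ball ((x : ℝ) + 1) (δ / 2)) := by
    rintro _ ⟨y, hy, rfl⟩
    have hx := x.2
    have hy' := y.2
    rw [Set.mem_Icc] at hx hy'
    have habs : |(x : ℝ) - y| ≤ 1 := abs_le.2 ⟨by linarith, by linarith⟩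
    simp only [Set.mem_union, Metric.mem_ball, Real.dist_eq]
    rcases abs_lt_of_abs_sin_pi_mul_lt habs hy with h1 | h1
    · left; rwa [abs_sub_comm]
    · right
      rcases le_total 0 ((x : ℝ) - y) with h2 | h2
      · rw [abs_of_nonneg h2] at h1
        left
        rw [abs_lt]; constructor <;> linarith
      · rw [abs_of_nonpos h2] at h1
        right
        rw [abs_lt]; constructor <;> linarith
  have hvol : volume {y : unitInterval | |Real.sin (Real.pi * ((x : ℝ) - y))| < δ} =
      volume ((Subtype.val : unitInterval → ℝ) ''
        {y : unitInterval | |Real.sin (Real.pi * ((x : ℝ) - y))| < δ}) :=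
    comap_subtype_coe_apply measurableSet_Icc volume _
  rw [hvol]
  refine (measure_mono hsub).trans ((measure_union_le _ _).trans
    ((add_le_add le_rfl (measure_union_le _ _)).trans ?_))
  simp only [Real.volume_ball]
  rw [← ENNReal.ofReal_add (by positivity) (by positivity),
    ← ENNReal.ofReal_add (by positivity) (by positivity)]
  exact ENNReal.ofReal_le_ofReal (by linarith)

/-! ### Second moment of a block increment -/

namespace IsStandardIID

variable {Ω : Type*} [MeasurableSpace Ω] {P : Measure Ω} {A B : ℕ → Ω → ℝ}
  (h : IsStandardIID P A B)
include h

lemma integral_sub_one_mul_conj_sub_one {β : ℂ} (hne : ∀ k x, factor P A β k x ≠ 0) (m n : ℕ)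
    (x y : unitInterval) :
    ∫ ω, (expWeight P A B β m n x ω - 1) * (starRingEnd ℂ) (expWeight P A B β m n y ω - 1) ∂P =
      ∫ ω, expWeight P A B β m n x ω * (starRingEnd ℂ) (expWeight P A B β m n y ω) ∂P - 1 := by
  have := h.prob
  obtain ⟨C, hC, hle⟩ := h.exists_norm_expWeight_le hne m n
  have hm := h.measurable_expWeight_left β m n
  have i1 : ∀ x, Integrable (fun ω => expWeight P A B β m n x ω) P := fun x =>
    h.integrable_of_norm_le (hm x).aestronglyMeasurable (hle x)
  have i2 : Integrable (fun ω => (starRingEnd ℂ) (expWeight P A B β m n y ω)) P :=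
    h.integrable_of_norm_le (Complex.continuous_conj.measurable.comp (hm y)).aestronglyMeasurable
      (fun ω => by rw [Complex.norm_conj]; exact hle y ω)
  have i3 : Integrable (fun ω => expWeight P A B β m n x ω *
      (starRingEnd ℂ) (expWeight P A B β m n y ω)) P := by
    refine h.integrable_of_norm_le (C := C * C) (t := ‖β‖ + ‖β‖) (n := n)
      ((hm x).mul (Complex.continuous_conj.measurable.comp (hm y))).aestronglyMeasurable
      fun ω => ?_
    rw [norm_mul, Complex.norm_conj, add_mul, Real.exp_add]
    calc _ ≤ (C * Real.exp (‖β‖ * majorant A B n ω)) * (C * Real.exp (‖β‖ * majorant A B n ω)) :=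
          mul_le_mul (hle x ω) (hle y ω) (norm_nonneg _) (by positivity)
      _ = _ := by ring
  have e : ∀ ω, (expWeight P A B β m n x ω - 1) *
      (starRingEnd ℂ) (expWeight P A B β m n y ω - 1) =
      (expWeight P A B β m n x ω * (starRingEnd ℂ) (expWeight P A B β m n y ω) -
        expWeight P A B β m n x ω) - ((starRingEnd ℂ) (expWeight P A B β m n y ω) - 1) := by
    intro ω; rw [map_sub, map_one]; ring
  simp_rw [e]
  have i4 : Integrable (fun ω => (starRingEnd ℂ) (expWeight P A B β m n y ω) - 1) P :=
    i2.sub (integrable_const 1)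
  have i5 : Integrable (fun ω => expWeight P A B β m n x ω *
      (starRingEnd ℂ) (expWeight P A B β m n y ω) - expWeight P A B β m n x ω) P := i3.sub (i1 x)
  rw [integral_sub i5 i4, integral_sub i3 (i1 x), integral_sub i2 (integrable_const 1),
    integral_conj, h.integral_expWeight fun k => hne k x, h.integral_expWeight fun k => hne k y]
  simp

/-- Second moment of a block increment, integrated against a function of the past. -/
lemma lintegral_sq_integral_mul_sub_one_le {β : ℂ} (hne : ∀ k x, factor P A β k x ≠ 0)
    {m n : ℕ} {g : Ω → unitInterval → ℂ} (hg : Measurable (Function.uncurry g))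
    (hgm : ∀ x, Measurable[coeffFiltration A B h.measurable_left h.measurable_right m]
      fun ω => g ω x) {c : ℝ} (hc : ∀ ω x, ‖g ω x‖ ≤ c) :
    ∫⁻ ω, ‖∫ x, g ω x * (expWeight P A B β m n x ω - 1)‖ₑ ^ 2 ∂P ≤
      ∫⁻ z : unitInterval × unitInterval, (∫⁻ ω, ‖g ω z.1‖ₑ * ‖g ω z.2‖ₑ ∂P) *
        ‖∫ ω, expWeight P A B β m n z.1 ω *
          (starRingEnd ℂ) (expWeight P A B β m n z.2 ω) ∂P - 1‖ₑ := by
  have := h.prob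
  obtain ⟨ω₀⟩ := P.nonempty_of_neZero
  have hc0 : 0 ≤ c := (norm_nonneg _).trans (hc ω₀ 0)
  obtain ⟨C, hC, hle⟩ := h.exists_norm_expWeight_le hne m n
  -- The bound `c` on `g` serves integrability only and is absent from the conclusion, so a large
  -- truncation level costs nothing here.
  set ψ : Ω → unitInterval → ℂ := fun ω x => g ω x * (expWeight P A B β m n x ω - 1) with hψ
  have hψm : Measurable (Function.uncurry ψ) :=
    hg.mul ((h.measurable_expWeight β m n).sub measurable_const)
  have hψle : ∀ ω x, ‖ψ ω x‖ ≤ c * (C + 1) * Real.exp (‖β‖ * majorant A B n ω) := fun ω x => by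
    have h1 : 1 ≤ Real.exp (‖β‖ * majorant A B n ω) :=
      Real.one_le_exp (mul_nonneg (norm_nonneg _) (majorant_nonneg A B n ω))
    rw [hψ, norm_mul, mul_assoc]
    refine mul_le_mul (hc ω x) ?_ (norm_nonneg _) hc0
    refine (norm_sub_le _ _).trans ?_
    rw [norm_one, add_mul, one_mul]
    exact add_le_add (hle x ω) h1
  have hΨm : Measurable (Function.uncurry fun (ω : Ω) (z : unitInterval × unitInterval) =>
      ψ ω z.1 * (starRingEnd ℂ) (ψ ω z.2)) :=
    (hψm.comp (measurable_fst.prodMk (measurable_fst.comp measurable_snd))).mul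
      (Complex.continuous_conj.measurable.comp
        (hψm.comp (measurable_fst.prodMk (measurable_snd.comp measurable_snd))))
  have hΨle : ∀ ω (z : unitInterval × unitInterval), ‖ψ ω z.1 * (starRingEnd ℂ) (ψ ω z.2)‖ ≤
      (c * (C + 1)) ^ 2 * Real.exp ((‖β‖ + ‖β‖) * majorant A B n ω) := fun ω z => by
    rw [norm_mul, Complex.norm_conj, add_mul, Real.exp_add]
    calc _ ≤ (c * (C + 1) * Real.exp (‖β‖ * majorant A B n ω)) *
          (c * (C + 1) * Real.exp (‖β‖ * majorant A B n ω)) :=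
          mul_le_mul (hψle ω _) (hψle ω _) (norm_nonneg _) (by positivity)
      _ = _ := by ring
  -- Writing the square as a double integral lets independence of past and block act at each pair of
  -- points.
  have hsq : ∀ ω, (∫ x, ψ ω x) * (starRingEnd ℂ) (∫ x, ψ ω x) =
      ∫ z : unitInterval × unitInterval, ψ ω z.1 * (starRingEnd ℂ) (ψ ω z.2) := fun ω => by
    rw [← integral_conj]
    exact (integral_prod_mul (ψ ω) fun y => (starRingEnd ℂ) (ψ ω y)).symm
  have hT : ∀ ω, ((‖∫ x, ψ ω x‖ ^ 2 : ℝ) : ℂ) =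
      ∫ z : unitInterval × unitInterval, ψ ω z.1 * (starRingEnd ℂ) (ψ ω z.2) := fun ω => by
    rw [← hsq, Complex.mul_conj']
    push_cast
    rfl
  have hTint : Integrable (fun ω => ‖∫ x, ψ ω x‖ ^ 2) P := by
    have hmeas : AEStronglyMeasurable (fun ω => ∫ x, ψ ω x) P :=
      (StronglyMeasurable.integral_prod_right hψm.stronglyMeasurable).aestronglyMeasurable
    refine h.integrable_of_norm_le (C := (c * (C + 1)) ^ 2) (t := ‖β‖ + ‖β‖) (n := n)
      (hmeas.norm.pow 2) fun ω => ?_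
    have := norm_integral_le_of_norm_le_const (μ := (volume : Measure unitInterval))
      (ae_of_all _ fun x => hψle ω x)
    rw [probReal_univ, mul_one] at this
    rw [norm_pow, norm_norm, add_mul, Real.exp_add]
    calc _ ≤ (c * (C + 1) * Real.exp (‖β‖ * majorant A B n ω)) ^ 2 := by gcongr
      _ = _ := by ring
  have e1 : ∫⁻ ω, ‖∫ x, ψ ω x‖ₑ ^ 2 ∂P = ‖∫ ω, ((‖∫ x, ψ ω x‖ ^ 2 : ℝ) : ℂ) ∂P‖ₑ := by
    rw [integral_complex_ofReal, ← ofReal_norm, Complex.norm_real, Real.norm_eq_abs,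
      abs_of_nonneg (integral_nonneg fun ω => by positivity),
      ofReal_integral_eq_lintegral_ofReal hTint (ae_of_all _ fun ω => by positivity)]
    refine lintegral_congr fun ω => ?_
    rw [ENNReal.ofReal_pow (norm_nonneg _), ofReal_norm]
  change ∫⁻ ω, ‖∫ x, ψ ω x‖ₑ ^ 2 ∂P ≤ _
  rw [e1]
  simp_rw [hT]
  rw [integral_integral_swap (h.integrable_prod_of_norm_le hΨm.aestronglyMeasurable
    (fun p => hΨle p.1 p.2))]
  refine (enorm_integral_le_lintegral_enorm _).trans (lintegral_mono fun z => ?_)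
  have hconj : Measurable (starRingEnd ℂ : ℂ → ℂ) := Complex.continuous_conj.measurable
  have hX : Measurable[coeffFiltration A B h.measurable_left h.measurable_right m]
      fun ω => g ω z.1 * (starRingEnd ℂ) (g ω z.2) :=
    (hgm z.1).mul (hconj.comp (hgm z.2))
  have hY : Measurable[tailAlgebra A B m] fun ω => (expWeight P A B β m n z.1 ω - 1) *
      (starRingEnd ℂ) (expWeight P A B β m n z.2 ω - 1) :=
    ((h.measurable_expWeight_tail β m n z.1).sub_const 1).mul
      (hconj.comp ((h.measurable_expWeight_tail β m n z.2).sub_const 1))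
  have hind := (h.indepFun_of_measurable hX hY).integral_fun_mul_eq_mul_integral
    (hX.mono (Filtration.le _ m) le_rfl).aestronglyMeasurable
    (hY.mono (h.tailAlgebra_le m) le_rfl).aestronglyMeasurable
  have e2 : ∀ ω, ψ ω z.1 * (starRingEnd ℂ) (ψ ω z.2) =
      (g ω z.1 * (starRingEnd ℂ) (g ω z.2)) * ((expWeight P A B β m n z.1 ω - 1) *
      (starRingEnd ℂ) (expWeight P A B β m n z.2 ω - 1)) := fun ω => by
    simp only [hψ, map_mul]; ring
  simp_rw [e2]
  rw [hind, h.integral_sub_one_mul_conj_sub_one hne, enorm_mul]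
  gcongr
  refine (enorm_integral_le_lintegral_enorm _).trans (le_of_eq (lintegral_congr fun ω => ?_))
  rw [enorm_mul, ← ofReal_norm ((starRingEnd ℂ) (g ω z.2)), Complex.norm_conj, ofReal_norm]

end IsStandardIID

lemma ENNReal_mul_le_sq_add_sq (a b : ENNReal) : a * b ≤ a ^ 2 + b ^ 2 := by
  rcases le_total a b with hab | hab
  · calc a * b ≤ b * b := by gcongr
      _ ≤ a ^ 2 + b ^ 2 := by rw [← sq]; exact le_add_self
  · calc a * b ≤ a * a := by gcongr
      _ ≤ a ^ 2 + b ^ 2 := by rw [← sq]; exact le_self_add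

/-- The indicator of the pairs of points close to each other on the circle. -/
noncomputable def nearIndicator (δ : ℝ) (z : unitInterval × unitInterval) : ENNReal :=
  {z : unitInterval × unitInterval |
    |Real.sin (Real.pi * ((z.1 : ℝ) - z.2))| < δ}.indicator (fun _ => 1) z

lemma measurable_nearIndicator (δ : ℝ) : Measurable (nearIndicator δ) := by
  refine measurable_const.indicator (IsOpen.measurableSet ?_)
  exact isOpen_lt (by fun_prop) continuous_const

lemma nearIndicator_swap (δ : ℝ) (x y : unitInterval) :
    nearIndicator δ (x, y) = nearIndicator δ (y, x) := by
  have : |Real.sin (Real.pi * ((x : ℝ) - y))| = |Real.sin (Real.pi * ((y : ℝ) - x))| := by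
    rw [← neg_sub, mul_neg, Real.sin_neg, abs_neg]
  simp only [nearIndicator, Set.indicator, Set.mem_ofPred_eq, this]

lemma lintegral_nearIndicator_le (δ : ℝ) (x : unitInterval) :
    ∫⁻ y, nearIndicator δ (x, y) ≤ ENNReal.ofReal (3 * δ) := by
  refine le_trans (le_of_eq ?_) (volume_abs_sin_lt_le x δ)
  have hs : MeasurableSet {y : unitInterval | |Real.sin (Real.pi * ((x : ℝ) - y))| < δ} :=
    (isOpen_lt (by fun_prop) continuous_const).measurableSet
  rw [← lintegral_indicator_one hs]
  rfl

/-- A Schur-type bound: `ab ≤ a² + b²`, then each variable is integrated over a set of measure at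
most `3δ`; hence `6δ`. -/
lemma lintegral_mul_mul_nearIndicator_le {a : unitInterval → ENNReal} (ha : Measurable a) (δ : ℝ) :
    ∫⁻ z : unitInterval × unitInterval, a z.1 * a z.2 * nearIndicator δ z ≤
      ENNReal.ofReal (6 * δ) * ∫⁻ x, a x ^ 2 := by
  have hm := measurable_nearIndicator δ
  have h1 : ∫⁻ z : unitInterval × unitInterval, a z.1 ^ 2 * nearIndicator δ z ≤
      ENNReal.ofReal (3 * δ) * ∫⁻ x, a x ^ 2 := by
    rw [Measure.volume_eq_prod, lintegral_prod _ (by fun_prop),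
      ← lintegral_const_mul _ (by fun_prop)]
    refine lintegral_mono fun x => ?_
    have hmx : Measurable fun y => nearIndicator δ (x, y) := hm.comp measurable_prodMk_left
    simp only
    rw [lintegral_const_mul _ hmx, mul_comm]
    exact mul_le_mul_left (lintegral_nearIndicator_le δ x) _
  have h2 : ∫⁻ z : unitInterval × unitInterval, a z.2 ^ 2 * nearIndicator δ z ≤
      ENNReal.ofReal (3 * δ) * ∫⁻ x, a x ^ 2 := by
    refine le_trans (le_of_eq ?_) h1
    rw [Measure.volume_eq_prod, ← lintegral_prod_swap]
    exact lintegral_congr fun z => by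
      simp only [Prod.snd_swap]; rw [Prod.swap, nearIndicator_swap]
  calc _ ≤ ∫⁻ z : unitInterval × unitInterval,
        (a z.1 ^ 2 * nearIndicator δ z + a z.2 ^ 2 * nearIndicator δ z) := by
        refine lintegral_mono fun z => ?_
        simp only
        rw [← add_mul]
        exact mul_le_mul_left (ENNReal_mul_le_sq_add_sq _ _) _
    _ ≤ ENNReal.ofReal (3 * δ) * (∫⁻ x, a x ^ 2) + ENNReal.ofReal (3 * δ) * ∫⁻ x, a x ^ 2 := by
        rw [lintegral_add_left (by fun_prop)]
        exact add_le_add h1 h2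
    _ = _ := by
        rw [← add_mul, ← two_mul, ← ENNReal.ofReal_ofNat 2, ← ENNReal.ofReal_mul (by norm_num)]
        ring_nf

/-- The size of the covariance kernel of a block off the diagonal. -/
noncomputable def offDiag (m : ℕ) (δ : ℝ) : ℝ := 1 / (((m : ℝ) + 1) * δ) + 1 / √((m : ℝ) + 1)

lemma offDiag_nonneg (m : ℕ) {δ : ℝ} (hδ : 0 < δ) : 0 ≤ offDiag m δ := by
  rw [offDiag]; positivity

namespace IsStandardIID

variable {Ω : Type*} [MeasurableSpace Ω] {P : Measure Ω} {A B : ℕ → Ω → ℝ}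
  (h : IsStandardIID P A B)
include h

/-- The width `δ` stays free so that it can be balanced later against the truncation level. The
first-moment bound on `R - 1` is for the part of `M` above that level. -/
lemma exists_lintegral_sq_integral_mul_sub_one_le (L : ℝ) :
    ∃ C : ℝ, 0 ≤ C ∧ ∃ N₀ : ℕ, ∀ β : ℂ, ‖β‖ ≤ L → (∀ k x, factor P A β k x ≠ 0) →
      ∀ m n : ℕ, N₀ ≤ m → m ≤ n → n ≤ 2 * m →
      (∀ x, ∫⁻ ω, ‖expWeight P A B β m n x ω - 1‖ₑ ∂P ≤ ENNReal.ofReal C) ∧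
      ∀ δ : ℝ, 0 < δ → ∀ g : Ω → unitInterval → ℂ, Measurable (Function.uncurry g) →
        (∀ x, Measurable[coeffFiltration A B h.measurable_left h.measurable_right m]
          fun ω => g ω x) → ∀ c : ℝ, (∀ ω x, ‖g ω x‖ ≤ c) →
        ∫⁻ ω, ‖∫ x, g ω x * (expWeight P A B β m n x ω - 1)‖ₑ ^ 2 ∂P ≤
          ENNReal.ofReal C * (ENNReal.ofReal δ * (∫⁻ ω, (∫⁻ x, ‖g ω x‖ₑ ^ 2) ∂P) +
            ENNReal.ofReal (offDiag m δ) * ∫⁻ ω, (∫⁻ x, ‖g ω x‖ₑ) ^ 2 ∂P) := by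
  have := h.prob
  obtain ⟨C, hC, N₀, hK⟩ := h.exists_norm_blockKernel_le L
  -- This covers the `6C` of the near-diagonal term, and `3C + 1` for the first moment: the kernel
  -- bound at `δ = 1` gives `𝔼 |R - 1|² ≤ 3C`, and `t ≤ t² + 1`.
  refine ⟨6 * C + 1, by positivity, N₀, fun β hβ hne m n hm hmn hn => ⟨fun x => ?_,
    fun δ hδ g hg hgm c hc => ?_⟩⟩
  · have hK1 := hK β hβ m n hm hmn hn 1 one_pos x x
    rw [← h.integral_sub_one_mul_conj_sub_one hne] at hK1
    obtain ⟨c, hc, hle⟩ := h.exists_norm_expWeight_le hne m n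
    have hmx := (h.measurable_expWeight_left β m n x).sub_const 1
    have hint : Integrable (fun ω => ‖expWeight P A B β m n x ω - 1‖ ^ 2) P := by
      refine h.integrable_of_norm_le (C := (c + 1) ^ 2) (t := ‖β‖ + ‖β‖) (n := n)
        (hmx.norm.pow_const 2).aestronglyMeasurable fun ω => ?_
      have h1 : 1 ≤ Real.exp (‖β‖ * majorant A B n ω) :=
        Real.one_le_exp (mul_nonneg (norm_nonneg _) (majorant_nonneg A B n ω))
      have h2 : ‖expWeight P A B β m n x ω - 1‖ ≤
          (c + 1) * Real.exp (‖β‖ * majorant A B n ω) := by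
        refine (norm_sub_le _ _).trans ?_
        rw [norm_one, add_mul, one_mul]
        exact add_le_add (hle x ω) h1
      rw [norm_pow, norm_norm, add_mul, Real.exp_add]
      calc _ ≤ ((c + 1) * Real.exp (‖β‖ * majorant A B n ω)) ^ 2 := by gcongr
        _ = _ := by ring
    have e : ∫ ω, (expWeight P A B β m n x ω - 1) *
        (starRingEnd ℂ) (expWeight P A B β m n x ω - 1) ∂P =
        ((∫ ω, ‖expWeight P A B β m n x ω - 1‖ ^ 2 ∂P : ℝ) : ℂ) := by
      rw [← integral_complex_ofReal]
      congr 1 with ω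
      rw [Complex.mul_conj']; push_cast; rfl
    rw [e, Complex.norm_real, Real.norm_eq_abs,
      abs_of_nonneg (integral_nonneg fun ω => by positivity)] at hK1
    have hoff : 1 / (((m : ℝ) + 1) * 1) + 1 / √((m : ℝ) + 1) ≤ 2 := by
      have h1 : 1 / (((m : ℝ) + 1) * 1) ≤ 1 := by
        rw [div_le_one (by positivity)]; linarith [Nat.cast_nonneg (α := ℝ) m]
      linarith [one_div_sqrt_le_one m]
    have hif : (if |Real.sin (Real.pi * ((x : ℝ) - x))| < 1 then (1 : ℝ) else 0) ≤ 1 := by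
      split_ifs <;> norm_num
    have hK2 : ∫ ω, ‖expWeight P A B β m n x ω - 1‖ ^ 2 ∂P ≤ C * 3 := by
      refine hK1.trans ?_
      gcongr
      linarith
    calc ∫⁻ ω, ‖expWeight P A B β m n x ω - 1‖ₑ ∂P
        ≤ ∫⁻ ω, (ENNReal.ofReal (‖expWeight P A B β m n x ω - 1‖ ^ 2) + 1) ∂P := by
          refine lintegral_mono fun ω => ?_
          rw [← ofReal_norm, ← ENNReal.ofReal_one, ← ENNReal.ofReal_add (by positivity) zero_le_one]
          exact ENNReal.ofReal_le_ofReal (by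
            nlinarith [sq_nonneg (‖expWeight P A B β m n x ω - 1‖ - 1),
              norm_nonneg (expWeight P A B β m n x ω - 1)])
      _ = ENNReal.ofReal (∫ ω, ‖expWeight P A B β m n x ω - 1‖ ^ 2 ∂P) + 1 := by
          rw [lintegral_add_right _ measurable_const, lintegral_one, measure_univ,
            ofReal_integral_eq_lintegral_ofReal hint (ae_of_all _ fun ω => by positivity)]
      _ ≤ ENNReal.ofReal (6 * C + 1) := by
          rw [← ENNReal.ofReal_one, ← ENNReal.ofReal_add
            (integral_nonneg fun ω => by positivity) zero_le_one]
          exact ENNReal.ofReal_le_ofReal (by linarith)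
  refine (h.lintegral_sq_integral_mul_sub_one_le hne hg hgm hc).trans ?_
  have hη := offDiag_nonneg m hδ
  have hker : ∀ z : unitInterval × unitInterval, ‖∫ ω, expWeight P A B β m n z.1 ω *
      (starRingEnd ℂ) (expWeight P A B β m n z.2 ω) ∂P - 1‖ₑ ≤
      ENNReal.ofReal C * (nearIndicator δ z + ENNReal.ofReal (offDiag m δ)) := fun z => by
    have e : nearIndicator δ z = ENNReal.ofReal
        (if |Real.sin (Real.pi * ((z.1 : ℝ) - z.2))| < δ then 1 else 0) := by
      simp only [nearIndicator, Set.indicator, Set.mem_ofPred_eq]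
      split_ifs <;> simp
    rw [e, ← ENNReal.ofReal_add (by split_ifs <;> norm_num) hη, ← ENNReal.ofReal_mul hC,
      ← ofReal_norm]
    exact ENNReal.ofReal_le_ofReal (hK β hβ m n hm hmn hn δ hδ z.1 z.2)
  have hgx : ∀ ω, Measurable fun x => ‖g ω x‖ₑ := fun ω =>
    (hg.comp measurable_prodMk_left).enorm
  have hG : Measurable fun p : (unitInterval × unitInterval) × Ω =>
      ‖g p.2 p.1.1‖ₑ * ‖g p.2 p.1.2‖ₑ :=
    (hg.comp (measurable_snd.prodMk (measurable_fst.comp measurable_fst))).enorm.mul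
      (hg.comp (measurable_snd.prodMk (measurable_snd.comp measurable_fst))).enorm
  have hG' : Measurable fun z : unitInterval × unitInterval =>
      ∫⁻ ω, ‖g ω z.1‖ₑ * ‖g ω z.2‖ₑ ∂P := hG.lintegral_prod_right'
  have hGz : ∀ z : unitInterval × unitInterval, Measurable fun ω => ‖g ω z.1‖ₑ * ‖g ω z.2‖ₑ :=
    fun z => hG.comp measurable_prodMk_left
  have hI := measurable_nearIndicator δ
  calc _ ≤ ∫⁻ z : unitInterval × unitInterval, ENNReal.ofReal C *
        ((∫⁻ ω, ‖g ω z.1‖ₑ * ‖g ω z.2‖ₑ * nearIndicator δ z ∂P) +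
          ENNReal.ofReal (offDiag m δ) * ∫⁻ ω, ‖g ω z.1‖ₑ * ‖g ω z.2‖ₑ ∂P) := by
        refine lintegral_mono fun z => ?_
        simp only
        rw [lintegral_mul_const _ (hGz z)]
        refine (mul_le_mul_right (hker z) _).trans (le_of_eq ?_)
        ring
    _ = ENNReal.ofReal C *
        ((∫⁻ ω, (∫⁻ z : unitInterval × unitInterval,
          ‖g ω z.1‖ₑ * ‖g ω z.2‖ₑ * nearIndicator δ z) ∂P) +
          ENNReal.ofReal (offDiag m δ) * ∫⁻ ω, (∫⁻ x, ‖g ω x‖ₑ) ^ 2 ∂P) := by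
        rw [lintegral_const_mul' _ _ ENNReal.ofReal_ne_top,
          lintegral_add_right _ (hG'.const_mul _), lintegral_const_mul _ hG',
          lintegral_lintegral_swap (hG.mul (hI.comp measurable_fst)).aemeasurable,
          lintegral_lintegral_swap (f := fun (z : unitInterval × unitInterval) ω =>
            ‖g ω z.1‖ₑ * ‖g ω z.2‖ₑ) hG.aemeasurable]
        congr 3
        refine lintegral_congr fun ω => ?_
        rw [Measure.volume_eq_prod, lintegral_prod_mul (hgx ω).aemeasurable (hgx ω).aemeasurable,
            sq]
    _ ≤ ENNReal.ofReal C * (ENNReal.ofReal (6 * δ) * (∫⁻ ω, (∫⁻ x, ‖g ω x‖ₑ ^ 2) ∂P) +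
          ENNReal.ofReal (offDiag m δ) * ∫⁻ ω, (∫⁻ x, ‖g ω x‖ₑ) ^ 2 ∂P) := by
        gcongr
        rw [← lintegral_const_mul' _ _ ENNReal.ofReal_ne_top]
        exact lintegral_mono fun ω => lintegral_mul_mul_nearIndicator_le (hgx ω) δ
    _ ≤ _ := by
        have e6 : ENNReal.ofReal C * ENNReal.ofReal (6 * δ) ≤
            ENNReal.ofReal (6 * C + 1) * ENNReal.ofReal δ := by
          rw [← ENNReal.ofReal_mul hC, ← ENNReal.ofReal_mul (by positivity)]
          exact ENNReal.ofReal_le_ofReal (by nlinarith)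
        have e7 : ENNReal.ofReal C ≤ ENNReal.ofReal (6 * C + 1) :=
          ENNReal.ofReal_le_ofReal (by linarith)
        rw [mul_add, mul_add, ← mul_assoc, ← mul_assoc, ← mul_assoc, ← mul_assoc]
        gcongr

end IsStandardIID

/-! ### Truncation and the mean of a block increment -/

/-- The complex number `z` if its modulus is at most `r`, and `0` otherwise. -/
noncomputable def truncate (r : ℝ) (z : ℂ) : ℂ := if ‖z‖ ≤ r then z else 0

lemma measurable_truncate (r : ℝ) : Measurable (truncate r) :=
  Measurable.ite (isClosed_le continuous_norm continuous_const).measurableSet measurable_id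
    measurable_const

lemma norm_truncate_le {r : ℝ} (hr : 0 ≤ r) (z : ℂ) : ‖truncate r z‖ ≤ r := by
  rw [truncate]; split_ifs with h
  · exact h
  · simpa using hr

lemma norm_truncate_le_norm (r : ℝ) (z : ℂ) : ‖truncate r z‖ ≤ ‖z‖ := by
  rw [truncate]; split_ifs with h
  · exact le_rfl
  · simp

lemma enorm_rpow_eq (z : ℂ) {p : ℝ} (hp : 0 ≤ p) : ‖z‖ₑ ^ p = ENNReal.ofReal (‖z‖ ^ p) := by
  rw [← ENNReal.ofReal_rpow_of_nonneg (norm_nonneg _) hp, ofReal_norm]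

/-- Below the level, `|z|² = |z|^(2-p) |z|^p` and the first factor is at most `r^(2-p)`: a `p`-th
moment controls the second moment of the truncation. -/
lemma enorm_truncate_sq_le {r p : ℝ} (hp0 : 0 < p) (hp : p ≤ 2) (z : ℂ) :
    ‖truncate r z‖ₑ ^ 2 ≤ ENNReal.ofReal (r ^ (2 - p)) * ‖z‖ₑ ^ p := by
  rw [truncate]; split_ifs with h
  · rcases eq_or_ne z 0 with rfl | hz
    · simp
    have hz' : 0 < ‖z‖ := norm_pos_iff.2 hz
    have hr : 0 ≤ r := hz'.le.trans h
    rw [enorm_rpow_eq z hp0.le, ← ENNReal.ofReal_mul (by positivity), ← ofReal_norm,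
      ← ENNReal.ofReal_pow (norm_nonneg _)]
    refine ENNReal.ofReal_le_ofReal ?_
    calc ‖z‖ ^ 2 = ‖z‖ ^ (2 - p) * ‖z‖ ^ p := by
          rw [← Real.rpow_add hz', sub_add_cancel, Real.rpow_two]
      _ ≤ r ^ (2 - p) * ‖z‖ ^ p := by gcongr
  · simp

/-- Markov's inequality in pointwise form: above the level, `|z|^(1-p) ≤ r^(1-p)`. -/
lemma enorm_sub_truncate_le {r p : ℝ} (hr : 0 < r) (hp : 1 ≤ p) (z : ℂ) :
    ‖z - truncate r z‖ₑ ≤ ENNReal.ofReal (r ^ (1 - p)) * ‖z‖ₑ ^ p := by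
  rw [truncate]; split_ifs with h
  · simp
  · rw [not_le] at h
    have hz' : 0 < ‖z‖ := hr.trans h
    rw [enorm_rpow_eq z (by linarith), ← ENNReal.ofReal_mul (by positivity), sub_zero,
      ← ofReal_norm]
    refine ENNReal.ofReal_le_ofReal ?_
    calc ‖z‖ = ‖z‖ ^ (1 - p) * ‖z‖ ^ p := by
          rw [← Real.rpow_add hz', sub_add_cancel, Real.rpow_one]
      _ ≤ r ^ (1 - p) * ‖z‖ ^ p := by
          gcongr ?_ * _
          exact Real.rpow_le_rpow_of_nonpos hr h.le (by linarith)

namespace IsStandardIID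

variable {Ω : Type*} [MeasurableSpace Ω] {P : Measure Ω} {A B : ℕ → Ω → ℝ}
  (h : IsStandardIID P A B)
include h

lemma measurable_expWeight_right (β : ℂ) (m n : ℕ) (ω : Ω) :
    Measurable fun x => expWeight P A B β m n x ω := by
  simpa only [Function.comp_def] using (h.measurable_expWeight β m n).comp
    (measurable_prodMk_left (x := ω) : Measurable (fun x : unitInterval => (ω, x)))

lemma chaos_sub_chaos (f : C(unitInterval, ℂ)) {β : ℂ} (hne : ∀ k x, factor P A β k x ≠ 0)
    {m n : ℕ} (hmn : m ≤ n) (r : ℝ) (ω : Ω) :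
    chaos P A B f β n ω - chaos P A B f β m ω =
      (∫ x : unitInterval, f x * truncate r (expWeight P A B β 0 m x ω) *
        (expWeight P A B β m n x ω - 1)) +
      ∫ x : unitInterval, f x * (expWeight P A B β 0 m x ω -
        truncate r (expWeight P A B β 0 m x ω)) * (expWeight P A B β m n x ω - 1) := by
  obtain ⟨C₁, hC₁, h1⟩ := h.exists_norm_expWeight_le hne 0 m
  obtain ⟨C₂, hC₂, h2⟩ := h.exists_norm_expWeight_le hne m n
  obtain ⟨C₃, hC₃, h3⟩ := h.exists_norm_mul_expWeight_le f hne 0 m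
  obtain ⟨C₄, hC₄, h4⟩ := h.exists_norm_mul_expWeight_le f hne 0 n
  have hf : Measurable f := f.continuous.measurable
  have m1 := h.measurable_expWeight_right β 0 m ω
  have m2 := h.measurable_expWeight_right β m n ω
  have m3 := h.measurable_expWeight_right β 0 n ω
  have m4 := (measurable_truncate r).comp m1
  have hR : ∀ x, ‖expWeight P A B β m n x ω - 1‖ ≤ C₂ * Real.exp (‖β‖ * majorant A B n ω) + 1 :=
    fun x => (norm_sub_le _ _).trans (by rw [norm_one]; exact add_le_add (h2 x ω) le_rfl)
  have i1 : Integrable (fun x : unitInterval =>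
      f x * truncate r (expWeight P A B β 0 m x ω) * (expWeight P A B β m n x ω - 1)) := by
    refine Integrable.of_bound ((hf.mul m4).mul (m2.sub_const 1)).aestronglyMeasurable
      (C₃ * Real.exp (‖β‖ * majorant A B m ω) *
        (C₂ * Real.exp (‖β‖ * majorant A B n ω) + 1)) (ae_of_all _ fun x => ?_)
    rw [norm_mul]
    refine mul_le_mul ((le_trans ?_ (h3 x ω))) (hR x) (norm_nonneg _) (by positivity)
    rw [norm_mul, norm_mul]
    gcongr
    exact norm_truncate_le_norm _ _
  have i3 : Integrable (fun x : unitInterval =>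
      f x * expWeight P A B β 0 m x ω * (expWeight P A B β m n x ω - 1)) := by
    refine Integrable.of_bound ((hf.mul m1).mul (m2.sub_const 1)).aestronglyMeasurable
      (C₃ * Real.exp (‖β‖ * majorant A B m ω) *
        (C₂ * Real.exp (‖β‖ * majorant A B n ω) + 1)) (ae_of_all _ fun x => ?_)
    rw [norm_mul]
    exact mul_le_mul (h3 x ω) (hR x) (norm_nonneg _) (by positivity)
  have i2 : Integrable (fun x : unitInterval => f x * (expWeight P A B β 0 m x ω -
      truncate r (expWeight P A B β 0 m x ω)) * (expWeight P A B β m n x ω - 1)) :=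
    (i3.sub i1).congr (ae_of_all _ fun x => by simp only [Pi.sub_apply]; ring)
  rw [h.chaos_eq, h.chaos_eq, ← integral_add i1 i2, ← integral_sub]
  · refine integral_congr_ae (ae_of_all _ fun x => ?_)
    simp only
    rw [← expWeight_mul P A B β (Nat.zero_le m) hmn]
    ring
  · exact Integrable.of_bound (hf.mul m3).aestronglyMeasurable _ (ae_of_all _ fun x => h4 x ω)
  · exact Integrable.of_bound (hf.mul m1).aestronglyMeasurable _ (ae_of_all _ fun x => h3 x ω)

/-- No cancellation in `R - 1` is needed here: at each point the excess of `M` is independent of the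
block, so first moments multiply. -/
lemma lintegral_tail_le (f : C(unitInterval, ℂ)) {β : ℂ} {m n : ℕ} {C : ENNReal}
    (hR : ∀ x, ∫⁻ ω, ‖expWeight P A B β m n x ω - 1‖ₑ ∂P ≤ C) {p : ℝ} (hp1 : 1 ≤ p)
    {G : ENNReal} (hG : ∀ x, ∫⁻ ω, ‖expWeight P A B β 0 m x ω‖ₑ ^ p ∂P ≤ G) {r : ℝ} (hr : 0 < r) :
    ∫⁻ ω, ‖∫ x : unitInterval, f x * (expWeight P A B β 0 m x ω -
        truncate r (expWeight P A B β 0 m x ω)) * (expWeight P A B β m n x ω - 1)‖ₑ ∂P ≤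
      ‖f‖ₑ * (ENNReal.ofReal (r ^ (1 - p)) * G) * C := by
  have := h.prob
  have hM := h.measurable_expWeight β 0 m
  have hR' := h.measurable_expWeight β m n
  have hf : Measurable fun q : Ω × unitInterval => f q.2 :=
    f.continuous.measurable.comp measurable_snd
  have hmeas : Measurable fun q : Ω × unitInterval => ‖f q.2 * (expWeight P A B β 0 m q.2 q.1 -
        truncate r (expWeight P A B β 0 m q.2 q.1)) * (expWeight P A B β m n q.2 q.1 - 1)‖ₑ :=
    ((hf.mul (hM.sub ((measurable_truncate r).comp hM))).mul (hR'.sub_const 1)).enorm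
  calc _ ≤ ∫⁻ ω, (∫⁻ x : unitInterval, ‖f x * (expWeight P A B β 0 m x ω -
        truncate r (expWeight P A B β 0 m x ω)) * (expWeight P A B β m n x ω - 1)‖ₑ) ∂P :=
        lintegral_mono fun ω => enorm_integral_le_lintegral_enorm _
    _ = ∫⁻ x : unitInterval, ∫⁻ ω, ‖f x * (expWeight P A B β 0 m x ω -
        truncate r (expWeight P A B β 0 m x ω)) * (expWeight P A B β m n x ω - 1)‖ₑ ∂P :=
        lintegral_lintegral_swap hmeas.aemeasurable
    _ ≤ ∫⁻ _ : unitInterval, ‖f‖ₑ * (ENNReal.ofReal (r ^ (1 - p)) * G) * C := by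
        refine lintegral_mono fun x => ?_
        simp only [enorm_mul]
        have hX := measurable_enorm.comp ((h.measurable_expWeight_filtration_left β m x).sub
          ((measurable_truncate r).comp (h.measurable_expWeight_filtration_left β m x)))
        have hY := measurable_enorm.comp ((h.measurable_expWeight_tail β m n x).sub_const 1)
        have hXm := hX.mono (Filtration.le _ m) le_rfl
        have hYm := hY.mono (h.tailAlgebra_le m) le_rfl
        have hind := lintegral_mul_eq_lintegral_mul_lintegral_of_indepFun''
          hXm.aemeasurable hYm.aemeasurable (h.indepFun_of_measurable hX hY)
        have e : ∀ ω, ‖f x‖ₑ * ‖expWeight P A B β 0 m x ω -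
            truncate r (expWeight P A B β 0 m x ω)‖ₑ * ‖expWeight P A B β m n x ω - 1‖ₑ =
            ‖f x‖ₑ * (‖expWeight P A B β 0 m x ω -
            truncate r (expWeight P A B β 0 m x ω)‖ₑ * ‖expWeight P A B β m n x ω - 1‖ₑ) :=
          fun ω => mul_assoc _ _ _
        simp_rw [e]
        rw [lintegral_const_mul' _ _ enorm_ne_top]
        refine (mul_le_mul_right hind.le _).trans ?_
        rw [← mul_assoc]
        have hfx : ‖f x‖ₑ ≤ ‖f‖ₑ := by
          rw [← ofReal_norm, ← ofReal_norm]
          exact ENNReal.ofReal_le_ofReal (f.norm_coe_le_norm x)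
        refine mul_le_mul' (mul_le_mul' hfx ?_) (hR x)
        calc _ ≤ ∫⁻ ω, ENNReal.ofReal (r ^ (1 - p)) * ‖expWeight P A B β 0 m x ω‖ₑ ^ p ∂P :=
              lintegral_mono fun ω => enorm_sub_truncate_le hr hp1 _
          _ ≤ _ := by
              rw [lintegral_const_mul' _ _ ENNReal.ofReal_ne_top]
              exact mul_le_mul_right (hG x) _
    _ = _ := by rw [lintegral_const, measure_univ, mul_one]

end IsStandardIID

namespace IsStandardIID

variable {Ω : Type*} [MeasurableSpace Ω] {P : Measure Ω} {A B : ℕ → Ω → ℝ}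
  (h : IsStandardIID P A B)
include h

/-- The off-diagonal term contains `(∫ |g|)²`, whereas only the mean of `L = ∫ |f M|` is controlled.
Multiplying by `v = (1 + L)^(-1/2)`, a function of the past, turns this term into `v² L² ≤ L`. The
weight is removed at the end, at the price of `a (1 + L)`. -/
lemma lintegral_truncated_le (f : C(unitInterval, ℂ)) {β : ℂ} (hne : ∀ k x, factor P A β k x ≠ 0)
    {m n : ℕ} {C δ η : ENNReal}
    (hT : ∀ g : Ω → unitInterval → ℂ, Measurable (Function.uncurry g) →
        (∀ x, Measurable[coeffFiltration A B h.measurable_left h.measurable_right m]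
          fun ω => g ω x) → ∀ c : ℝ, (∀ ω x, ‖g ω x‖ ≤ c) →
        ∫⁻ ω, ‖∫ x, g ω x * (expWeight P A B β m n x ω - 1)‖ₑ ^ 2 ∂P ≤
          C * (δ * (∫⁻ ω, (∫⁻ x, ‖g ω x‖ₑ ^ 2) ∂P) + η * ∫⁻ ω, (∫⁻ x, ‖g ω x‖ₑ) ^ 2 ∂P))
    {p : ℝ} (hp0 : 0 < p) (hp2 : p ≤ 2) {G₁ G : ENNReal}
    (hG₁ : ∀ x, ∫⁻ ω, ‖expWeight P A B β 0 m x ω‖ₑ ∂P ≤ G₁)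
    (hG : ∀ x, ∫⁻ ω, ‖expWeight P A B β 0 m x ω‖ₑ ^ p ∂P ≤ G) {r : ℝ} (hr : 0 ≤ r)
    {a : ℝ} (ha : 0 < a) :
    ∫⁻ ω, ‖∫ x : unitInterval, f x * truncate r (expWeight P A B β 0 m x ω) *
        (expWeight P A B β m n x ω - 1)‖ₑ ∂P ≤
      ENNReal.ofReal a * (1 + ‖f‖ₑ * G₁) + ENNReal.ofReal a⁻¹ *
        (C * (δ * (‖f‖ₑ ^ 2 * (ENNReal.ofReal (r ^ (2 - p)) * G)) + η * (‖f‖ₑ * G₁))) := by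
  have := h.prob
  set M : Ω → unitInterval → ℂ := fun ω x => expWeight P A B β 0 m x ω with hMdef
  have hM : Measurable (Function.uncurry M) := h.measurable_expWeight β 0 m
  have hMx : ∀ ω, Measurable (M ω) := fun ω => h.measurable_expWeight_right β 0 m ω
  have hf : Measurable fun q : Ω × unitInterval => f q.2 :=
    f.continuous.measurable.comp measurable_snd
  have hfx : ∀ x, ‖f x‖ₑ ≤ ‖f‖ₑ := fun x => by
    rw [← ofReal_norm, ← ofReal_norm]
    exact ENNReal.ofReal_le_ofReal (f.norm_coe_le_norm x)
  set L : Ω → ENNReal := fun ω => ∫⁻ x, ‖f x * M ω x‖ₑ with hL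
  have hfM : Measurable fun q : Ω × unitInterval => ‖f q.2 * M q.1 q.2‖ₑ := (hf.mul hM).enorm
  have hLm : Measurable L := hfM.lintegral_prod_right'
  have hLF : Measurable[coeffFiltration A B h.measurable_left h.measurable_right m] L :=
    @Measurable.lintegral_prod_right' Ω unitInterval
      (coeffFiltration A B h.measurable_left h.measurable_right m) _ volume _ _
      (measurable_enorm.comp (Measurable.mul (f.continuous.measurable.comp measurable_snd)
        (h.measurable_expWeight_filtration β m)))
  have hLtop : ∀ ω, L ω ≠ ⊤ := fun ω => by
    obtain ⟨c, hc, hle⟩ := h.exists_norm_mul_expWeight_le f hne 0 m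
    refine (lt_of_le_of_lt (lintegral_mono (g := fun _ => ENNReal.ofReal
      (c * Real.exp (‖β‖ * majorant A B m ω))) fun x => ?_) ?_).ne
    · rw [← ofReal_norm]; exact ENNReal.ofReal_le_ofReal (hle x ω)
    · rw [lintegral_const, measure_univ, mul_one]; exact ENNReal.ofReal_lt_top
  set w : Ω → ℝ := fun ω => 1 + (L ω).toReal with hw
  have hw1 : ∀ ω, 1 ≤ w ω := fun ω => by
    have : 0 ≤ (L ω).toReal := ENNReal.toReal_nonneg
    simp only [hw]; linarith
  set v : Ω → ℝ := fun ω => (√(w ω))⁻¹ with hv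
  have hv0 : ∀ ω, 0 ≤ v ω := fun ω => by simp only [hv]; positivity
  have hvw : ∀ ω, v ω ^ 2 * w ω = 1 := fun ω => by
    have : 0 < w ω := by linarith [hw1 ω]
    simp only [hv]
    rw [inv_pow, Real.sq_sqrt this.le, inv_mul_cancel₀ this.ne']
  have hv1 : ∀ ω, v ω ≤ 1 := fun ω => by
    simp only [hv]
    exact inv_le_one_of_one_le₀ (Real.one_le_sqrt.2 (hw1 ω))
  have hφ : Measurable fun l : ENNReal => (√(1 + l.toReal))⁻¹ :=
    (Real.continuous_sqrt.measurable.comp (measurable_const.add ENNReal.measurable_toReal)).inv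
  have hvm : Measurable v := hφ.comp hLm
  have hvF : Measurable[coeffFiltration A B h.measurable_left h.measurable_right m] v :=
    hφ.comp hLF
  set T : Ω → ℂ := fun ω => ∫ x : unitInterval, f x * truncate r (M ω x) *
        (expWeight P A B β m n x ω - 1) with hTdef
  have hTg := hT (fun ω x => (v ω : ℂ) * (f x * truncate r (M ω x)))
    ((hvm.complex_ofReal.comp measurable_fst).mul (hf.mul ((measurable_truncate r).comp hM)))
    (fun x => Measurable.mul (Complex.measurable_ofReal.comp hvF) (measurable_const.mul
      ((measurable_truncate r).comp (h.measurable_expWeight_filtration_left β m x))))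
    (‖f‖ * r) (fun ω x => by
      rw [norm_mul, norm_mul, Complex.norm_real, Real.norm_eq_abs, abs_of_nonneg (hv0 ω)]
      calc v ω * (‖f x‖ * ‖truncate r (M ω x)‖) ≤ 1 * (‖f‖ * r) := by
            gcongr
            · exact hv1 ω
            · exact f.norm_coe_le_norm x
            · exact norm_truncate_le hr _
        _ = _ := one_mul _)
  have hvT : ∀ ω, (∫ x : unitInterval, (v ω : ℂ) * (f x * truncate r (M ω x)) *
      (expWeight P A B β m n x ω - 1)) = (v ω : ℂ) * T ω := fun ω => by
    rw [hTdef, ← integral_const_mul]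
    simp only [mul_assoc]
  simp_rw [hvT] at hTg
  -- Young's inequality `|T| ≤ a w + (a w)⁻¹ |T|²`, with `w = 1 + L = v⁻²`.
  have hpoint : ∀ ω, ‖T ω‖ₑ ≤ ENNReal.ofReal a * (1 + L ω) +
      ENNReal.ofReal a⁻¹ * ‖(v ω : ℂ) * T ω‖ₑ ^ 2 := fun ω => by
    have e1 : 1 + L ω = ENNReal.ofReal (w ω) := by
      simp only [hw]
      rw [ENNReal.ofReal_add zero_le_one ENNReal.toReal_nonneg, ENNReal.ofReal_one,
        ENNReal.ofReal_toReal (hLtop ω)]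
    rw [e1, ← ENNReal.ofReal_mul ha.le, ← ofReal_norm, ← ofReal_norm,
      ← ENNReal.ofReal_pow (norm_nonneg _), ← ENNReal.ofReal_mul (by positivity),
      ← ENNReal.ofReal_add (mul_nonneg ha.le (by linarith [hw1 ω])) (by positivity)]
    refine ENNReal.ofReal_le_ofReal ?_
    rw [norm_mul, Complex.norm_real, Real.norm_eq_abs, abs_of_nonneg (hv0 ω), mul_pow]
    have hw0 : 0 < w ω := by linarith [hw1 ω]
    have e2 : v ω ^ 2 = (w ω)⁻¹ := eq_inv_of_mul_eq_one_left (hvw ω)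
    rw [e2]
    have e3 : a * w ω + a⁻¹ * ((w ω)⁻¹ * ‖T ω‖ ^ 2) - ‖T ω‖ =
        ((a * w ω - ‖T ω‖) ^ 2 + a * w ω * ‖T ω‖) / (a * w ω) := by
      field_simp
      ring
    have e4 : 0 ≤ ((a * w ω - ‖T ω‖) ^ 2 + a * w ω * ‖T ω‖) / (a * w ω) := by positivity
    linarith
  have hswap1 : ∫⁻ ω, L ω ∂P ≤ ‖f‖ₑ * G₁ := by
    rw [hL]
    rw [lintegral_lintegral_swap (f := fun ω x => ‖f x * M ω x‖ₑ) hfM.aemeasurable]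
    refine (lintegral_mono (g := fun _ => ‖f‖ₑ * G₁) fun x => ?_).trans_eq (by simp)
    simp only [enorm_mul]
    rw [lintegral_const_mul' _ _ enorm_ne_top]
    exact mul_le_mul' (hfx x) (hG₁ x)
  have hswap2 : ∫⁻ ω, (∫⁻ x, ‖(v ω : ℂ) * (f x * truncate r (M ω x))‖ₑ ^ 2) ∂P ≤
      ‖f‖ₑ ^ 2 * (ENNReal.ofReal (r ^ (2 - p)) * G) := by
    calc _ ≤ ∫⁻ ω, (∫⁻ x, ‖f‖ₑ ^ 2 * (ENNReal.ofReal (r ^ (2 - p)) * ‖M ω x‖ₑ ^ p)) ∂P := by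
          refine lintegral_mono fun ω => lintegral_mono fun x => ?_
          simp only
          rw [enorm_mul, enorm_mul, mul_pow, mul_pow]
          have hve : ‖(v ω : ℂ)‖ₑ ^ 2 ≤ 1 := by
            refine pow_le_one₀ zero_le ?_
            rw [← ofReal_norm, Complex.norm_real, Real.norm_eq_abs, abs_of_nonneg (hv0 ω)]
            exact ENNReal.ofReal_le_one.2 (hv1 ω)
          calc _ ≤ 1 * (‖f‖ₑ ^ 2 * (ENNReal.ofReal (r ^ (2 - p)) * ‖M ω x‖ₑ ^ p)) :=
                mul_le_mul' hve (mul_le_mul' (by gcongr; exact hfx x)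
                  (enorm_truncate_sq_le hp0 hp2 _))
            _ = _ := one_mul _
      _ = ∫⁻ x, ∫⁻ ω, ‖f‖ₑ ^ 2 * (ENNReal.ofReal (r ^ (2 - p)) * ‖M ω x‖ₑ ^ p) ∂P := by
          have : Measurable fun q : Ω × unitInterval =>
              ‖f‖ₑ ^ 2 * (ENNReal.ofReal (r ^ (2 - p)) * ‖M q.1 q.2‖ₑ ^ p) :=
            ((hM.enorm.pow_const p).const_mul _).const_mul _
          exact lintegral_lintegral_swap this.aemeasurable
      _ ≤ ∫⁻ _ : unitInterval, ‖f‖ₑ ^ 2 * (ENNReal.ofReal (r ^ (2 - p)) * G) := by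
          refine lintegral_mono fun x => ?_
          simp only
          rw [lintegral_const_mul' _ _ (by finiteness), lintegral_const_mul' _ _ (by finiteness)]
          exact mul_le_mul_right (mul_le_mul_right (hG x) _) _
      _ = _ := by simp
  have hswap3 : ∫⁻ ω, (∫⁻ x, ‖(v ω : ℂ) * (f x * truncate r (M ω x))‖ₑ) ^ 2 ∂P ≤ ‖f‖ₑ * G₁ := by
    refine le_trans (lintegral_mono fun ω => ?_) hswap1
    have e1 : ∫⁻ x, ‖(v ω : ℂ) * (f x * truncate r (M ω x))‖ₑ ≤ ENNReal.ofReal (v ω) * L ω := by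
      rw [hL, ← lintegral_const_mul' _ _ ENNReal.ofReal_ne_top]
      refine lintegral_mono fun x => ?_
      simp only
      rw [enorm_mul, ← ofReal_norm (v ω : ℂ), Complex.norm_real, Real.norm_eq_abs,
        abs_of_nonneg (hv0 ω), enorm_mul, enorm_mul]
      gcongr
      rw [← ofReal_norm, ← ofReal_norm]
      exact ENNReal.ofReal_le_ofReal (norm_truncate_le_norm _ _)
    have e2 : ENNReal.ofReal (v ω) ^ 2 * L ω ≤ 1 := by
      rw [← ENNReal.ofReal_toReal (hLtop ω), ← ENNReal.ofReal_pow (hv0 ω),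
        ← ENNReal.ofReal_mul (by positivity)]
      refine ENNReal.ofReal_le_one.2 ?_
      rw [← hvw ω]
      simp only [hw]
      gcongr
      linarith
    calc _ ≤ (ENNReal.ofReal (v ω) * L ω) ^ 2 := by gcongr
      _ = ENNReal.ofReal (v ω) ^ 2 * L ω * L ω := by ring
      _ ≤ 1 * L ω := by gcongr
      _ = L ω := one_mul _
  calc ∫⁻ ω, ‖T ω‖ₑ ∂P ≤ ∫⁻ ω, (ENNReal.ofReal a * (1 + L ω) +
      ENNReal.ofReal a⁻¹ * ‖(v ω : ℂ) * T ω‖ₑ ^ 2) ∂P := lintegral_mono hpoint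
    _ = ENNReal.ofReal a * (1 + ∫⁻ ω, L ω ∂P) +
        ENNReal.ofReal a⁻¹ * ∫⁻ ω, ‖(v ω : ℂ) * T ω‖ₑ ^ 2 ∂P := by
        have hm1 : Measurable fun ω => ENNReal.ofReal a * (1 + L ω) :=
          (measurable_const.add hLm).const_mul _
        rw [lintegral_add_left hm1,
          lintegral_const_mul' _ _ ENNReal.ofReal_ne_top,
          lintegral_const_mul' _ _ ENNReal.ofReal_ne_top, lintegral_add_left measurable_const]
        simp
    _ ≤ _ := by
        gcongr
        refine hTg.trans ?_
        gcongr

end IsStandardIID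

/-! ### Choice of the exponents -/

/-- The bound for the mean of a block increment, once the truncation level, the distance to the
diagonal and the weight are chosen as powers of the first index of the block. -/
lemma block_bound_le_rpow {N F C C' γ p η : ℝ} (hN : 1 ≤ N) (hF : 0 ≤ F) (hC : 0 ≤ C)
    (hC' : 0 ≤ C') (hγ : 0 < γ) (hη : η ≤ 2 * N ^ (-(γ / 2))) :
    N ^ (-(γ / 8)) * (1 + F * (C * N ^ (γ / 16))) + (N ^ (-(γ / 8)))⁻¹ *
      (C' * (N ^ (γ / 2 - 1) * (F ^ 2 * (N ^ (2 - p) * (C * N ^ (p - 1 - γ)))) +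
        η * (F * (C * N ^ (γ / 16))))) +
      F * (N ^ (1 - p) * (C * N ^ (p - 1 - γ))) * C' ≤
    (1 + F * C + C' * F ^ 2 * C + 2 * C' * F * C + F * C * C') * N ^ (-(γ / 16)) := by
  have hN0 : 0 < N := by linarith
  have mono : ∀ e : ℝ, e ≤ -(γ / 16) → N ^ e ≤ N ^ (-(γ / 16)) := fun e he =>
    Real.rpow_le_rpow_of_exponent_le hN he
  have e1 : N ^ (-(γ / 8)) * (1 + F * (C * N ^ (γ / 16))) =
      N ^ (-(γ / 8)) + F * C * N ^ (-(γ / 8) + γ / 16) := by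
    rw [Real.rpow_add hN0]; ring
  have e2 : (N ^ (-(γ / 8)))⁻¹ *
      (C' * (N ^ (γ / 2 - 1) * (F ^ 2 * (N ^ (2 - p) * (C * N ^ (p - 1 - γ)))))) =
      C' * F ^ 2 * C * N ^ (γ / 8 + (γ / 2 - 1) + (2 - p) + (p - 1 - γ)) := by
    rw [Real.rpow_add hN0, Real.rpow_add hN0, Real.rpow_add hN0, ← Real.rpow_neg hN0.le, neg_neg]
    ring
  have e3 : (N ^ (-(γ / 8)))⁻¹ * (C' * ((2 * N ^ (-(γ / 2))) * (F * (C * N ^ (γ / 16))))) =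
      2 * C' * F * C * N ^ (γ / 8 + -(γ / 2) + γ / 16) := by
    rw [Real.rpow_add hN0, Real.rpow_add hN0, ← Real.rpow_neg hN0.le, neg_neg]
    ring
  have e4 : F * (N ^ (1 - p) * (C * N ^ (p - 1 - γ))) * C' =
      F * C * C' * N ^ ((1 - p) + (p - 1 - γ)) := by
    rw [Real.rpow_add hN0]; ring
  have h3 : (N ^ (-(γ / 8)))⁻¹ * (C' * (η * (F * (C * N ^ (γ / 16))))) ≤
      (N ^ (-(γ / 8)))⁻¹ * (C' * ((2 * N ^ (-(γ / 2))) * (F * (C * N ^ (γ / 16))))) := by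
    gcongr
  -- The exponents are `-γ/8` and `-γ/16` for the weight, `-3γ/8` near the diagonal, `-5γ/16` off it
  -- and `-γ` for the excess; the worst is `-γ/16`.
  have m0 := mono (-(γ / 8)) (by linarith)
  have m1 := mul_le_mul_of_nonneg_left (mono (-(γ / 8) + γ / 16) (by linarith))
    (by positivity : 0 ≤ F * C)
  have m2 := mul_le_mul_of_nonneg_left
    (mono (γ / 8 + (γ / 2 - 1) + (2 - p) + (p - 1 - γ)) (by linarith))
    (by positivity : 0 ≤ C' * F ^ 2 * C)
  have m3 := mul_le_mul_of_nonneg_left (mono (γ / 8 + -(γ / 2) + γ / 16) (by linarith))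
    (by positivity : 0 ≤ 2 * C' * F * C)
  have m4 := mul_le_mul_of_nonneg_left (mono ((1 - p) + (p - 1 - γ)) (by linarith))
    (by positivity : 0 ≤ F * C * C')
  rw [e1, mul_add C', mul_add (N ^ (-(γ / 8)))⁻¹, e2, e4]
  rw [e3] at h3
  linarith

/-- The width makes `m δ = m ^ (γ/2)`; `γ ≤ 1` lets the error `m ^ (-1/2)` fit under the same bound.
-/
lemma offDiag_le_rpow {m : ℕ} (hm : 1 ≤ m) {γ : ℝ} (hγ : γ ≤ 1) :
    offDiag m ((m : ℝ) ^ (γ / 2 - 1)) ≤ 2 * (m : ℝ) ^ (-(γ / 2)) := by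
  have hN : (1 : ℝ) ≤ m := by exact_mod_cast hm
  have hN0 : (0 : ℝ) < m := by linarith
  have h1 : 1 / (((m : ℝ) + 1) * (m : ℝ) ^ (γ / 2 - 1)) ≤ (m : ℝ) ^ (-(γ / 2)) := by
    calc _ ≤ 1 / ((m : ℝ) * (m : ℝ) ^ (γ / 2 - 1)) := by
          gcongr; linarith
      _ = (m : ℝ) ^ (-(γ / 2)) := by
          rw [Real.rpow_sub_one hN0.ne', mul_div_cancel₀ _ hN0.ne', Real.rpow_neg hN0.le, one_div]
  have h2 : 1 / √((m : ℝ) + 1) ≤ (m : ℝ) ^ (-(γ / 2)) := by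
    calc _ ≤ 1 / √(m : ℝ) := by gcongr; linarith
      _ = (m : ℝ) ^ (-(1 / 2 : ℝ)) := by
          rw [Real.sqrt_eq_rpow, Real.rpow_neg hN0.le, one_div]
      _ ≤ _ := Real.rpow_le_rpow_of_exponent_le hN (by linarith)
  rw [offDiag]; linarith

namespace IsStandardIID

variable {Ω : Type*} [MeasurableSpace Ω] {P : Measure Ω} {A B : ℕ → Ω → ℝ}
  (h : IsStandardIID P A B)
include h

/-- The truncation level is `m`, the width `m ^ (γ/2 - 1)` and the Young parameter `m ^ (-γ/8)`.
Here `momentExponent 1 β = (Im β)² / 2` measures the growth of `𝔼 |M|` off the real axis, which is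
why it must be small compared with `γ`. -/
lemma exists_lintegral_chaos_sub_le :
    ∃ ε : ℝ, 0 < ε ∧ ∃ C : ℝ, 0 ≤ C ∧ ∃ N₀ : ℕ, 1 ≤ N₀ ∧
      ∀ β : ℂ, |β.re| ≤ 2 → |β.im| ≤ ε → (∀ k x, factor P A β k x ≠ 0) ∧
      (∀ q : ℝ, 1 ≤ q → q ≤ 2 → ∀ n : ℕ, 1 ≤ n → ∀ x : unitInterval,
        ∫⁻ ω, ‖expWeight P A B β 0 n x ω‖ₑ ^ q ∂P ≤
          ENNReal.ofReal (C * (n : ℝ) ^ momentExponent q β)) ∧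
      ∀ p γ : ℝ, 1 ≤ p → p ≤ 2 → 0 < γ → γ ≤ 1 → momentExponent p β ≤ p - 1 - γ →
        momentExponent 1 β ≤ γ / 16 → ∀ f : C(unitInterval, ℂ), ∀ m n : ℕ, N₀ ≤ m → m ≤ n →
          n ≤ 2 * m →
        ∫⁻ ω, ‖chaos P A B f β n ω - chaos P A B f β m ω‖ₑ ∂P ≤
          ENNReal.ofReal ((1 + ‖f‖ * C + C * ‖f‖ ^ 2 * C + 2 * C * ‖f‖ * C + ‖f‖ * C * C) *
            (m : ℝ) ^ (-(γ / 16))) := by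
  obtain ⟨ε, hε, C₁, hC₁, hmom⟩ := h.exists_lintegral_norm_expWeight_rpow_le
  obtain ⟨C₂, hC₂, N₀, hker⟩ := h.exists_lintegral_sq_integral_mul_sub_one_le (2 + ε)
  set C := max C₁ C₂ with hCdef
  have hC : 0 ≤ C := hC₁.trans (le_max_left _ _)
  refine ⟨ε, hε, C, hC, max N₀ 1, le_max_right _ _, fun β h1 h2 => ⟨(hmom β h1 h2).1,
    fun q hq1 hq2 n hn x => ((hmom β h1 h2).2 q hq1 hq2 n hn x).trans ?_,
    fun p γ hp1 hp2 hγ hγ1 hp hone f m n hm hmn hn => ?_⟩⟩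
  · exact ENNReal.ofReal_le_ofReal (by gcongr; exact le_max_left _ _)
  obtain ⟨hne, hm1⟩ := hmom β h1 h2
  have hβ : ‖β‖ ≤ 2 + ε := (Complex.norm_le_abs_re_add_abs_im β).trans (add_le_add h1 h2)
  have hm0 : 1 ≤ m := (le_max_right _ _).trans hm
  have hN : (1 : ℝ) ≤ m := by exact_mod_cast hm0
  have hN0 : (0 : ℝ) < m := by linarith
  obtain ⟨hR, hT⟩ := hker β hβ hne m n ((le_max_left _ _).trans hm) hmn hn
  have hG₁ : ∀ x, ∫⁻ ω, ‖expWeight P A B β 0 m x ω‖ₑ ∂P ≤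
      ENNReal.ofReal (C * (m : ℝ) ^ (γ / 16)) := fun x => by
    have := hm1 1 le_rfl (by norm_num) m hm0 x
    simp only [ENNReal.rpow_one] at this
    refine this.trans (ENNReal.ofReal_le_ofReal ?_)
    exact mul_le_mul (le_max_left _ _) (Real.rpow_le_rpow_of_exponent_le hN hone)
      (by positivity) hC
  have hG : ∀ x, ∫⁻ ω, ‖expWeight P A B β 0 m x ω‖ₑ ^ p ∂P ≤
      ENNReal.ofReal (C * (m : ℝ) ^ (p - 1 - γ)) := fun x => by
    refine (hm1 p hp1 hp2 m hm0 x).trans (ENNReal.ofReal_le_ofReal ?_)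
    exact mul_le_mul (le_max_left _ _) (Real.rpow_le_rpow_of_exponent_le hN hp)
      (by positivity) hC
  have hδ : 0 < (m : ℝ) ^ (γ / 2 - 1) := by positivity
  have hC₂C : ENNReal.ofReal C₂ ≤ ENNReal.ofReal C :=
    ENNReal.ofReal_le_ofReal (le_max_right _ _)
  have t1 := h.lintegral_truncated_le f hne
    (fun g a1 a2 c a3 => (hT _ hδ g a1 a2 c a3).trans (mul_le_mul_left hC₂C _))
    (by linarith : 0 < p) hp2 hG₁ hG hN0.le (by positivity : 0 < (m : ℝ) ^ (-(γ / 8)))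
  have t2 := h.lintegral_tail_le f (fun x => (hR x).trans hC₂C) hp1 hG hN0
  have hη := offDiag_nonneg m hδ
  have hη2 := offDiag_le_rpow hm0 hγ1
  calc ∫⁻ ω, ‖chaos P A B f β n ω - chaos P A B f β m ω‖ₑ ∂P
      ≤ ∫⁻ ω, (‖∫ x : unitInterval, f x * truncate m (expWeight P A B β 0 m x ω) *
        (expWeight P A B β m n x ω - 1)‖ₑ + ‖∫ x : unitInterval, f x *
        (expWeight P A B β 0 m x ω - truncate m (expWeight P A B β 0 m x ω)) *
        (expWeight P A B β m n x ω - 1)‖ₑ) ∂P := by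
        refine lintegral_mono fun ω => ?_
        rw [h.chaos_sub_chaos f hne hmn m ω]
        exact enorm_add_le _ _
    _ = (∫⁻ ω, ‖∫ x : unitInterval, f x * truncate m (expWeight P A B β 0 m x ω) *
        (expWeight P A B β m n x ω - 1)‖ₑ ∂P) + ∫⁻ ω, ‖∫ x : unitInterval, f x *
        (expWeight P A B β 0 m x ω - truncate m (expWeight P A B β 0 m x ω)) *
        (expWeight P A B β m n x ω - 1)‖ₑ ∂P := by
        refine lintegral_add_left (Measurable.enorm ?_) _
        have : Measurable (Function.uncurry fun (ω : Ω) (x : unitInterval) =>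
            f x * truncate m (expWeight P A B β 0 m x ω) * (expWeight P A B β m n x ω - 1)) :=
          ((f.continuous.measurable.comp measurable_snd).mul ((measurable_truncate m).comp
            (h.measurable_expWeight β 0 m))).mul ((h.measurable_expWeight β m n).sub_const 1)
        exact (StronglyMeasurable.integral_prod_right this.stronglyMeasurable).measurable
    _ ≤ _ := add_le_add t1 t2
    _ = ENNReal.ofReal ((m : ℝ) ^ (-(γ / 8)) * (1 + ‖f‖ * (C * (m : ℝ) ^ (γ / 16))) +
        ((m : ℝ) ^ (-(γ / 8)))⁻¹ * (C * ((m : ℝ) ^ (γ / 2 - 1) * (‖f‖ ^ 2 *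
          ((m : ℝ) ^ (2 - p) * (C * (m : ℝ) ^ (p - 1 - γ)))) +
        offDiag m ((m : ℝ) ^ (γ / 2 - 1)) * (‖f‖ * (C * (m : ℝ) ^ (γ / 16))))) +
        ‖f‖ * ((m : ℝ) ^ (1 - p) * (C * (m : ℝ) ^ (p - 1 - γ))) * C) := by
        simp (disch := positivity) only [ENNReal.ofReal_add, ENNReal.ofReal_mul,
          ENNReal.ofReal_pow, ENNReal.ofReal_one, ofReal_norm]
    _ ≤ _ := ENNReal.ofReal_le_ofReal
        (block_bound_le_rpow hN (norm_nonneg _) hC hC hγ hη2)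

end IsStandardIID

/-! ### From dyadic `L¹` decay to a Cauchy sequence in `Lʳ` -/

lemma lintegral_rpow_le_of_isProbabilityMeasure {α : Type*} [MeasurableSpace α] {ν : Measure α}
    [IsProbabilityMeasure ν] {φ : α → ENNReal} (hφ : AEMeasurable φ ν) {p : ℝ} (hp : 1 ≤ p) :
    (∫⁻ x, φ x ∂ν) ^ p ≤ ∫⁻ x, φ x ^ p ∂ν := by
  have hp0 : 0 < p := by linarith
  have h1 := ENNReal.lintegral_mul_norm_pow_le (μ := ν) (f := fun x => φ x ^ p) (g := fun _ => 1)
    (hφ.pow_const p) aemeasurable_const (p := p⁻¹) (q := 1 - p⁻¹) (by positivity)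
    (sub_nonneg.2 (inv_le_one_of_one_le₀ hp)) (by ring)
  simp only [ENNReal.rpow_rpow_inv hp0.ne', ENNReal.one_rpow, mul_one, lintegral_one,
    measure_univ] at h1
  calc _ ≤ ((∫⁻ x, φ x ^ p ∂ν) ^ p⁻¹) ^ p := by gcongr
    _ = _ := ENNReal.rpow_inv_rpow hp0.ne' _

/-- A family of distances which decays along dyadic blocks decays. -/
lemma le_of_dyadic_le {d : ℕ → ℕ → ENNReal} (htri : ∀ l m n, d l n ≤ d l m + d m n)
    {K c : ℝ} (hK : 0 ≤ K) (hc : 0 < c) {N₀ : ℕ} (hN₀ : 1 ≤ N₀)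
    (hd : ∀ m n, N₀ ≤ m → m ≤ n → n ≤ 2 * m → d m n ≤ ENNReal.ofReal (K * (m : ℝ) ^ (-c)))
    {m n : ℕ} (hm : N₀ ≤ m) (hmn : m ≤ n) :
    d m n ≤ ENNReal.ofReal (K / (1 - 2 ^ (-c)) * (m : ℝ) ^ (-c)) := by
  have hθ : (2 : ℝ) ^ (-c) < 1 := Real.rpow_lt_one_of_one_lt_of_neg one_lt_two (by linarith)
  have hθ0 : (0 : ℝ) < 2 ^ (-c) := by positivity
  have h1 : 0 < 1 - (2 : ℝ) ^ (-c) := by linarith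
  have hKK : K ≤ K / (1 - 2 ^ (-c)) := by
    rw [le_div_iff₀ h1]; nlinarith
  -- Induction on a bound for `n - m`: the block from `m` to `2m` is split off, and `m ≥ 1` makes
  -- the rest shorter. The constant `K / (1 - 2 ^ (-c))` is the sum of the geometric series.
  obtain ⟨j, hj⟩ : ∃ j, n - m ≤ j := ⟨_, le_rfl⟩
  induction j generalizing m with
  | zero =>
    refine (hd m n hm hmn (by omega)).trans (ENNReal.ofReal_le_ofReal ?_)
    gcongr
  | succ j ih =>
    rcases le_total n (2 * m) with h2 | h2
    · refine (hd m n hm hmn h2).trans (ENNReal.ofReal_le_ofReal ?_)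
      gcongr
    · refine (htri m (2 * m) n).trans ((add_le_add (hd m (2 * m) hm (by omega) le_rfl)
        (ih (by omega) h2 (by omega))).trans ?_)
      rw [← ENNReal.ofReal_add (by positivity) (by positivity)]
      refine ENNReal.ofReal_le_ofReal (le_of_eq ?_)
      push_cast
      rw [Real.mul_rpow (by norm_num) (by positivity)]
      field_simp
      ring

namespace IsStandardIID

variable {Ω : Type*} [MeasurableSpace Ω] {P : Measure Ω} {A B : ℕ → Ω → ℝ}
  (h : IsStandardIID P A B)
include h

lemma lintegral_enorm_chaos_rpow_le (f : C(unitInterval, ℂ)) (β : ℂ) {n : ℕ} {p : ℝ} (hp : 1 ≤ p)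
    {G : ENNReal} (hG : ∀ x, ∫⁻ ω, ‖expWeight P A B β 0 n x ω‖ₑ ^ p ∂P ≤ G) :
    ∫⁻ ω, ‖chaos P A B f β n ω‖ₑ ^ p ∂P ≤ ‖f‖ₑ ^ p * G := by
  have := h.prob
  have hp0 : 0 ≤ p := by linarith
  have hM := h.measurable_expWeight β 0 n
  have hm : Measurable fun q : Ω × unitInterval =>
      ‖f‖ₑ ^ p * ‖expWeight P A B β 0 n q.2 q.1‖ₑ ^ p := (hM.enorm.pow_const p).const_mul _
  calc _ ≤ ∫⁻ ω, (∫⁻ x, ‖f‖ₑ ^ p * ‖expWeight P A B β 0 n x ω‖ₑ ^ p) ∂P := by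
        refine lintegral_mono fun ω => ?_
        have hx : Measurable fun x : unitInterval => ‖f x * expWeight P A B β 0 n x ω‖ₑ :=
          (f.continuous.measurable.mul (h.measurable_expWeight_right β 0 n ω)).enorm
        simp only
        rw [h.chaos_eq]
        calc _ ≤ (∫⁻ x, ‖f x * expWeight P A B β 0 n x ω‖ₑ) ^ p := by
              gcongr; exact enorm_integral_le_lintegral_enorm _
          _ ≤ _ := (lintegral_rpow_le_of_isProbabilityMeasure hx.aemeasurable hp).trans
              (lintegral_mono fun x => ?_)
        simp only
        rw [enorm_mul, ENNReal.mul_rpow_of_nonneg _ _ hp0]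
        gcongr
        rw [← ofReal_norm, ← ofReal_norm]
        exact ENNReal.ofReal_le_ofReal (f.norm_coe_le_norm x)
    _ = ∫⁻ x, ∫⁻ ω, ‖f‖ₑ ^ p * ‖expWeight P A B β 0 n x ω‖ₑ ^ p ∂P :=
        lintegral_lintegral_swap hm.aemeasurable
    _ ≤ ∫⁻ _ : unitInterval, ‖f‖ₑ ^ p * G := by
        refine lintegral_mono fun x => ?_
        simp only
        rw [lintegral_const_mul' _ _ (ENNReal.rpow_ne_top_of_nonneg hp0 enorm_ne_top)]
        exact mul_le_mul_right (hG x) _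
    _ = _ := by simp

lemma lintegral_enorm_chaos_sub_rpow_le (f : C(unitInterval, ℂ)) (β : ℂ) {m n : ℕ} {p : ℝ}
    (hp : 1 ≤ p) (hp2 : p ≤ 2) {G : ENNReal}
    (hGm : ∀ x, ∫⁻ ω, ‖expWeight P A B β 0 m x ω‖ₑ ^ p ∂P ≤ G)
    (hGn : ∀ x, ∫⁻ ω, ‖expWeight P A B β 0 n x ω‖ₑ ^ p ∂P ≤ G) :
    ∫⁻ ω, ‖chaos P A B f β n ω - chaos P A B f β m ω‖ₑ ^ p ∂P ≤ 4 * (‖f‖ₑ ^ p * G) := by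
  have hp0 : 0 ≤ p := by linarith
  have h2 : (2 : ENNReal) ^ (p - 1) ≤ 2 := by
    calc (2 : ENNReal) ^ (p - 1) ≤ 2 ^ (1 : ℝ) :=
          ENNReal.rpow_le_rpow_of_exponent_le (by norm_num) (by linarith)
      _ = 2 := ENNReal.rpow_one 2
  calc _ ≤ ∫⁻ ω, 2 * (‖chaos P A B f β n ω‖ₑ ^ p + ‖chaos P A B f β m ω‖ₑ ^ p) ∂P := by
        refine lintegral_mono fun ω => ?_
        calc _ ≤ (‖chaos P A B f β n ω‖ₑ + ‖chaos P A B f β m ω‖ₑ) ^ p := by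
              gcongr; exact enorm_sub_le
          _ ≤ 2 ^ (p - 1) * (‖chaos P A B f β n ω‖ₑ ^ p + ‖chaos P A B f β m ω‖ₑ ^ p) :=
              ENNReal.rpow_add_le_mul_rpow_add_rpow _ _ hp
          _ ≤ _ := by gcongr
    _ = 2 * ((∫⁻ ω, ‖chaos P A B f β n ω‖ₑ ^ p ∂P) + ∫⁻ ω, ‖chaos P A B f β m ω‖ₑ ^ p ∂P) := by
        rw [lintegral_const_mul' _ _ (by norm_num),
          lintegral_add_left ((h.measurable_chaos f β n).enorm.pow_const p)]
    _ ≤ 2 * (‖f‖ₑ ^ p * G + ‖f‖ₑ ^ p * G) := by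
        gcongr
        · exact h.lintegral_enorm_chaos_rpow_le f β hp hGn
        · exact h.lintegral_enorm_chaos_rpow_le f β hp hGm
    _ = _ := by ring

end IsStandardIID

/-- Interpolation between a decaying `L¹` bound and a growing `Lᵖ` bound. -/
lemma eLpNorm_le_of_lintegral_le {Ω : Type*} [MeasurableSpace Ω] {P : Measure Ω} {D : Ω → ℂ}
    (hD : Measurable D) {p s N K₁ K₂ c : ℝ} (hp : 1 ≤ p) (hs0 : 0 < s) (hs1 : s < 1)
    (hN : 1 ≤ N) (hK₁ : 0 ≤ K₁) (hK₂ : 0 ≤ K₂)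
    (h1 : ∫⁻ ω, ‖D ω‖ₑ ∂P ≤ ENNReal.ofReal (K₁ * N ^ (-c)))
    (h2 : ∫⁻ ω, ‖D ω‖ₑ ^ p ∂P ≤ ENNReal.ofReal (K₂ * N)) (hcs : s - c * (1 - s) ≤ - (c / 4)) :
    eLpNorm D (ENNReal.ofReal (1 - s + p * s)) P ≤
      ENNReal.ofReal ((K₁ ^ (1 - s) * K₂ ^ s) ^ (1 - s + p * s)⁻¹ *
        N ^ (-(c / 4 * (1 - s + p * s)⁻¹))) := by
  have hN0 : 0 < N := by linarith
  set r := 1 - s + p * s with hr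
  have hr0 : 0 < r := by
    have : 0 < p * s := by positivity
    linarith
  rw [eLpNorm_eq_lintegral_rpow_enorm_toReal (by simpa using hr0) ENNReal.ofReal_ne_top,
    ENNReal.toReal_ofReal hr0.le]
  -- Hölder with exponents `1 - s` and `s` applied to `|D|` and `|D|^p`.
  have hint := ENNReal.lintegral_mul_norm_pow_le (μ := P) (f := fun ω => ‖D ω‖ₑ)
    (g := fun ω => ‖D ω‖ₑ ^ p) hD.enorm.aemeasurable (hD.enorm.pow_const p).aemeasurable
    (p := 1 - s) (q := s) (by linarith) hs0.le (by ring)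
  have e : ∀ ω, ‖D ω‖ₑ ^ (1 - s) * (‖D ω‖ₑ ^ p) ^ s = ‖D ω‖ₑ ^ r := fun ω => by
    rw [← ENNReal.rpow_mul, ← ENNReal.rpow_add_of_nonneg _ _ (by linarith) (by positivity)]
  simp_rw [e] at hint
  have hb : ∫⁻ ω, ‖D ω‖ₑ ^ r ∂P ≤ ENNReal.ofReal ((K₁ ^ (1 - s) * K₂ ^ s) * N ^ (-(c / 4))) := by
    calc _ ≤ ENNReal.ofReal (K₁ * N ^ (-c)) ^ (1 - s) * ENNReal.ofReal (K₂ * N) ^ s := by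
          refine hint.trans (mul_le_mul' ?_ ?_)
          · exact ENNReal.rpow_le_rpow h1 (by linarith)
          · exact ENNReal.rpow_le_rpow h2 hs0.le
      _ = ENNReal.ofReal ((K₁ * N ^ (-c)) ^ (1 - s) * (K₂ * N) ^ s) := by
          rw [ENNReal.ofReal_rpow_of_nonneg (by positivity) (by linarith),
            ENNReal.ofReal_rpow_of_nonneg (by positivity) hs0.le,
            ← ENNReal.ofReal_mul (by positivity)]
      _ ≤ _ := by
          refine ENNReal.ofReal_le_ofReal ?_
          rw [Real.mul_rpow hK₁ (by positivity), Real.mul_rpow hK₂ hN0.le, ← Real.rpow_mul hN0.le]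
          have : N ^ (-c * (1 - s)) * N ^ s ≤ N ^ (-(c / 4)) := by
            rw [← Real.rpow_add hN0]
            exact Real.rpow_le_rpow_of_exponent_le hN (by linarith)
          calc _ = K₁ ^ (1 - s) * K₂ ^ s * (N ^ (-c * (1 - s)) * N ^ s) := by ring
            _ ≤ _ := by gcongr
  calc _ ≤ ENNReal.ofReal ((K₁ ^ (1 - s) * K₂ ^ s) * N ^ (-(c / 4))) ^ (1 / r) :=
        ENNReal.rpow_le_rpow hb (by positivity)
    _ = _ := by
        rw [ENNReal.ofReal_rpow_of_nonneg (by positivity) (by positivity),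
          Real.mul_rpow (by positivity) (by positivity), ← Real.rpow_mul hN0.le, one_div,
          neg_mul]

namespace IsStandardIID

variable {Ω : Type*} [MeasurableSpace Ω] {P : Measure Ω} {A B : ℕ → Ω → ℝ}
  (h : IsStandardIID P A B)
include h

/-- Near each subcritical parameter, the chaos is uniformly Cauchy in some `Lʳ` with `r > 1`. -/
lemma exists_uniform_cauchy {b : ℝ} (hb0 : 0 < b) (hb : b < √2) :
    ∃ τ : ℝ, 0 < τ ∧ ∃ r : ℝ, 1 < r ∧
      (∀ β ∈ Metric.closedBall (b : ℂ) τ, ∀ k x, factor P A β k x ≠ 0) ∧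
      ∀ f : C(unitInterval, ℂ), ∃ u : ℕ → ENNReal, Tendsto u atTop (𝓝 0) ∧
        ∀ β ∈ Metric.closedBall (b : ℂ) τ, ∀ m n : ℕ, m ≤ n →
          eLpNorm (chaos P A B f β n - chaos P A B f β m) (ENNReal.ofReal r) P ≤ u m := by
  obtain ⟨ε, hε, C, hC, N₀, hN₀, hest⟩ := h.exists_lintegral_chaos_sub_le
  have hb2 : b ^ 2 < 2 := by
    have := Real.sq_sqrt (show (0 : ℝ) ≤ 2 by norm_num)
    nlinarith [Real.sqrt_nonneg 2]
  -- the integrability exponent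
  set σ : ℝ := min 1 ((2 - b ^ 2) / (2 * b ^ 2)) with hσ
  have hσ0 : 0 < σ := lt_min one_pos (div_pos (by linarith) (by positivity))
  have hσ1 : σ ≤ 1 := min_le_left _ _
  have hσb : σ * b ^ 2 ≤ (2 - b ^ 2) / 2 := by
    have : σ ≤ (2 - b ^ 2) / (2 * b ^ 2) := min_le_right _ _
    calc σ * b ^ 2 ≤ (2 - b ^ 2) / (2 * b ^ 2) * b ^ 2 := by gcongr
      _ = (2 - b ^ 2) / 2 := by field_simp
  set p : ℝ := 1 + σ with hp
  have hpb : p * b ^ 2 < 2 := by rw [hp]; linarith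
  -- At the real point `momentExponent p b = σ p b² / 2 = (p - 1) - 2γ`. Half of the gap is kept as
  -- decay, the other half leaves room to move `β` off the real axis.
  set γ : ℝ := σ * (1 - p * b ^ 2 / 2) / 2 with hγ
  have hγ0 : 0 < γ := by
    rw [hγ]; exact div_pos (mul_pos hσ0 (by linarith)) two_pos
  have hγ1 : γ ≤ 1 / 2 := by
    have hpb0 : 0 ≤ p * b ^ 2 := by rw [hp]; positivity
    rw [hγ]; nlinarith
  have hc1 : Continuous fun β : ℂ => momentExponent p β := by unfold momentExponent; fun_prop
  have hc2 : Continuous fun β : ℂ => momentExponent 1 β := by unfold momentExponent; fun_prop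
  have hnear : ∀ᶠ β : ℂ in 𝓝 (b : ℂ), |β.re| < 2 ∧ |β.im| < ε ∧
      momentExponent p β < p - 1 - γ ∧ momentExponent 1 β < γ / 16 := by
    have hsq2 : √2 < 2 := by
      rw [Real.sqrt_lt' two_pos]; norm_num
    refine Filter.Eventually.and ?_ (Filter.Eventually.and ?_ (Filter.Eventually.and ?_ ?_))
    · refine (Complex.continuous_re.abs.tendsto (b : ℂ)).eventually_lt_const ?_
      rw [Complex.ofReal_re, abs_of_pos hb0]
      linarith
    · refine (Complex.continuous_im.abs.tendsto (b : ℂ)).eventually_lt_const ?_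
      simpa using hε
    · refine (hc1.tendsto (b : ℂ)).eventually_lt_const ?_
      simp only [momentExponent, Complex.ofReal_re, Complex.ofReal_im]
      have : γ * 2 = σ * (1 - p * b ^ 2 / 2) := by rw [hγ]; ring
      have e : (p ^ 2 * b ^ 2 - p * (b ^ 2 - 0 ^ 2)) / 2 = σ - γ * 2 := by
        rw [this, hp]; ring
      rw [e, hp]
      linarith
    · refine (hc2.tendsto (b : ℂ)).eventually_lt_const ?_
      simp only [momentExponent, Complex.ofReal_re, Complex.ofReal_im]
      have : (1 ^ 2 * b ^ 2 - 1 * (b ^ 2 - 0 ^ 2)) / 2 = 0 := by ring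
      rw [this]
      positivity
  obtain ⟨τ, hτ, hball⟩ := Metric.nhds_basis_closedBall.eventually_iff.1 hnear
  set c : ℝ := γ / 16 with hcdef
  have hc0 : 0 < c := by positivity
  -- Then `s - c (1 - s) = -3c/4 + c²/4 ≤ -c/4` because `c ≤ 1`: the decay beats the linear growth
  -- of the `p`-th moment.
  set s : ℝ := c / 4 with hs
  have hs0 : 0 < s := by positivity
  have hs1 : s < 1 := by rw [hs, hcdef]; linarith
  set r : ℝ := 1 - s + p * s with hr
  have hr1 : 1 < r := by
    have : r = 1 + σ * s := by rw [hr, hp]; ring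
    rw [this]
    have := mul_pos hσ0 hs0
    linarith
  refine ⟨τ, hτ, r, hr1, fun β hβ => ?_, fun f => ?_⟩
  · obtain ⟨h1, h2, -, -⟩ := hball hβ
    exact (hest β h1.le h2.le).1
  set K₁ : ℝ := 1 + ‖f‖ * C + C * ‖f‖ ^ 2 * C + 2 * C * ‖f‖ * C + ‖f‖ * C * C with hK₁
  -- `8 = 4 * 2`: the `4` from the `p`-th moment of a difference, the `2` from indices up to `2m`.
  set K₂ : ℝ := 8 * (‖f‖ ^ p * C) with hK₂
  have hK₁0 : 0 ≤ K₁ := by positivity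
  have hK₂0 : 0 ≤ K₂ := by positivity
  set K : ℝ := (K₁ ^ (1 - s) * K₂ ^ s) ^ r⁻¹ with hK
  have hK0 : 0 ≤ K := by positivity
  set c' : ℝ := c / 4 * r⁻¹ with hc'
  have hc'0 : 0 < c' := by
    have : 0 < r := by linarith
    positivity
  refine ⟨fun m => if N₀ ≤ m then ENNReal.ofReal (K / (1 - 2 ^ (-c')) * (m : ℝ) ^ (-c')) else ⊤,
    ?_, fun β hβ m n hmn => ?_⟩
  · have h0 : Tendsto (fun m : ℕ => ENNReal.ofReal (K / (1 - 2 ^ (-c')) * (m : ℝ) ^ (-c')))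
        atTop (𝓝 0) := by
      have := ((tendsto_rpow_neg_atTop hc'0).comp tendsto_natCast_atTop_atTop).const_mul
        (K / (1 - 2 ^ (-c')))
      rw [mul_zero] at this
      have h3 := ENNReal.tendsto_ofReal this
      rwa [ENNReal.ofReal_zero] at h3
    refine h0.congr' ?_
    filter_upwards [eventually_ge_atTop N₀] with m hm
    rw [if_pos hm]
  · simp only
    split_ifs with hm
    swap
    · exact le_top
    obtain ⟨h1, h2, h3, h4⟩ := hball hβ
    obtain ⟨hne, hmom, hL1⟩ := hest β h1.le h2.le
    refine le_of_dyadic_le (d := fun m n =>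
      eLpNorm (chaos P A B f β n - chaos P A B f β m) (ENNReal.ofReal r) P) ?_ hK0 hc'0 hN₀ ?_ hm
          hmn
    · intro l m n
      have hmeas := fun j => (h.measurable_chaos f β j).aestronglyMeasurable (μ := P)
      have e : chaos P A B f β n - chaos P A B f β l =
          (chaos P A B f β m - chaos P A B f β l) + (chaos P A B f β n - chaos P A B f β m) := by
        abel
      rw [e]
      exact eLpNorm_add_le ((hmeas m).sub (hmeas l)) ((hmeas n).sub (hmeas m))
        (by rw [← ENNReal.ofReal_one]; exact ENNReal.ofReal_le_ofReal hr1.le)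
    · intro m n hm hmn hn
      have hm1 : 1 ≤ m := hN₀.trans hm
      have hN : (1 : ℝ) ≤ m := by exact_mod_cast hm1
      have hκ1 : momentExponent p β ≤ 1 := by linarith
      have hmomle : ∀ j : ℕ, 1 ≤ j → j ≤ 2 * m → ∀ x,
          ∫⁻ ω, ‖expWeight P A B β 0 j x ω‖ₑ ^ p ∂P ≤ ENNReal.ofReal (C * (2 * m)) := by
        intro j hj1 hj2 x
        refine (hmom p (by linarith) (by linarith) j hj1 x).trans (ENNReal.ofReal_le_ofReal ?_)
        have hj : (1 : ℝ) ≤ j := by exact_mod_cast hj1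
        have hj' : (j : ℝ) ≤ 2 * m := by exact_mod_cast hj2
        gcongr
        calc (j : ℝ) ^ momentExponent p β ≤ (j : ℝ) ^ (1 : ℝ) :=
              Real.rpow_le_rpow_of_exponent_le hj hκ1
          _ = j := Real.rpow_one _
          _ ≤ _ := hj'
      have hLp := h.lintegral_enorm_chaos_sub_rpow_le f β (p := p) (by linarith) (by linarith)
        (hmomle m hm1 (by omega)) (hmomle n (by omega) hn)
      refine eLpNorm_le_of_lintegral_le ((h.measurable_chaos f β n).sub (h.measurable_chaos f β m))
        (by linarith) hs0 hs1 hN hK₁0 hK₂0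
        (hL1 p γ (by linarith) (by linarith) hγ0 (by linarith) h3.le h4.le f m n hm hmn hn)
        (hLp.trans (le_of_eq ?_)) ?_
      · have h4 : (4 : ENNReal) = ENNReal.ofReal 4 := by norm_num
        rw [← ofReal_norm, ENNReal.ofReal_rpow_of_nonneg (norm_nonneg _) (by linarith), h4,
          ← ENNReal.ofReal_mul (by positivity), ← ENNReal.ofReal_mul (by norm_num), hK₂]
        congr 1; ring
      · rw [hs]
        have : c ≤ 1 := by rw [hcdef]; linarith
        nlinarith

end IsStandardIID

/-! ### Holomorphy in the parameter -/

/-- A parametric integral over a compact space of a jointly continuous function which is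
holomorphic in the parameter is holomorphic. -/
lemma differentiableOn_integral_of_continuousOn {X : Type*} [TopologicalSpace X] [CompactSpace X]
    [MeasurableSpace X] [OpensMeasurableSpace X] {ν : Measure X} [IsFiniteMeasure ν] {V : Set ℂ}
    (hV : IsOpen V) {F : ℂ → X → ℂ} (hF : ContinuousOn (Function.uncurry F) (V ×ˢ Set.univ))
    (hd : ∀ x, DifferentiableOn ℂ (fun z => F z x) V) :
    DifferentiableOn ℂ (fun z => ∫ x, F z x ∂ν) V := by
  intro z₀ hz₀
  obtain ⟨δ, hδ, hsub⟩ := Metric.isOpen_iff.1 hV z₀ hz₀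
  have hK : IsCompact (Metric.closedBall z₀ (δ / 2) ×ˢ (Set.univ : Set X)) :=
    (isCompact_closedBall _ _).prod isCompact_univ
  have hcb : Metric.closedBall z₀ (δ / 2) ⊆ V :=
    (Metric.closedBall_subset_ball (by linarith)).trans hsub
  obtain ⟨C, hC⟩ := hK.exists_bound_of_continuousOn (hF.mono (Set.prod_mono hcb le_rfl))
  have hCF : ∀ z ∈ Metric.closedBall z₀ (δ / 2), ∀ x, ‖F z x‖ ≤ C := fun z hz x =>
    hC (z, x) ⟨hz, trivial⟩
  have hcont : ∀ z ∈ V, Continuous (F z) := fun z hz => by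
    have := hF.comp_continuous (f := fun x : X => (z, x)) (by fun_prop) fun x => ⟨hz, trivial⟩
    simpa [Function.comp_def] using this
  have hmeas : ∀ z ∈ V, AEStronglyMeasurable (F z) ν := fun z hz =>
    (hcont z hz).measurable.aestronglyMeasurable
  have hderiv : ∀ z ∈ V, ∀ x, HasDerivAt (fun z => F z x) (deriv (fun z => F z x) z) z :=
    fun z hz x => ((hd x).differentiableAt (hV.mem_nhds hz)).hasDerivAt
  have hs : Metric.ball z₀ (δ / 4) ∈ 𝓝 z₀ := Metric.ball_mem_nhds _ (by positivity)
  -- Difference quotients along this sequence give the measurability in `x` of the derivative.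
  have hseq : Tendsto (fun n : ℕ => z₀ + ((1 / ((n : ℝ) + 1) : ℝ) : ℂ)) atTop (𝓝 z₀) := by
    have h0 : Tendsto (fun n : ℕ => z₀ + ((1 / ((n : ℝ) + 1) : ℝ) : ℂ)) atTop
        (𝓝 (z₀ + ((0 : ℝ) : ℂ))) :=
      tendsto_const_nhds.add ((Complex.continuous_ofReal.tendsto 0).comp
        tendsto_one_div_add_atTop_nhds_zero_nat)
    simpa using h0
  have hlim : ∀ᵐ x ∂ν, Tendsto (fun n : ℕ => slope (fun z => F z x) z₀
      (z₀ + ((1 / ((n : ℝ) + 1) : ℝ) : ℂ))) atTop (𝓝 (deriv (fun z => F z x) z₀)) := by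
    refine ae_of_all _ fun x => (hderiv z₀ hz₀ x).tendsto_slope.comp ?_
    refine tendsto_nhdsWithin_iff.2 ⟨?_, Eventually.of_forall fun n => ?_⟩
    · exact hseq
    · have : (n : ℂ) + 1 ≠ 0 := by exact_mod_cast n.succ_ne_zero
      simpa using this
  obtain ⟨N, hN⟩ := eventually_atTop.1 (hseq.eventually (hV.mem_nhds hz₀))
  have hF' : AEStronglyMeasurable (fun x => deriv (fun z => F z x) z₀) ν := by
    refine aestronglyMeasurable_of_tendsto_ae atTop (f := fun (n : ℕ) x => slope (fun z => F z x) z₀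
      (z₀ + ((1 / (((n + N : ℕ) : ℝ) + 1) : ℝ) : ℂ))) (fun n => ?_) ?_
    · simp only [slope, vsub_eq_sub, smul_eq_mul]
      exact ((hmeas _ (hN (n + N) (Nat.le_add_left _ _))).sub (hmeas _ hz₀)).const_mul _
    · filter_upwards [hlim] with x hx
      exact hx.comp (tendsto_add_atTop_nat N)
  refine (hasDerivAt_integral_of_dominated_loc_of_deriv_le
    (F' := fun z x => deriv (fun z => F z x) z) (bound := fun _ => C / (δ / 4)) hs ?_ ?_ hF' ?_
    (integrable_const _) ?_).2.differentiableAt.differentiableWithinAt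
  · filter_upwards [hV.mem_nhds hz₀] with z hz using hmeas z hz
  · exact Integrable.of_bound (hmeas z₀ hz₀) C
      (ae_of_all _ (hCF z₀ (Metric.mem_closedBall_self (by positivity))))
  · refine ae_of_all _ fun x z hz => ?_
    -- Discs of radius `δ / 4` around such `z` stay where `‖F‖ ≤ C`, so Cauchy's estimate dominates
    -- the derivative by a constant.
    have hz' : Metric.closedBall z (δ / 4) ⊆ Metric.closedBall z₀ (δ / 2) := by
      refine Metric.closedBall_subset_closedBall' ?_
      have := Metric.mem_ball.1 hz
      linarith
    refine Complex.norm_deriv_le_of_forall_mem_sphere_norm_le (by positivity) ?_ fun w hw =>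
      hCF w (hz' (Metric.sphere_subset_closedBall hw)) x
    exact ((hd x).mono (hz'.trans hcb)).diffContOnCl_ball le_rfl
  · exact ae_of_all _ fun x z hz => hderiv z
      (hcb (Metric.ball_subset_closedBall (Metric.ball_subset_ball (by linarith) hz))) x

namespace IsStandardIID

variable {Ω : Type*} [MeasurableSpace Ω] {P : Measure Ω} {A B : ℕ → Ω → ℝ}
  (h : IsStandardIID P A B)
include h

lemma differentiable_factor (k : ℕ) (x : unitInterval) :
    Differentiable ℂ fun β => factor P A β k x := by
  have := differentiable_complexMGF h.exp_moment
  unfold factor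
  fun_prop

/-- The chaos is holomorphic in the parameter as long as the normalization does not vanish. -/
lemma differentiableOn_chaos (f : C(unitInterval, ℂ)) {V : Set ℂ} (hV : IsOpen V)
    (hne : ∀ β ∈ V, ∀ k x, factor P A β k x ≠ 0) (n : ℕ) (ω : Ω) :
    DifferentiableOn ℂ (fun β => chaos P A B f β n ω) V := by
  have hne' : ∀ β ∈ V, ∀ x, ∏ k ∈ Finset.Ico 0 n, factor P A β k x ≠ 0 := fun β hβ x =>
    Finset.prod_ne_zero_iff.2 fun k _ => hne β hβ k x
  simp_rw [h.chaos_eq, expWeight]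
  refine differentiableOn_integral_of_continuousOn hV ?_ fun x => ?_
  · have hb : Continuous fun x : unitInterval => blockField A B 0 n x ω := by
      simp only [blockField, field_eq]
      fun_prop
    refine ContinuousOn.mul (by fun_prop) (ContinuousOn.div (by fun_prop)
      (h.continuous_prod_factor 0 n).continuousOn fun p hp => hne' p.1 hp.1 p.2)
  · refine DifferentiableOn.const_mul (DifferentiableOn.div (by fun_prop) ?_
      fun β hβ => hne' β hβ x) _
    exact DifferentiableOn.fun_finsetProd fun k _ => (h.differentiable_factor k x).differentiableOn

/-- A bound for the normalized exponential, locally uniform in the parameter. -/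
lemma exists_norm_chaos_le_of_isCompact (f : C(unitInterval, ℂ)) {K : Set ℂ} (hK : IsCompact K)
    (hne : ∀ β ∈ K, ∀ k x, factor P A β k x ≠ 0) (n : ℕ) :
    ∃ C t : ℝ, ∀ β ∈ K, ∀ ω, ‖chaos P A B f β n ω‖ ≤ C * Real.exp (t * majorant A B n ω) := by
  have hc : ContinuousOn (fun p : ℂ × unitInterval =>
      (∏ k ∈ Finset.Ico 0 n, factor P A p.1 k p.2)⁻¹) (K ×ˢ Set.univ) :=
    (h.continuous_prod_factor 0 n).continuousOn.inv₀
      fun p hp => Finset.prod_ne_zero_iff.2 fun k _ => hne p.1 hp.1 k p.2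
  obtain ⟨C, hC⟩ := (hK.prod isCompact_univ).exists_bound_of_continuousOn hc
  obtain ⟨t, ht⟩ := hK.exists_bound_of_continuousOn continuousOn_id
  refine ⟨‖f‖ * C, t, fun β hβ ω => ?_⟩
  rw [h.chaos_eq]
  have hle : ∀ x, ‖f x * expWeight P A B β 0 n x ω‖ ≤
      ‖f‖ * C * Real.exp (t * majorant A B n ω) := by
    intro x
    have hCx := hC (β, x) ⟨hβ, trivial⟩
    rw [norm_mul, mul_assoc]
    refine mul_le_mul (f.norm_coe_le_norm x) ?_ (norm_nonneg _) (norm_nonneg _)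
    rw [expWeight, div_eq_mul_inv, norm_mul, mul_comm]
    refine mul_le_mul hCx ?_ (norm_nonneg _) ((norm_nonneg _).trans hCx)
    rw [Complex.norm_exp]
    refine Real.exp_le_exp.2 ((Complex.re_le_norm _).trans ?_)
    rw [norm_mul]
    refine mul_le_mul (ht β hβ) ?_ (norm_nonneg _) ((norm_nonneg _).trans (ht β hβ))
    simpa using abs_blockField_le A B 0 n x ω
  simpa using norm_integral_le_of_norm_le_const (μ := (volume : Measure unitInterval))
    (ae_of_all _ hle)

end IsStandardIID

/-! ### Maximal inequality over a disc of parameters -/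

section Maximal

variable {Ω Θ : Type*} {m0 : MeasurableSpace Ω} {P : Measure Ω} [MeasurableSpace Θ]
  {𝓖 : Filtration ℕ m0}

/-- The integral of the norms of a family of martingales is a submartingale. -/
lemma submartingale_integral_norm [IsFiniteMeasure P] {ν : Measure Θ} [IsFiniteMeasure ν]
    {D : Θ → ℕ → Ω → ℂ} (hD : ∀ θ, Martingale (D θ) 𝓖 P)
    (hm : ∀ n, StronglyMeasurable[(inferInstance : MeasurableSpace Θ).prod (𝓖 n)]
      (Function.uncurry fun θ ω => D θ n ω))
    (hint : ∀ n, Integrable (Function.uncurry fun θ ω => D θ n ω) (ν.prod P)) :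
    Submartingale (fun n ω => ∫ θ, ‖D θ n ω‖ ∂ν) 𝓖 P := by
  have hint' : ∀ n, Integrable (Function.uncurry fun θ ω => ‖D θ n ω‖) (ν.prod P) :=
    fun n => (hint n).norm
  refine submartingale_of_setIntegral_le_succ (fun n => ?_)
    (fun n => (hint' n).integral_prod_right) fun n s hs => ?_
  · exact @StronglyMeasurable.integral_prod_left Θ Ω ℝ _ (𝓖 n) ν _ _ _ _ (hm n).norm
  · have hs' : MeasurableSet s := 𝓖.le n s hs
    have hr : ∀ n, Integrable (Function.uncurry fun θ ω => ‖D θ n ω‖) (ν.prod (P.restrict s)) :=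
      fun n => (hint' n).mono_measure (Measure.prod_mono le_rfl Measure.restrict_le_self)
    rw [← integral_integral_swap (hr n), ← integral_integral_swap (hr (n + 1))]
    refine integral_mono (hr n).integral_prod_left (hr (n + 1)).integral_prod_left fun θ => ?_
    calc ∫ ω in s, ‖D θ n ω‖ ∂P = ∫ ω in s, ‖(P[D θ (n + 1) | 𝓖 n]) ω‖ ∂P :=
          integral_congr_ae (ae_restrict_of_ae (((hD θ).condExp_ae_eq n.le_succ).mono
            fun ω hω => by simp only [hω]))
      _ ≤ _ := setIntegral_norm_condExp_le hs _

/-- Doob's maximal inequality on an infinite time interval. -/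
lemma measure_exists_le_mul_le [IsFiniteMeasure P] {Z : ℕ → Ω → ℝ} (hZ : Submartingale Z 𝓖 P)
    (h0 : 0 ≤ Z) {K : ℝ} (hK : ∀ n, ∫ ω, Z n ω ∂P ≤ K) (ε : NNReal) :
    ε * P {ω | ∃ n, (ε : ℝ) ≤ Z n ω} ≤ ENNReal.ofReal K := by
  let S : ℕ → Set Ω := fun n => {ω | (ε : ℝ) ≤
    (Finset.range (n + 1)).sup' Finset.nonempty_range_add_one fun k => Z k ω}
  have hS : ∀ n ω, ω ∈ S n ↔ ∃ k, k ≤ n ∧ (ε : ℝ) ≤ Z k ω := fun n ω => by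
    simp only [S, Set.mem_ofPred_eq, Finset.le_sup'_iff, Finset.mem_range, Nat.lt_succ_iff]
  have hmono : Monotone S := fun i j hij ω hω => by
    rw [hS] at hω ⊢
    obtain ⟨k, hk, hk'⟩ := hω
    exact ⟨k, hk.trans hij, hk'⟩
  have hU : {ω | ∃ n, (ε : ℝ) ≤ Z n ω} = ⋃ n, S n := by
    ext ω
    simp only [Set.mem_ofPred_eq, Set.mem_iUnion, hS]
    exact ⟨fun ⟨n, hn⟩ => ⟨n, n, le_rfl, hn⟩, fun ⟨_, k, _, hk⟩ => ⟨k, hk⟩⟩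
  rw [hU, hmono.measure_iUnion, ENNReal.mul_iSup]
  refine iSup_le fun n => (maximal_ineq hZ h0 n).trans (ENNReal.ofReal_le_ofReal ?_)
  exact (setIntegral_le_integral (hZ.integrable n) (ae_of_all _ (h0 n))).trans (hK n)

end Maximal

/-- A value of a holomorphic function is controlled by the mean over a circle. -/
lemma norm_le_integral_norm_circleMap {g : ℂ → ℂ} {c w : ℂ} {R : ℝ} (hR : 0 < R)
    (hg : DifferentiableOn ℂ g (Metric.closedBall c R)) (hw : dist w c ≤ 2 * R / 3) :
    ‖g w‖ ≤ ∫ θ in Set.Ioc 0 (2 * Real.pi), ‖g (circleMap c R θ)‖ := by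
  have hcirc : ∀ θ, circleMap c R θ ∈ Metric.closedBall c R := fun θ =>
    circleMap_mem_closedBall c hR.le θ
  have hcont : Continuous fun θ => g (circleMap c R θ) :=
    hg.continuousOn.comp_continuous (continuous_circleMap c R) hcirc
  -- The Cauchy kernel times the radius is thus at most `3`, and `3 < 2π` leaves constant one in the
  -- conclusion.
  have hdist : ∀ θ, R / 3 ≤ ‖circleMap c R θ - w‖ := fun θ => by
    have h1 : dist (circleMap c R θ) c = R := by simp [dist_eq_norm, circleMap, abs_of_pos hR]
    have h2 := dist_triangle (circleMap c R θ) w c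
    rw [← dist_eq_norm]
    linarith
  have hne : ∀ θ, circleMap c R θ - w ≠ 0 := fun θ =>
    norm_pos_iff.1 ((by positivity : 0 < R / 3).trans_le (hdist θ))
  have hpi := Real.pi_gt_three
  have hpi0 : (0 : ℝ) ≤ 2 * Real.pi := by positivity
  have key := hg.circleIntegral_sub_inv_smul (w := w)
    (Metric.mem_ball.2 (hw.trans_lt (by linarith)))
  have h1 : 2 * Real.pi * ‖g w‖ ≤
      ∫ θ in (0 : ℝ)..2 * Real.pi, 3 * ‖g (circleMap c R θ)‖ := by
    calc 2 * Real.pi * ‖g w‖ = ‖(2 * Real.pi * Complex.I : ℂ) • g w‖ := by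
          simp [abs_of_pos Real.pi_pos]
      _ ≤ ∫ θ in (0 : ℝ)..2 * Real.pi,
          ‖deriv (circleMap c R) θ • (circleMap c R θ - w)⁻¹ • g (circleMap c R θ)‖ := by
          rw [← key, circleIntegral]
          exact intervalIntegral.norm_integral_le_integral_norm hpi0
      _ ≤ _ := by
          refine intervalIntegral.integral_mono_on hpi0 (Continuous.intervalIntegrable ?_ _ _)
            ((continuous_const.mul hcont.norm).intervalIntegrable _ _) fun θ _ => ?_
          · simp only [deriv_circleMap]
            have := (continuous_circleMap c R).sub (continuous_const (y := w))
            have h0 := continuous_circleMap 0 R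
            exact ((h0.mul continuous_const).smul ((this.inv₀ hne).smul hcont)).norm
          · rw [norm_smul, norm_smul, norm_inv, deriv_circleMap, norm_mul, Complex.norm_I, mul_one,
              norm_circleMap_zero, abs_of_pos hR, ← mul_assoc]
            refine mul_le_mul_of_nonneg_right ?_ (norm_nonneg _)
            rw [← div_eq_mul_inv, div_le_iff₀ (norm_pos_iff.2 (hne θ))]
            linarith [hdist θ]
  rw [intervalIntegral.integral_const_mul, intervalIntegral.integral_of_le hpi0] at h1
  have h2 : 0 ≤ ∫ θ in Set.Ioc 0 (2 * Real.pi), ‖g (circleMap c R θ)‖ :=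
    integral_nonneg fun _ => norm_nonneg _
  nlinarith [norm_nonneg (g w)]

/-- The filtration shifted in time. -/
def shiftFiltration {Ω : Type*} {m0 : MeasurableSpace Ω} (𝓕 : Filtration ℕ m0) (m : ℕ) :
    Filtration ℕ m0 where
  seq n := 𝓕 (m + n)
  mono' _ _ hij := 𝓕.mono (Nat.add_le_add_left hij m)
  le' n := 𝓕.le (m + n)

lemma martingale_shift_sub {Ω : Type*} {m0 : MeasurableSpace Ω} {P : Measure Ω}
    [IsFiniteMeasure P] {𝓕 : Filtration ℕ m0} {M : ℕ → Ω → ℂ} (hM : Martingale M 𝓕 P) (m : ℕ) :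
    Martingale (fun n => M (m + n) - M m) (shiftFiltration 𝓕 m) P := by
  have hmeas : ∀ n, StronglyMeasurable[𝓕 (m + n)] (M m) := fun n =>
    (hM.stronglyMeasurable m).mono (𝓕.mono (Nat.le_add_right m n))
  refine ⟨fun n => (hM.stronglyMeasurable (m + n)).sub (hmeas n), fun i j hij => ?_⟩
  have h1 := condExp_sub (hM.integrable (m + j)) (hM.integrable m) (𝓕 (m + i))
  have h2 := hM.condExp_ae_eq (Nat.add_le_add_left hij m)
  have h3 := condExp_of_stronglyMeasurable (𝓕.le (m + i)) (hmeas i) (hM.integrable m)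
  rw [h3] at h1
  exact h1.trans (h2.sub (EventuallyEq.refl _ _))

namespace IsStandardIID

variable {Ω : Type*} [MeasurableSpace Ω] {P : Measure Ω} {A B : ℕ → Ω → ℝ}
  (h : IsStandardIID P A B)
include h

/-- The maximal inequality for the chaos, uniformly over a disc of parameters. -/
lemma measure_exists_lt_norm_chaos_sub_le (f : C(unitInterval, ℂ)) {c : ℂ} {R τ : ℝ} (hR : 0 < R)
    (hRτ : R < τ) (hne : ∀ β ∈ Metric.closedBall c τ, ∀ k x, factor P A β k x ≠ 0)
    {m : ℕ} {K : ℝ} (hK : ∀ β ∈ Metric.closedBall c τ, ∀ n,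
      ∫ ω, ‖chaos P A B f β (m + n) ω - chaos P A B f β m ω‖ ∂P ≤ K) (ε : NNReal) :
    ε * P {ω | ∃ n, ∃ β ∈ Metric.closedBall c (2 * R / 3),
      ε ≤ ‖chaos P A B f β (m + n) ω - chaos P A B f β m ω‖} ≤
        ENNReal.ofReal (2 * Real.pi * K) := by
  have := h.prob
  let 𝓕 := coeffFiltration A B h.measurable_left h.measurable_right
  let ν : Measure ℝ := volume.restrict (Set.Ioc 0 (2 * Real.pi))
  let D : ℝ → ℕ → Ω → ℂ := fun θ n =>
    chaos P A B f (circleMap c R θ) (m + n) - chaos P A B f (circleMap c R θ) m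
  have hcirc : ∀ θ, circleMap c R θ ∈ Metric.closedBall c τ := fun θ =>
    Metric.closedBall_subset_closedBall hRτ.le (circleMap_mem_closedBall c hR.le θ)
  have hdiff : ∀ n ω, DifferentiableOn ℂ (fun β => chaos P A B f β n ω) (Metric.ball c τ) :=
    fun n ω => h.differentiableOn_chaos f Metric.isOpen_ball
      (fun β hβ => hne β (Metric.ball_subset_closedBall hβ)) n ω
  have hcont : ∀ n ω, Continuous fun θ => chaos P A B f (circleMap c R θ) n ω := fun n ω =>
    (hdiff n ω).continuousOn.comp_continuous (continuous_circleMap c R) fun θ =>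
      Metric.closedBall_subset_ball hRτ (circleMap_mem_closedBall c hR.le θ)
  have hmart : ∀ θ, Martingale (D θ) (shiftFiltration 𝓕 m) P := fun θ =>
    martingale_shift_sub (h.martingale_chaos f (hne _ (hcirc θ))) m
  -- Joint measurability follows from continuity in `θ` together with adaptedness at each fixed `θ`.
  have hmeas : ∀ n, StronglyMeasurable[(inferInstance : MeasurableSpace ℝ).prod
      (shiftFiltration 𝓕 m n)] (Function.uncurry fun θ ω => D θ n ω) := fun n =>
    @stronglyMeasurable_uncurry_of_continuous_of_stronglyMeasurable Ω ℂ ℝ _ _ _ _ _ _ _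
      (shiftFiltration 𝓕 m n) (fun θ ω => D θ n ω)
      (fun ω => (hcont (m + n) ω).sub (hcont m ω)) fun θ => (hmart θ).stronglyMeasurable n
  have hint : ∀ n, Integrable (Function.uncurry fun θ ω => D θ n ω) (ν.prod P) := by
    intro n
    have h1 : ∀ k, Integrable (Function.uncurry fun θ ω => chaos P A B f (circleMap c R θ) k ω)
        (ν.prod P) := fun k => by
      obtain ⟨C, t, hC⟩ := h.exists_norm_chaos_le_of_isCompact f
        (isCompact_closedBall c τ) hne k
      refine Integrable.mono' (((h.integrable_exp_majorant t k).comp_snd ν).const_mul C) ?_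
        (ae_of_all _ fun p => hC _ (hcirc p.1) p.2)
      exact (stronglyMeasurable_uncurry_of_continuous_of_stronglyMeasurable (hcont k)
        fun θ => (h.measurable_chaos f _ k).stronglyMeasurable).aestronglyMeasurable
    exact (h1 (m + n)).sub (h1 m)
  have hsub := submartingale_integral_norm hmart hmeas hint
  have hZ : ∀ n, ∫ ω, ∫ θ, ‖D θ n ω‖ ∂ν ∂P ≤ 2 * Real.pi * K := by
    intro n
    have h2 : Integrable (Function.uncurry fun θ ω => ‖D θ n ω‖) (ν.prod P) := (hint n).norm
    rw [← integral_integral_swap h2]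
    calc ∫ θ, ∫ ω, ‖D θ n ω‖ ∂P ∂ν ≤ ∫ _, K ∂ν :=
          integral_mono h2.integral_prod_left (integrable_const _) fun θ => hK _ (hcirc θ) n
      _ = 2 * Real.pi * K := by
          rw [integral_const]
          simp [ν, Measure.real, Real.pi_pos.le]
  refine le_trans (mul_le_mul_right ?_ _) (measure_exists_le_mul_le hsub
    (fun n ω => integral_nonneg fun _ => norm_nonneg _) hZ ε)
  refine measure_mono fun ω => ?_
  rintro ⟨n, β, hβ, hε⟩
  refine ⟨n, hε.trans ?_⟩
  exact norm_le_integral_norm_circleMap (g := fun β => chaos P A B f β (m + n) ω -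
    chaos P A B f β m ω) hR (((hdiff (m + n) ω).sub (hdiff m ω)).mono
      (Metric.closedBall_subset_ball hRτ)) hβ

/-- Almost surely the chaos is uniformly Cauchy over a disc of parameters. -/
lemma ae_uniformCauchySeqOn_chaos (f : C(unitInterval, ℂ)) {c : ℂ} {R τ : ℝ} (hR : 0 < R)
    (hRτ : R < τ) (hne : ∀ β ∈ Metric.closedBall c τ, ∀ k x, factor P A β k x ≠ 0)
    {r : ℝ} (hr : 1 ≤ r) {u : ℕ → ENNReal} (hu : Tendsto u atTop (𝓝 0))
    (hle : ∀ β ∈ Metric.closedBall c τ, ∀ m n, m ≤ n →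
      eLpNorm (chaos P A B f β n - chaos P A B f β m) (ENNReal.ofReal r) P ≤ u m) :
    ∀ᵐ ω ∂P, UniformCauchySeqOn (fun n β => chaos P A B f β n ω) atTop
      (Metric.closedBall c (2 * R / 3)) := by
  have := h.prob
  let S : ℝ → ℕ → Set Ω := fun ε m => {ω | ∃ n, ∃ β ∈ Metric.closedBall c (2 * R / 3),
    ε ≤ ‖chaos P A B f β (m + n) ω - chaos P A B f β m ω‖}
  -- Intersecting over the starting time `m` avoids Borel–Cantelli: `u m → 0` suffices, without a
  -- rate.
  have hS : ∀ ε : NNReal, 0 < ε → P (⋂ m, S ε m) = 0 := by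
    intro ε hε
    have h1 : ∀ᶠ m in atTop, ε * P (⋂ m, S ε m) ≤ ENNReal.ofReal (2 * Real.pi) * u m := by
      filter_upwards [hu.eventually (gt_mem_nhds ENNReal.zero_lt_top)] with m hm
      refine le_trans (mul_le_mul_right (measure_mono (Set.iInter_subset _ m)) _) ?_
      refine (h.measure_exists_lt_norm_chaos_sub_le f hR hRτ hne (m := m) (K := (u m).toReal)
        (fun β hβ n => ?_) ε).trans ?_
      · have hi : Integrable (chaos P A B f β (m + n) - chaos P A B f β m) P :=
          (h.integrable_chaos f (hne β hβ) _).sub (h.integrable_chaos f (hne β hβ) _)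
        have h2 := integral_norm_eq_lintegral_enorm hi.aestronglyMeasurable
        simp only [Pi.sub_apply] at h2
        rw [h2]
        refine ENNReal.toReal_mono hm.ne ?_
        refine le_trans ?_ (hle β hβ m (m + n) (Nat.le_add_right m n))
        refine le_trans ?_ (eLpNorm_le_eLpNorm_of_exponent_le
          (ENNReal.one_le_ofReal.2 hr) hi.aestronglyMeasurable)
        rw [eLpNorm_one_eq_lintegral_enorm]
        rfl
      · rw [ENNReal.ofReal_mul (by positivity), ENNReal.ofReal_toReal hm.ne]
    have h2 := ENNReal.Tendsto.const_mul (a := ENNReal.ofReal (2 * Real.pi)) hu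
      (Or.inr ENNReal.ofReal_ne_top)
    rw [mul_zero] at h2
    have h3 := ge_of_tendsto h2 h1
    simpa [hε.ne'] using h3
  have hae : ∀ᵐ ω ∂P, ∀ j : ℕ, ω ∉ ⋂ m, S ((1 / ((j : NNReal) + 1) : NNReal)) m :=
    ae_all_iff.2 fun j => measure_eq_zero_iff_ae_notMem.1 (hS _ (by positivity))
  filter_upwards [hae] with ω hω
  refine Metric.uniformCauchySeqOn_iff.2 fun ε hε => ?_
  obtain ⟨j, hj⟩ := exists_nat_one_div_lt (half_pos hε)
  have hωj := hω j
  simp only [Set.mem_iInter, not_forall] at hωj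
  obtain ⟨m, hm⟩ := hωj
  simp only [S, Set.mem_ofPred_eq, not_exists, not_and, not_le] at hm
  have hd : ∀ k, m ≤ k → ∀ β ∈ Metric.closedBall c (2 * R / 3),
      dist (chaos P A B f β k ω) (chaos P A B f β m ω) < ε / 2 := by
    intro k hk β hβ
    obtain ⟨n, rfl⟩ := Nat.exists_eq_add_of_le hk
    rw [dist_eq_norm]
    refine (hm n β hβ).trans ?_
    push_cast
    exact hj
  refine ⟨m, fun k hk l hl β hβ => ?_⟩
  refine (dist_triangle_right _ _ (chaos P A B f β m ω)).trans_lt ?_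
  linarith [hd k hk β hβ, hd l hl β hβ]

end IsStandardIID

/-! ### The limit and its identification in `Lʳ` -/

/-- The pointwise limit of the chaos. -/
noncomputable def chaosLimit {Ω : Type*} [MeasurableSpace Ω] (P : Measure Ω) (A B : ℕ → Ω → ℝ)
    (f : C(unitInterval, ℂ)) (β : ℂ) (ω : Ω) : ℂ :=
  limUnder atTop fun n => chaos P A B f β n ω

namespace IsStandardIID

variable {Ω : Type*} [MeasurableSpace Ω] {P : Measure Ω} {A B : ℕ → Ω → ℝ}
  (h : IsStandardIID P A B)
include h

lemma exists_disc {b : ℝ} (hb0 : 0 < b) (hb : b < √2) :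
    ∃ ρ, 0 < ρ ∧ ∃ r : ℝ, 1 < r ∧
      (∀ β ∈ Metric.closedBall (b : ℂ) ρ, ∀ k x, factor P A β k x ≠ 0) ∧
      ∀ f : C(unitInterval, ℂ),
        (∃ u : ℕ → ENNReal, Tendsto u atTop (𝓝 0) ∧
          ∀ β ∈ Metric.closedBall (b : ℂ) ρ, ∀ m n, m ≤ n →
            eLpNorm (chaos P A B f β n - chaos P A B f β m) (ENNReal.ofReal r) P ≤ u m) ∧
        ∀ᵐ ω ∂P, TendstoUniformlyOn (fun n β => chaos P A B f β n ω)
          (fun β => chaosLimit P A B f β ω) atTop (Metric.closedBall (b : ℂ) ρ) := by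
  obtain ⟨τ, hτ, r, hr, hne, hf⟩ := h.exists_uniform_cauchy hb0 hb
  have hsub : Metric.closedBall (b : ℂ) (τ / 2) ⊆ Metric.closedBall (b : ℂ) τ :=
    Metric.closedBall_subset_closedBall (by linarith)
  refine ⟨τ / 2, by positivity, r, hr, fun β hβ => hne β (hsub hβ), fun f => ?_⟩
  obtain ⟨u, hu, hle⟩ := hf f
  refine ⟨⟨u, hu, fun β hβ => hle β (hsub hβ)⟩, ?_⟩
  -- The circle of radius `3τ / 4` lies inside the disc of radius `τ` and controls the disc of
  -- radius `2/3` of its own, `τ / 2`.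
  have hae := h.ae_uniformCauchySeqOn_chaos f (R := 3 * τ / 4) (by positivity) (by linarith) hne
    hr.le hu hle
  rw [show 2 * (3 * τ / 4) / 3 = τ / 2 by ring] at hae
  filter_upwards [hae] with ω hω
  exact hω.tendstoUniformlyOn_of_tendsto fun β hβ => CauchySeq.tendsto_limUnder (hω.cauchySeq hβ)

/-- Fatou's lemma carries the Cauchy estimate to the almost sure limit, so the pointwise and the
`Lʳ` limit are the same random variable. -/
lemma chaos_tendsto_eLpNorm (f : C(unitInterval, ℂ)) {β : ℂ}
    (hne : ∀ k x, factor P A β k x ≠ 0) {r : ℝ} (hr : 1 ≤ r) {u : ℕ → ENNReal}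
    (hu : Tendsto u atTop (𝓝 0))
    (hle : ∀ m n, m ≤ n →
      eLpNorm (chaos P A B f β n - chaos P A B f β m) (ENNReal.ofReal r) P ≤ u m)
    (hlim : ∀ᵐ ω ∂P, Tendsto (fun n => chaos P A B f β n ω) atTop
      (𝓝 (chaosLimit P A B f β ω))) :
    MemLp (chaosLimit P A B f β) (ENNReal.ofReal r) P ∧
      Tendsto (fun n => eLpNorm (chaos P A B f β n - chaosLimit P A B f β) (ENNReal.ofReal r) P)
        atTop (𝓝 0) := by
  have := h.prob
  have hmeas : AEStronglyMeasurable (chaosLimit P A B f β) P :=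
    aestronglyMeasurable_of_tendsto_ae atTop
      (fun n => (h.measurable_chaos f β n).aestronglyMeasurable) hlim
  have hbd : ∀ m, eLpNorm (chaosLimit P A B f β - chaos P A B f β m) (ENNReal.ofReal r) P ≤
      u m := by
    intro m
    refine (Lp.eLpNorm_lim_le_liminf_eLpNorm
      (f := fun n => chaos P A B f β n - chaos P A B f β m)
      (fun n => ((h.measurable_chaos f β n).sub
        (h.measurable_chaos f β m)).aestronglyMeasurable) _ ?_).trans ?_
    · filter_upwards [hlim] with ω hω using hω.sub_const _
    · refine liminf_le_of_frequently_le' (Eventually.frequently ?_)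
      filter_upwards [eventually_ge_atTop m] with n hn using hle m n hn
  have hr0 : 0 < r := by linarith
  obtain ⟨m, hm⟩ := (hu.eventually (gt_mem_nhds ENNReal.zero_lt_top)).exists
  constructor
  · have h1 : MemLp (chaosLimit P A B f β - chaos P A B f β m) (ENNReal.ofReal r) P :=
      ⟨hmeas.sub (h.measurable_chaos f β m).aestronglyMeasurable, (hbd m).trans_lt hm⟩
    simpa using h1.add (h.memLp_chaos f hne m hr0)
  · refine tendsto_of_tendsto_of_tendsto_of_le_of_le tendsto_const_nhds hu (fun _ => zero_le)
      fun n => ?_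
    rw [eLpNorm_sub_comm]
    exact hbd n

end IsStandardIID

end FourierChaos

/-! ### Gluing the discs -/

theorem theorem1p1 {Ω : Type*} [MeasurableSpace Ω] (P : Measure Ω) [IsProbabilityMeasure P]
    (A B : ℕ → Ω → ℝ) (hA : ∀ k, Measurable (A k)) (hB : ∀ k, Measurable (B k))
    (hindep : iIndepFun (Sum.elim A B) P)
    (hidentA : ∀ k, IdentDistrib (A k) (A 0) P P)
    (hidentB : ∀ k, IdentDistrib (B k) (A 0) P P)
    (hmean : ∫ ω, A 0 ω ∂P = 0)
    (hvar : variance (A 0) P = 1)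
    (hexp : ∀ t : ℝ, Integrable (fun ω => Real.exp (t * A 0 ω)) P) :
    ∃ U : Set ℂ, IsOpen U ∧ (∀ t : ℝ, 0 < t → t < √2 → (t : ℂ) ∈ U) ∧
      -- the measures are well defined for every parameter in `U`
      (∀ β ∈ U, ∀ (n : ℕ) (x : unitInterval), FourierChaos.normalizer P A B β n x ≠ 0) ∧
      (∀ β ∈ U, ∀ f : C(unitInterval, ℂ),
        Martingale (FourierChaos.chaos P A B f β) (FourierChaos.coeffFiltration A B hA hB) P) ∧
      ∃ μ : C(unitInterval, ℂ) → ℂ → Ω → ℂ,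
        -- convergence in `L^p`, with `p` uniform over the compact set and over `f`
        (∀ K : Set ℂ, K ⊆ U → IsCompact K → ∃ p : ℝ, 1 < p ∧
          ∀ β ∈ K, ∀ f : C(unitInterval, ℂ),
            (∀ n, MemLp (FourierChaos.chaos P A B f β n) (ENNReal.ofReal p) P) ∧
            MemLp (μ f β) (ENNReal.ofReal p) P ∧
            Tendsto
              (fun n => eLpNorm (FourierChaos.chaos P A B f β n - μ f β) (ENNReal.ofReal p) P)
              atTop (𝓝 0)) ∧
        -- almost sure locally uniform convergence to an analytic function of `β`
        (∀ f : C(unitInterval, ℂ), ∀ᵐ ω ∂P,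
          (∀ K : Set ℂ, K ⊆ U → IsCompact K →
            TendstoUniformlyOn (fun n β => FourierChaos.chaos P A B f β n ω)
              (fun β => μ f β ω) atTop K) ∧
          AnalyticOnNhd ℂ (fun β => μ f β ω) U) := by
  have h : FourierChaos.IsStandardIID P A B :=
    ⟨inferInstance, hA, hB, hindep, hidentA, hidentB, hmean, hvar, hexp⟩
  choose! ρ hρ r hr hne hf using fun (b : Set.Ioo 0 √2) => h.exists_disc b.2.1 b.2.2
  have hsub : ∀ b : Set.Ioo 0 √2, Metric.ball ((b : ℝ) : ℂ) (ρ b) ⊆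
      Metric.closedBall ((b : ℝ) : ℂ) (ρ b) := fun b => Metric.ball_subset_closedBall
  have hU : IsOpen (⋃ b : Set.Ioo 0 √2, Metric.ball ((b : ℝ) : ℂ) (ρ b)) :=
    isOpen_iUnion fun b => Metric.isOpen_ball
  have hneU : ∀ β ∈ ⋃ b : Set.Ioo 0 √2, Metric.ball ((b : ℝ) : ℂ) (ρ b), ∀ k x,
      FourierChaos.factor P A β k x ≠ 0 := fun β hβ => by
    obtain ⟨b, hb⟩ := Set.mem_iUnion.1 hβ
    exact hne b β (hsub b hb)
  refine ⟨⋃ b : Set.Ioo 0 √2, Metric.ball ((b : ℝ) : ℂ) (ρ b), hU, fun t ht0 ht => ?_,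
    fun β hβ n x => ?_, fun β hβ f => h.martingale_chaos f (hneU β hβ),
    FourierChaos.chaosLimit P A B, fun K hKU hK => ?_, fun f => ?_⟩
  · exact Set.mem_iUnion.2 ⟨⟨t, ht0, ht⟩, Metric.mem_ball_self (hρ _)⟩
  · rw [h.normalizer_eq]
    exact Finset.prod_ne_zero_iff.2 fun k _ => hneU β hβ k x
  · obtain ⟨T, hT⟩ := hK.elim_finite_subcover _ (fun b => Metric.isOpen_ball) hKU
    -- A finite subcover leaves finitely many exponents `r b > 1`, and `p` is the least; `2` is a
    -- default when the subcover is empty.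
    obtain ⟨p, hp, hpT⟩ : ∃ p : ℝ, 1 < p ∧ ∀ b ∈ T, p ≤ r b := by
      rcases T.eq_empty_or_nonempty with rfl | hne'
      · exact ⟨2, one_lt_two, by simp⟩
      · exact ⟨T.inf' hne' r, (Finset.lt_inf'_iff _).2 fun b _ => hr b,
          fun b hb => Finset.inf'_le _ hb⟩
    refine ⟨p, hp, fun β hβ f => ?_⟩
    obtain ⟨b, hbT, hb⟩ := Set.mem_iUnion₂.1 (hT hβ)
    have hpr : ENNReal.ofReal p ≤ ENNReal.ofReal (r b) := ENNReal.ofReal_le_ofReal (hpT b hbT)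
    have hβne := hne b β (hsub b hb)
    obtain ⟨⟨u, hu, hle⟩, hae⟩ := hf b f
    obtain ⟨hmem, hlim⟩ := h.chaos_tendsto_eLpNorm f hβne (hr b).le hu (hle β (hsub b hb))
      (hae.mono fun ω hω => hω.tendsto_at (hsub b hb))
    refine ⟨fun n => h.memLp_chaos f hβne n (by linarith), hmem.mono_exponent hpr,
      tendsto_of_tendsto_of_tendsto_of_le_of_le tendsto_const_nhds hlim (fun _ => zero_le)
        fun n => ?_⟩
    exact eLpNorm_le_eLpNorm_of_exponent_le hpr
      ((h.measurable_chaos f β n).aestronglyMeasurable.sub hmem.aestronglyMeasurable)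
  -- A countable subfamily already covers `U`, so the exceptional null sets of the discs have a null
  -- union.
  · obtain ⟨T, hT, hTU⟩ := TopologicalSpace.isOpen_iUnion_countable
      (fun b : Set.Ioo 0 √2 => Metric.ball ((b : ℝ) : ℂ) (ρ b)) fun b => Metric.isOpen_ball
    filter_upwards [(ae_ball_iff hT).2 fun b _ => (hf b f).2] with ω hω
    have hloc : TendstoLocallyUniformlyOn (fun n β => FourierChaos.chaos P A B f β n ω)
        (fun β => FourierChaos.chaosLimit P A B f β ω) atTop
        (⋃ b : Set.Ioo 0 √2, Metric.ball ((b : ℝ) : ℂ) (ρ b)) := by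
      rw [← hTU]
      exact tendstoLocallyUniformlyOn_biUnion (fun b _ => Metric.isOpen_ball) fun b hb =>
        ((hω b hb).mono (hsub b)).tendstoLocallyUniformlyOn
    refine ⟨fun K hKU hK => (tendstoLocallyUniformlyOn_iff_forall_isCompact hU).1 hloc K hKU hK,
      DifferentiableOn.analyticOnNhd ?_ hU⟩
    exact hloc.differentiableOn (Eventually.of_forall fun n =>
      h.differentiableOn_chaos f hU hneU n ω) hU
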